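/- **Effective behavior in the moving frame.** Let $Y=(-\pi,\pi)^2$ and let $a_Y\in C^1(\mathbb{R}^2,\mathbb{R}^{2\times2})$ be $Y$-periodic, symmetric at every point, and uniformly positive definite: $\sum_{ij}(a_Y(y))_{ij}\xi_i\xi_j\ge\gamma|\xi|^2$ for some $\gamma>0$ and all $y,\xi\in\mathbb{R}^2$. Let $a_Y$ be evenly symmetric in both coordinates, in the sense that $a_Y(Ry)=R\,a_Y(y)\,R$ for all $y\in\mathbb{R}^2$ and for both reflections $R=\mathrm{diag}(-1,1)$ and $R=\mathrm{diag}(1,-1)$ (for fields of diagonal matrices, in particular for scalar media $a_Y=\tilde a_Y I$, this says $a_Y(y_1,y_2)=a_Y(-y_1,y_2)=a_Y(y_1,-y_2)$). For $k\in\mathbb{R}^2$ let $\mu_0(k)$ be the smallest eigenvalue of $-(\nabla+ik)\cdot(a_Y(\nabla+ik)\psi)=\mu\psi$, $\psi\in H^1_{\mathrm{per}}(Y)$ (weak formulation), and let $A_{lm}=\frac12\partial_l\partial_m\mu_0(0)$ and $C_{lmnq}=\frac1{24}\partial_l\partial_m\partial_n\partial_q\mu_0(0)$ be its Taylor coefficients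 of order two and four at $k=0$. Put $a_i=A_{ii}$, $\alpha_i=C_{iiii}$, $\beta=C_{1122}$. Write $MD^2=\sum M_{ij}\partial_i\partial_j$ and $GD^4=\sum G_{ijkl}\partial_i\partial_j\partial_k\partial_l$. Let $E\in\mathbb{R}^{2\times2}$ and $F\in\mathbb{R}^{2\times2\times2\times2}$ be symmetric and positive semi-definite ($E_{ij}=E_{ji}$, $\sum E_{ij}\eta_i\eta_j\ge0$, $F_{ijkl}=F_{klij}$, $\sum F_{ijkl}\xi_{ij}\xi_{kl}\ge0$) with $-CD^4=ED^2AD^2-FD^4$. Let $T>0$, let $\varepsilon=\varepsilon_n>0$ be a sequence with $\varepsilon_n\to0$, let $f^\varepsilon\in H^2(\mathbb{R}^2)$ be real initial data (which may, but need not, depend on $\varepsilon$), and let $w^\varepsilon\in L^\infty(0,T\varepsilon^{-2};H^2(\mathbb{R}^2))\cap W^{1,\infty}(0,T\varepsilon^{-2};H^1(\mathbb{R}^2))$ be a weak solution on $\mathbb{R}^2\times(0,T\varepsilon^{-2})$ of $$\partial_t^2w^\varepsilon-AD^2w^\varepsilon-\varepsilon^2\partial_t^2ED^2w^\varepsilon+\varepsilon^2FD^4w^\varepsilon=0,\qquad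 w^\varepsilon(\cdot,0)=f^\varepsilon,\quad\partial_tw^\varepsilon(\cdot,0)=0 .$$ Express $w^\varepsilon$ in the elliptic coordinates $x=(r\sqrt{a_1}\cos\varphi,\,r\sqrt{a_2}\sin\varphi)$ and set $$W^\varepsilon(r,\varphi,t)=w^\varepsilon\Big(r+\frac t{\varepsilon^2},\varphi,\frac t{\varepsilon^2}\Big)\ \text{ for } r>-t\varepsilon^{-2},\qquad W^\varepsilon(r,\varphi,t)=0\ \text{ for } r\le-t\varepsilon^{-2}.$$ Assume that $W^\varepsilon\to W$ in $\mathcal D'(\mathbb{R}\times\mathbb{R}\times(0,T))$ for a distribution $W$. Then $A=\mathrm{diag}(a_1,a_2)$ with $a_1,a_2>0$, and $U:=\partial_rW$ satisfies the linearized cylindrical Korteweg-de Vries equation $$\partial_tU+\frac1{2t}U-\frac12\kappa(\varphi)\,\partial_r^3U=0$$ in the sense of distributions on $\mathbb{R}\times\mathbb{R}\times(0,T)$. Here $$\kappa(\varphi)=\sum_{ijkl}C_{ijkl}\xi_i\xi_j\xi_k\xi_l=6\beta\frac{\cos^2\varphi}{a_1}\frac{\sin^2\varphi}{a_2}+\alpha_1\frac{\cos^4\varphi}{a_1^2}+\alpha_2\frac{\sin^4\varphi}{a_2^2},\qquad\xi=\Big(\frac{\cos\varphi}{\sqrt{a_1}},\frac{\sin\varphi}{\sqrt{a_2}}\Big).$$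 -/

import Mathlib

open MeasureTheory Filter Topology Set
open scoped ContDiff Distributions LineDeriv ComplexConjugate

namespace MovingFrame

noncomputable section

/-- The plane `ℝ²` with its Euclidean structure. -/
abbrev Plane : Type := EuclideanSpace ℝ (Fin 2)

/-- The `i`-th standard unit vector of the plane. -/
def unitVec (i : Fin 2) : Plane := EuclideanSpace.single i (1 : ℝ)

/-- Tensors of order four on the plane. -/
abbrev Tensor4 : Type := Fin 2 → Fin 2 → Fin 2 → Fin 2 → ℝ

/-! ### The periodic medium -/

/-- The open unit cell `Y = (-π, π)²`. -/
def cell : Set Plane := {y | ∀ i, y i ∈ Ioo (-Real.pi) Real.pi}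

/-- Functions on the plane that are `2π`-periodic in each coordinate. -/
def CellPeriodic {β : Type*} (u : Plane → β) : Prop :=
  ∀ (m : Fin 2) (y : Plane), u (y + (2 * Real.pi) • unitVec m) = u y

/-- The coefficient field of the medium: `Y`-periodic, of class `C¹`, pointwise symmetric and
uniformly positive definite. -/
structure IsMedium (aY : Plane → Matrix (Fin 2) (Fin 2) ℝ) : Prop where
  periodic : CellPeriodic aY
  contDiff : ∀ i j, ContDiff ℝ 1 (fun y => aY y i j)
  symm : ∀ y, (aY y).IsSymm
  posDef : ∃ γ : ℝ, 0 < γ ∧ ∀ (y ξ : Plane), γ * ‖ξ‖ ^ 2 ≤ ∑ i, ∑ j, aY y i j * ξ i * ξ j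

/-- The sign of the `i`-th diagonal entry of the reflection matrix of the `m`-th coordinate. -/
def reflSign (m i : Fin 2) : ℝ := if i = m then -1 else 1

/-- The reflection of the plane in the `m`-th coordinate. -/
def refl (m : Fin 2) (y : Plane) : Plane := WithLp.toLp 2 (fun i => reflSign m i * y i)

/-- Even symmetry of a matrix field in both coordinates: the field is invariant under the two
coordinate reflections `R`, that is `a(R y) = R a(y) R`. Entrywise: the diagonal entries are even
and the off-diagonal entries are odd in each coordinate. -/
def EvenlySymmetric (aY : Plane → Matrix (Fin 2) (Fin 2) ℝ) : Prop :=
  ∀ (m : Fin 2) (y : Plane) (i j : Fin 2),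
    aY (refl m y) i j = reflSign m i * aY y i j * reflSign m j

/-- For fields of diagonal matrices, even symmetry just says that the field is an even function
of each coordinate. -/
theorem evenlySymmetric_iff_of_isDiag (aY : Plane → Matrix (Fin 2) (Fin 2) ℝ)
    (hd : ∀ y, (aY y).IsDiag) :
    EvenlySymmetric aY ↔ ∀ (m : Fin 2) (y : Plane), aY (refl m y) = aY y := by
  have key : ∀ (m : Fin 2) (y : Plane) (i j : Fin 2),
      reflSign m i * aY y i j * reflSign m j = aY y i j := by
    intro m y i j
    by_cases hij : i = j
    · subst hij
      unfold reflSign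
      split_ifs <;> ring
    · rw [hd y hij]
      ring
  constructor
  · intro h m y
    ext i j
    rw [h m y i j, key]
  · intro h m y i j
    rw [h m y, key]

/-! ### The Bloch eigenvalue and the effective coefficients -/

/-- `ψ` belongs to `H¹_per(Y)` and has the weak gradient `g`. -/
structure IsH1per (ψ : Plane → ℂ) (g : Fin 2 → Plane → ℂ) : Prop where
  periodic : CellPeriodic ψ
  periodic_grad : ∀ i, CellPeriodic (g i)
  memLp : MemLp ψ 2 (volume.restrict cell)
  memLp_grad : ∀ i, MemLp (g i) 2 (volume.restrict cell)
  weak_grad : ∀ χ : Plane → ℂ, ContDiff ℝ ∞ χ → CellPeriodic χ → ∀ i,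
    ∫ y in cell, ψ y * fderiv ℝ χ y (unitVec i) = -∫ y in cell, g i y * χ y

/-- `μ` is an eigenvalue of `-(∇ + i k) · (a_Y (∇ + i k) ψ) = μ ψ` on `H¹_per(Y)`, in the usual
weak formulation. -/
def IsBlochEigenvalue (aY : Plane → Matrix (Fin 2) (Fin 2) ℝ) (k : Plane) (μ : ℝ) : Prop :=
  ∃ (ψ : Plane → ℂ) (g : Fin 2 → Plane → ℂ), IsH1per ψ g ∧
    (¬ ψ =ᵐ[volume.restrict cell] 0) ∧
    ∀ (χ : Plane → ℂ) (h : Fin 2 → Plane → ℂ), IsH1per χ h →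
      ∫ y in cell, ∑ i, ∑ j, (aY y i j : ℂ) * (g j y + Complex.I * (k j : ℂ) * ψ y) *
          conj (h i y + Complex.I * (k i : ℂ) * χ y)
        = (μ : ℂ) * ∫ y in cell, ψ y * conj (χ y)

/-- The smallest Bloch eigenvalue `μ₀(k)`. -/
def blochMin (aY : Plane → Matrix (Fin 2) (Fin 2) ℝ) (k : Plane) : ℝ :=
  sInf {μ : ℝ | IsBlochEigenvalue aY k μ}

/-- The matrix `A` of the second order Taylor coefficients of `μ₀` at `k = 0`:
`A_{lm} = ½ ∂_l ∂_m μ₀(0)`. -/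
def effA (aY : Plane → Matrix (Fin 2) (Fin 2) ℝ) : Matrix (Fin 2) (Fin 2) ℝ :=
  fun l m => (1 / 2) * iteratedFDeriv ℝ 2 (blochMin aY) 0 ![unitVec l, unitVec m]

/-- The tensor `C` of the fourth order Taylor coefficients of `μ₀` at `k = 0`:
`C_{lmnq} = (1/24) ∂_l ∂_m ∂_n ∂_q μ₀(0)`. -/
def effC (aY : Plane → Matrix (Fin 2) (Fin 2) ℝ) : Tensor4 :=
  fun l m n q => (1 / 24) *
    iteratedFDeriv ℝ 4 (blochMin aY) 0 ![unitVec l, unitVec m, unitVec n, unitVec q]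

/-! ### Constant coefficient operators and the decomposition of `C D⁴` -/

/-- The partial derivative `∂_i u`. -/
def pd (i : Fin 2) (u : Plane → ℝ) : Plane → ℝ := fun x => fderiv ℝ u x (unitVec i)

/-- `M D² u = ∑ M_{ij} ∂_i ∂_j u`. -/
def opD2 (M : Matrix (Fin 2) (Fin 2) ℝ) (u : Plane → ℝ) : Plane → ℝ :=
  fun x => ∑ i, ∑ j, M i j * pd i (pd j u) x

/-- `G D⁴ u = ∑ G_{ijkl} ∂_i ∂_j ∂_k ∂_l u`. -/
def opD4 (G : Tensor4) (u : Plane → ℝ) : Plane → ℝ :=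
  fun x => ∑ i, ∑ j, ∑ k, ∑ l, G i j k l * pd i (pd j (pd k (pd l u))) x

/-- Symmetric positive semi-definite tensors of order four: `F_{ijkl} = F_{klij}` and
`∑ F_{ijkl} ξ_{ij} ξ_{kl} ≥ 0`. -/
def IsPosSemidef4 (F : Tensor4) : Prop :=
  (∀ i j k l, F i j k l = F k l i j) ∧
  ∀ ξ : Matrix (Fin 2) (Fin 2) ℝ, 0 ≤ ∑ i, ∑ j, ∑ k, ∑ l, F i j k l * ξ i j * ξ k l

/-- `-C D⁴ = E D² A D² - F D⁴` as differential operators. -/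
def IsDecomposition (A : Matrix (Fin 2) (Fin 2) ℝ) (C : Tensor4)
    (E : Matrix (Fin 2) (Fin 2) ℝ) (F : Tensor4) : Prop :=
  ∀ u : Plane → ℝ, ContDiff ℝ ∞ u → ∀ x, -opD4 C u x = opD2 E (opD2 A u) x - opD4 F u x

/-! ### The weakly dispersive equation -/

/-- On the open set `S`, the function `g` is the weak derivative of `u` in direction `v`. -/
def HasWeakDerivOn {X : Type*} [NormedAddCommGroup X] [NormedSpace ℝ X] [MeasureSpace X]
    (S : Set X) (v : X) (u g : X → ℝ) : Prop :=
  ∀ φ : X → ℝ, ContDiff ℝ ∞ φ → HasCompactSupport φ → tsupport φ ⊆ S →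
    ∫ x in S, u x * fderiv ℝ φ x v = -∫ x in S, g x * φ x

/-- The Sobolev space `H²(ℝ²)`. -/
def MemH2 (f : Plane → ℝ) : Prop :=
  MemLp f 2 volume ∧
  ∃ (g : Fin 2 → Plane → ℝ) (h : Fin 2 → Fin 2 → Plane → ℝ),
    (∀ i, MemLp (g i) 2 volume ∧ HasWeakDerivOn univ (unitVec i) f (g i)) ∧
    (∀ i j, MemLp (h i j) 2 volume ∧ HasWeakDerivOn univ (unitVec j) (g i) (h i j))

/-- The space-time slab `ℝ² × (0, τ)`. -/
def slab (τ : ℝ) : Set (Plane × ℝ) := univ ×ˢ Ioo 0 τ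

/-- `L^∞(0, τ; L²(ℝ²))`. -/
def MemLinftyL2 (τ : ℝ) (g : Plane × ℝ → ℝ) : Prop :=
  AEStronglyMeasurable g (volume.restrict (slab τ)) ∧
  ∃ M : NNReal, ∀ᵐ t ∂(volume.restrict (Ioo 0 τ)), eLpNorm (fun x => g (x, t)) 2 volume ≤ M

/-- `L^∞(0, τ; H²(ℝ²)) ∩ W^{1,∞}(0, τ; H¹(ℝ²))`. -/
def MemSolutionSpace (τ : ℝ) (w : Plane × ℝ → ℝ) : Prop :=
  MemLinftyL2 τ w ∧
  ∃ (g : Fin 2 → Plane × ℝ → ℝ) (h : Fin 2 → Fin 2 → Plane × ℝ → ℝ)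
    (wt : Plane × ℝ → ℝ) (gt : Fin 2 → Plane × ℝ → ℝ),
    (∀ i, MemLinftyL2 τ (g i) ∧ HasWeakDerivOn (slab τ) (unitVec i, 0) w (g i)) ∧
    (∀ i j, MemLinftyL2 τ (h i j) ∧ HasWeakDerivOn (slab τ) (unitVec j, 0) (g i) (h i j)) ∧
    MemLinftyL2 τ wt ∧ HasWeakDerivOn (slab τ) (0, 1) w wt ∧
    (∀ i, MemLinftyL2 τ (gt i) ∧ HasWeakDerivOn (slab τ) (unitVec i, 0) wt (gt i))

/-- `∂_t^n φ` for a function of `(x, t)`. -/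
def dt (n : ℕ) (φ : Plane × ℝ → ℝ) (x : Plane) (t : ℝ) : ℝ := iteratedDeriv n (fun s => φ (x, s)) t

/-- `w` is a weak solution on `ℝ² × (0, τ)` of
`∂_t² w - A D² w - ε² ∂_t² E D² w + ε² F D⁴ w = 0` with `w(·, 0) = f` and `∂_t w(·, 0) = 0`.
The initial conditions are imposed through test functions that need not vanish at `t = 0`. -/
structure IsWeakSolution (A E : Matrix (Fin 2) (Fin 2) ℝ) (F : Tensor4) (ε τ : ℝ)
    (f : Plane → ℝ) (w : Plane × ℝ → ℝ) : Prop where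
  memSolutionSpace : MemSolutionSpace τ w
  weak_eq : ∀ φ : Plane × ℝ → ℝ, ContDiff ℝ ∞ φ → HasCompactSupport φ →
    tsupport φ ⊆ univ ×ˢ Iio τ →
    (∫ p in slab τ, w p *
        (dt 2 φ p.1 p.2
          - opD2 A (fun x => φ (x, p.2)) p.1
          - ε ^ 2 * opD2 E (fun x => dt 2 φ x p.2) p.1
          + ε ^ 2 * opD4 F (fun x => φ (x, p.2)) p.1))
      + ∫ x, f x * (dt 1 φ x 0 - ε ^ 2 * opD2 E (fun y => dt 1 φ y 0) x) = 0

/-! ### Elliptic coordinates and the moving frame -/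

/-- Elliptic coordinates `x = (r √a₁ cos φ, r √a₂ sin φ)`. -/
def elliptic (a₁ a₂ r φ : ℝ) : Plane :=
  !₂[r * Real.sqrt a₁ * Real.cos φ, r * Real.sqrt a₂ * Real.sin φ]

/-- The function `W^ε(r, φ, t) = w^ε(r + t/ε², φ, t/ε²)`, extended by `0` to `r ≤ -t/ε²`, where
`w^ε` is expressed in elliptic coordinates. -/
def movingFrame (a₁ a₂ ε : ℝ) (w : Plane × ℝ → ℝ) (p : ℝ × ℝ × ℝ) : ℝ :=
  if -(p.2.2 / ε ^ 2) < p.1 then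
    w (elliptic a₁ a₂ (p.1 + p.2.2 / ε ^ 2) p.2.1, p.2.2 / ε ^ 2)
  else 0

/-- The domain `ℝ × ℝ × (0, T)` of the variables `(r, φ, t)`. -/
def frameDomain (T : ℝ) : TopologicalSpace.Opens (ℝ × ℝ × ℝ) where
  carrier := {p | p.2.2 ∈ Ioo 0 T}
  is_open' := isOpen_Ioo.preimage (continuous_snd.comp continuous_snd)

/-- Convergence in the sense of distributions of a sequence of functions to a distribution. -/
def TendstoInDistributions {X : Type*} [NormedAddCommGroup X] [NormedSpace ℝ X] [MeasureSpace X]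
    {Ω : TopologicalSpace.Opens X} (V : ℕ → X → ℝ) (W : 𝓓'(Ω, ℝ)) : Prop :=
  ∀ η : 𝓓(Ω, ℝ), Tendsto (fun n => ∫ p in (Ω : Set X), V n p * η p) atTop (𝓝 (W η))

/-- The product of a test function on `Ω` with a function that is smooth on `Ω`. -/
def mulTest {X : Type*} [NormedAddCommGroup X] [NormedSpace ℝ X] {Ω : TopologicalSpace.Opens X}
    (g : X → ℝ) (hg : ContDiffOn ℝ ∞ g Ω) (η : 𝓓(Ω, ℝ)) : 𝓓(Ω, ℝ) where
  toFun p := g p * η p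
  contDiff' := by
    rw [contDiff_iff_contDiffAt]
    intro p
    by_cases hp : p ∈ tsupport η
    · have hΩ : p ∈ (Ω : Set X) := η.tsupport_subset hp
      exact (hg.contDiffAt (Ω.isOpen.mem_nhds hΩ)).mul η.contDiff.contDiffAt
    · have h0 : (fun q => g q * η q) =ᶠ[𝓝 p] fun _ => (0 : ℝ) := by
        filter_upwards [notMem_tsupport_iff_eventuallyEq.mp hp] with q hq
        simp [hq]
      exact contDiffAt_const.congr_of_eventuallyEq h0
  hasCompactSupport' := η.hasCompactSupport.mul_left
  tsupport_subset' := (tsupport_mul_subset_right (f := g) (g := η)).trans η.tsupport_subset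

/-- The dispersion coefficient `κ(φ) = ∑ C_{ijkl} ξ_i ξ_j ξ_k ξ_l`,
`ξ = (cos φ / √a₁, sin φ / √a₂)`. -/
def kappa (a₁ a₂ : ℝ) (C : Tensor4) (φ : ℝ) : ℝ :=
  let ξ : Fin 2 → ℝ := ![Real.cos φ / Real.sqrt a₁, Real.sin φ / Real.sqrt a₂]
  ∑ i, ∑ j, ∑ k, ∑ l, C i j k l * ξ i * ξ j * ξ k * ξ l

theorem contDiffOn_kappa (a₁ a₂ : ℝ) (C : Tensor4) (T : ℝ) :
    ContDiffOn ℝ ∞ (fun p : ℝ × ℝ × ℝ => kappa a₁ a₂ C p.2.1) (frameDomain T) := by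
  have h : ContDiff ℝ ∞ (fun p : ℝ × ℝ × ℝ => kappa a₁ a₂ C p.2.1) := by
    have hφ : ContDiff ℝ ∞ (fun p : ℝ × ℝ × ℝ => p.2.1) := contDiff_fst.comp contDiff_snd
    simp only [kappa, Fin.sum_univ_two, Matrix.cons_val_zero, Matrix.cons_val_one]
    fun_prop
  exact h.contDiffOn

theorem contDiffOn_one_div_two_mul (T : ℝ) :
    ContDiffOn ℝ ∞ (fun p : ℝ × ℝ × ℝ => 1 / (2 * p.2.2)) (frameDomain T) := by
  refine ContDiffOn.div contDiffOn_const (by fun_prop) ?_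
  intro p hp
  have h0 : 0 < p.2.2 := hp.1
  positivity

/-- The direction of the derivative `∂_r` in the variables `(r, φ, t)`. -/
def dirR : ℝ × ℝ × ℝ := (1, 0, 0)

/-- The direction of the derivative `∂_t` in the variables `(r, φ, t)`. -/
def dirT : ℝ × ℝ × ℝ := (0, 0, 1)

/-- The linearized cylindrical Korteweg-de Vries equation
`∂_t U + U / (2 t) - ½ κ(φ) ∂_r³ U = 0` in the sense of distributions on `ℝ × ℝ × (0, T)`,
where the product of a smooth function `g` and a distribution `S` is `⟨g S, η⟩ = ⟨S, g η⟩`. -/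
def SolvesLinearizedKdV (a₁ a₂ : ℝ) (C : Tensor4) (T : ℝ) (U : 𝓓'(frameDomain T, ℝ)) : Prop :=
  ∀ η : 𝓓(frameDomain T, ℝ),
    (∂_{dirT} U) η
      + U (mulTest (fun p => 1 / (2 * p.2.2)) (contDiffOn_one_div_two_mul T) η)
      - (1 / 2) * (∂_{dirR} (∂_{dirR} (∂_{dirR} U)))
          (mulTest (fun p => kappa a₁ a₂ C p.2.1) (contDiffOn_kappa a₁ a₂ C T) η) = 0

end

end MovingFrame

/-!
The coefficients. The space `H¹_per(Y)` is realised as a closed subspace of `L²(Y)³`, and its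
Fourier coefficients are computed from the weak gradient. At `k = 0` the constant is the ground
state, with eigenvalue zero, and by the Poincaré inequality the form plus the projection onto the
constants is coercive. The eigenvalue problem for `(k, μ)` near `(0, 0)` is therefore equivalent to
a scalar analytic equation, and the implicit function theorem shows that `μ₀` is analytic near zero
(`contDiffAt_sInf_of_bordered`, `IsMedium.blochMin_analytic`). The shifted gradient bound
`|k| ‖ψ‖ ≤ ‖(∇ + i k) ψ‖` gives `μ₀(k) ≥ γ |k|²`, hence `A_{ii} > 0`. Even symmetry of the medium
makes `μ₀` even in each coordinate, so that all coefficients in which an index occurs an odd number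
of times vanish; this gives the diagonal form of `A` and the formula for `κ`.

The limit equation. With `s = ε²`, the weak formulation is transformed to the moving frame. There
the elliptic radius is `q / s` with `q = t + s r`, and the density of Lebesgue measure is a multiple
of `q`. Test functions of the form `q⁴ η` are used: as `∂_i (q^m h) = q^(m-1) P_i h` with an operator
`P_i` that is polynomial in `s` (`polarOp`), all derivatives up to order four become polynomial in
`s`. The terms of order one, `∂_r²` from the time derivative and from `A D²`, cancel because
`∑ a_i ξ_i² = 1` for `ξ = ∇ r`; what remains is `s` times the operator `frameOp`
(`IsFrameRep.weak_integrand`). Dividing by `s`, one obtains an exact identity for `W^ε` with a test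
function polynomial in `s` (`IsWeakSolution.integral_movingFrame`), in which distributional
convergence suffices to pass to the limit (`PolyFamily.tendsto_integral`). In the limit operator `E`
and `F` enter through `∑ F_{ijkl} ξ_i ξ_j ξ_k ξ_l - ∑ E_{ij} ξ_i ξ_j`, which is `κ` by the
decomposition of `C D⁴` and `∑ A_{ij} ξ_i ξ_j = 1` (`IsDecomposition.kappa_eq`). The choice
`η = ζ / (2 t⁵)` turns the limit identity into the equation for `U` tested with `ζ`.

Elliptic coordinates are injective only on one branch of the angle, while `φ` ranges over `ℝ`. The
identity is derived for test functions supported in one branch, and a general test function is cut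
into finitely many of these by smooth cutoffs in `φ` (`solvesLinearizedKdV_of_tendsto`).
-/


namespace MovingFrame

noncomputable section

/-! ### Analytic perturbation of the lowest eigenvalue -/

section Perturbation

variable {V H : Type*} [NormedAddCommGroup V] [NormedSpace ℝ V] [CompleteSpace V]
  [NormedAddCommGroup H] [InnerProductSpace ℂ H] [CompleteSpace H]

omit [CompleteSpace H] in
/-- If `N` is invertible, the bordered equation `N u = ⟪e, u⟫ e` has a nontrivial solution exactly
when `⟪e, N⁻¹ e⟫ = 1`; for `N` with real quadratic form it suffices to look at the real part. -/
theorem exists_bordered_iff {N : H →L[ℂ] H} (hN : IsUnit N) (e : H)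
    (hre : ∀ u, (inner ℂ u (N u)).im = 0) :
    (∃ u : H, u ≠ 0 ∧ N u = inner ℂ e u • e) ↔ (inner ℂ e (Ring.inverse N e)).re = 1 := by
  have h1 : ∀ x, N (Ring.inverse N x) = x := fun x => by
    have := congrArg (fun A : H →L[ℂ] H => A x) (Ring.mul_inverse_cancel N hN)
    simpa using this
  have h2 : ∀ x, Ring.inverse N (N x) = x := fun x => by
    have := congrArg (fun A : H →L[ℂ] H => A x) (Ring.inverse_mul_cancel N hN)
    simpa using this
  constructor
  · rintro ⟨u, hu, hNu⟩
    have h3 : u = inner ℂ e u • Ring.inverse N e := by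
      rw [← map_smul, ← hNu, h2]
    have h4 : inner ℂ e u ≠ 0 := by
      intro h0
      rw [h0, zero_smul] at h3
      exact hu h3
    have h5 := congrArg (fun x => inner ℂ e x) h3
    simp only [inner_smul_right] at h5
    have h6 : inner ℂ e (Ring.inverse N e) = 1 := by
      apply mul_left_cancel₀ h4
      rw [← h5, mul_one]
    rw [h6, Complex.one_re]
  · intro h
    have him : (inner ℂ e (Ring.inverse N e)).im = 0 := by
      have := hre (Ring.inverse N e)
      rw [h1] at this
      rw [← inner_conj_symm, Complex.conj_im, this, neg_zero]
    have h6 : inner ℂ e (Ring.inverse N e) = 1 := Complex.ext (by simpa using h) (by simpa using him)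
    refine ⟨Ring.inverse N e, ?_, ?_⟩
    · intro h0
      rw [h0, inner_zero_right] at h6
      exact zero_ne_one h6
    · rw [h1, h6, one_smul]

/-- Analytic perturbation of a simple lowest eigenvalue. The eigenvalue problem with parameter `k`
is given in bordered form `N (k, μ) u = ⟪e, u⟫ e`, with `N` analytic and invertible at the origin.
The eigenvalues near zero are then the zeros of a scalar analytic function, to which the implicit
function theorem applies. -/
theorem contDiffAt_sInf_of_bordered (N : V × ℝ → H →L[ℂ] H) (hN : ContDiff ℝ ω N)
    (hN0 : IsUnit (N (0, 0))) (e : H) (he : ‖e‖ = 1)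
    (hNe : ∀ t : ℝ, N (0, t) e = ((1 - t : ℝ) : ℂ) • e)
    (hre : ∀ p u, (inner ℂ u (N p u)).im = 0)
    (Eig : V → ℝ → Prop)
    (hEig : ∀ k μ, Eig k μ ↔ ∃ u : H, u ≠ 0 ∧ N (k, μ) u = inner ℂ e u • e)
    (γ : ℝ) (hγ : 0 ≤ γ) (hlow : ∀ᶠ k in 𝓝 (0 : V), ∀ μ, Eig k μ → γ * ‖k‖ ^ 2 ≤ μ) :
    ContDiffAt ℝ ω (fun k => sInf {μ | Eig k μ}) 0 ∧ sInf {μ | Eig 0 μ} = 0 ∧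
      ∀ᶠ k in 𝓝 (0 : V), γ * ‖k‖ ^ 2 ≤ sInf {μ | Eig k μ} := by
  -- `k` has the eigenvalue `μ` near `(0, 0)` exactly when `S (k, μ) = 1`
  set S : V × ℝ → ℝ := fun p => (inner ℂ e (Ring.inverse (N p) e)).re with hS
  have hunit : ∀ᶠ p in 𝓝 ((0 : V), (0 : ℝ)), IsUnit (N p) :=
    hN.continuous.continuousAt.eventually (Units.isOpen.mem_nhds hN0)
  have hScd : ContDiffAt ℝ ω S (0, 0) := by
    obtain ⟨U, hU⟩ := hN0
    have h1 : ContDiffAt ℝ ω (Ring.inverse : (H →L[ℂ] H) → _) (N (0, 0)) := by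
      rw [← hU]
      exact (contDiffAt_ringInverse ℂ U).restrict_scalars ℝ
    have h2 : ContDiffAt ℝ ω (fun p => Ring.inverse (N p)) ((0 : V), (0 : ℝ)) :=
      h1.comp (g := Ring.inverse) (f := N) _ hN.contDiffAt
    have h3 : IsBoundedLinearMap ℝ fun A : H →L[ℂ] H => (inner ℂ e (A e)).re := by
      let Λ : (H →L[ℂ] H) →L[ℂ] ℂ :=
        (innerSL ℂ e).comp (ContinuousLinearMap.apply ℂ H e)
      exact (Complex.reCLM.comp (Λ.restrictScalars ℝ)).isBoundedLinearMap
    exact h3.contDiff.contDiffAt.comp (g := fun A : H →L[ℂ] H => (inner ℂ e (A e)).re) _ h2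
  have hS0 : ∀ᶠ t in 𝓝 (0 : ℝ), S (0, t) = (1 - t)⁻¹ := by
    have hc : Tendsto (fun t : ℝ => ((0 : V), t)) (𝓝 0) (𝓝 (0, 0)) :=
      (Continuous.prodMk_right (0 : V)).tendsto 0
    have hne : ∀ᶠ t in 𝓝 (0 : ℝ), 1 - t ≠ 0 := by
      filter_upwards [gt_mem_nhds (zero_lt_one' ℝ)] with t ht
      linarith
    filter_upwards [hc.eventually hunit, hne] with t ht hne
    have h2 : Ring.inverse (N (0, t)) (N (0, t) e) = e := by
      have := congrArg (fun A : H →L[ℂ] H => A e) (Ring.inverse_mul_cancel _ ht)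
      simpa using this
    rw [hNe, map_smul] at h2
    have h3 : Ring.inverse (N (0, t)) e = (((1 - t)⁻¹ : ℝ) : ℂ) • e := by
      rw [← h2, smul_smul, ← Complex.ofReal_mul, inv_mul_cancel₀ hne, h2]
      simp
    simp only [hS, h3, inner_smul_right, inner_self_eq_norm_sq_to_K, he, RCLike.ofReal_one,
      one_pow, mul_one, Complex.ofReal_re]
  have hS00 : S (0, 0) = 1 := by simpa using hS0.self_of_nhds
  -- `S (0, t) = 1 / (1 - t)`, so the derivative of `S` in the eigenvalue parameter is invertible
  have hder : fderiv ℝ S (0, 0) ((0 : V), (1 : ℝ)) = 1 := by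
    have h1 : HasDerivAt (fun t : ℝ => S (0, t)) (fderiv ℝ S (0, 0) (0, 1)) 0 := by
      have hd : HasFDerivAt S (fderiv ℝ S (0, 0)) ((0 : V), (0 : ℝ)) :=
        (hScd.differentiableAt (by simp)).hasFDerivAt
      exact hd.comp_hasDerivAt (f := fun t : ℝ => ((0 : V), t)) 0
        ((hasDerivAt_const _ _).prodMk (hasDerivAt_id _))
    have h2 : HasDerivAt (fun t : ℝ => (1 - t)⁻¹) 1 0 := by
      have := ((hasDerivAt_id (0 : ℝ)).const_sub 1).inv (by simp)
      simpa using! this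
    exact h1.unique (h2.congr_of_eventuallyEq hS0)
  have hinv : (fderiv ℝ S (0, 0) ∘L .inr ℝ V ℝ).IsInvertible := by
    refine ⟨ContinuousLinearEquiv.refl ℝ ℝ, ?_⟩
    ext
    simp [hder]
  have hω : (ω : WithTop ℕ∞) ≠ 0 := by simp
  set lam := hScd.implicitFunction hω hinv with hlam
  have hlam0 : lam 0 = 0 := hScd.implicitFunction_apply_self hω hinv
  have hlamcd : ContDiffAt ℝ ω lam 0 := hScd.contDiffAt_implicitFunction hω hinv
  have hev : ∀ᶠ p in 𝓝 ((0 : V), (0 : ℝ)), Eig p.1 p.2 ↔ lam p.1 = p.2 := by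
    filter_upwards [hunit, hScd.eventually_apply_eq_iff_implicitFunction hω hinv] with p hp hp2
    rw [hEig, exists_bordered_iff hp e (hre p), ← hp2, hS00]
  rw [nhds_prod_eq] at hev
  obtain ⟨P, hP, Q, hQ, hPQ⟩ := eventually_prod_iff.mp hev
  obtain ⟨δ, hδ, hQδ⟩ := Metric.eventually_nhds_iff.mp hQ
  have hsmall : ∀ᶠ k in 𝓝 (0 : V), |lam k| < δ := by
    have := hlamcd.continuousAt.tendsto
    rw [hlam0] at this
    simpa using this.eventually (Metric.ball_mem_nhds 0 hδ)
  have hleast : ∀ᶠ k in 𝓝 (0 : V), IsLeast {μ | Eig k μ} (lam k) := by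
    filter_upwards [hP, hsmall, hlow] with k hk hs hl
    refine ⟨(hPQ hk (hQδ (by rwa [Real.dist_eq, sub_zero]))).mpr rfl, fun μ hμ => ?_⟩
    -- the lower bound excludes negative eigenvalues, so an eigenvalue is either small, hence
    -- equal to `lam k`, or at least `δ > lam k`
    by_cases hμδ : μ < δ
    · have h0 : 0 ≤ μ := le_trans (by positivity) (hl μ hμ)
      exact ((hPQ hk (hQδ (y := μ)
        (by rwa [Real.dist_eq, sub_zero, abs_of_nonneg h0]))).mp hμ).le
    · exact (abs_lt.mp hs).2.le.trans (not_lt.mp hμδ)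
  have heq : (fun k => sInf {μ | Eig k μ}) =ᶠ[𝓝 0] lam := by
    filter_upwards [hleast] with k hk using hk.csInf_eq
  refine ⟨hlamcd.congr_of_eventuallyEq heq, heq.self_of_nhds.trans hlam0, ?_⟩
  filter_upwards [hleast, hlow] with k hk hl
  rw [hk.csInf_eq]
  exact hl _ hk.1

end Perturbation

section QuadraticFamily

variable {H L : Type*} [NormedAddCommGroup H] [InnerProductSpace ℂ H] [CompleteSpace H]
  [NormedAddCommGroup L] [InnerProductSpace ℂ L] [CompleteSpace L]

/-- The operator on `H` representing the sesquilinear form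
`(v, u) ↦ ∑ ⟪(G_i + i k_i J) v, M_ij (G_j + i k_j J) u⟫ - μ ⟪J v, J u⟫ + ⟪v, e⟫ ⟪e, u⟫`,
written out as a polynomial in the real parameters `(k, μ)`. -/
def borderedOp (J : H →L[ℂ] L) (G : Fin 2 → H →L[ℂ] L) (M : Fin 2 → Fin 2 → L →L[ℂ] L) (e : H)
    (p : Plane × ℝ) : H →L[ℂ] H :=
  (∑ i, ∑ j, (((G i).adjoint ∘L M i j ∘L G j)
      + (p.1 j) • (Complex.I • ((G i).adjoint ∘L M i j ∘L J))
      - (p.1 i) • (Complex.I • (J.adjoint ∘L M i j ∘L G j))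
      + (p.1 i * p.1 j) • (J.adjoint ∘L M i j ∘L J)))
    - p.2 • (J.adjoint ∘L J) + (innerSL ℂ e).smulRight e

theorem contDiff_borderedOp (J : H →L[ℂ] L) (G : Fin 2 → H →L[ℂ] L)
    (M : Fin 2 → Fin 2 → L →L[ℂ] L) (e : H) : ContDiff ℝ ω (borderedOp J G M e) := by
  unfold borderedOp
  fun_prop

theorem inner_borderedOp (J : H →L[ℂ] L) (G : Fin 2 → H →L[ℂ] L)
    (M : Fin 2 → Fin 2 → L →L[ℂ] L) (e : H) (k : Plane) (μ : ℝ) (v u : H) :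
    inner ℂ v (borderedOp J G M e (k, μ) u) =
      (∑ i, ∑ j, inner ℂ (G i v + (Complex.I * (k i : ℂ)) • J v)
        (M i j (G j u + (Complex.I * (k j : ℂ)) • J u)))
      - μ * inner ℂ (J v) (J u) + inner ℂ v e * inner ℂ e u := by
  have hr : ∀ (c : ℝ) (x : H), c • x = (c : ℂ) • x := fun c x => (Complex.coe_smul c x).symm
  simp only [borderedOp, add_apply, sub_apply,
    sum_apply, smul_apply, ContinuousLinearMap.comp_apply,
    ContinuousLinearMap.smulRight_apply, innerSL_apply_apply, inner_add_right, inner_sub_right,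
    inner_sum, hr, inner_smul_right, ContinuousLinearMap.adjoint_inner_right, map_add, map_smul,
    inner_add_left, inner_smul_left, map_mul, Complex.conj_I, Complex.conj_ofReal,
    Complex.ofReal_mul]
  congr 1
  · congr 1
    refine Finset.sum_congr rfl fun i _ => Finset.sum_congr rfl fun j _ => ?_
    linear_combination ((k i : ℂ) * k j * inner ℂ (J v) ((M i j) (J u))) * Complex.I_sq
  · ring

/-- The lowest eigenvalue of a coercive family of forms depending quadratically on `k`, whose
unperturbed ground state is `e`, is analytic in `k` near the origin and grows at least
quadratically. -/
theorem contDiffAt_sInf_of_form (J : H →L[ℂ] L) (G : Fin 2 → H →L[ℂ] L)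
    (M : Fin 2 → Fin 2 → L →L[ℂ] L) (e : H) (he : ‖e‖ = 1) (hGe : ∀ i, G i e = 0)
    (hJe : ∀ v, inner ℂ (J v) (J e) = inner ℂ v e) (hJ : ∀ u, J u = 0 → u = 0)
    (hMre : ∀ ξ : Fin 2 → L, (∑ i, ∑ j, inner ℂ (ξ i) (M i j (ξ j))).im = 0)
    (γ : ℝ) (hγ : 0 < γ)
    (hM : ∀ ξ : Fin 2 → L, γ * ∑ i, ‖ξ i‖ ^ 2 ≤ (∑ i, ∑ j, inner ℂ (ξ i) (M i j (ξ j))).re)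
    (hpoincare : ∀ u, ‖u‖ ^ 2 ≤ 2 * (∑ i, ‖G i u‖ ^ 2 + ‖inner ℂ e u‖ ^ 2))
    (hshift : ∀ k : Plane, (∀ i, |k i| ≤ 1 / 2) → ∀ u,
      ‖k‖ ^ 2 * ‖J u‖ ^ 2 ≤ ∑ i, ‖G i u + (Complex.I * (k i : ℂ)) • J u‖ ^ 2)
    (Eig : Plane → ℝ → Prop)
    (hEig : ∀ k μ, Eig k μ ↔ ∃ u : H, u ≠ 0 ∧ ∀ v : H,
      ∑ i, ∑ j, inner ℂ (G i v + (Complex.I * (k i : ℂ)) • J v)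
        (M i j (G j u + (Complex.I * (k j : ℂ)) • J u)) = μ * inner ℂ (J v) (J u)) :
    ContDiffAt ℝ ω (fun k => sInf {μ | Eig k μ}) 0 ∧ sInf {μ | Eig 0 μ} = 0 ∧
      ∀ᶠ k in 𝓝 (0 : Plane), γ * ‖k‖ ^ 2 ≤ sInf {μ | Eig k μ} := by
  refine contDiffAt_sInf_of_bordered (borderedOp J G M e) (contDiff_borderedOp J G M e) ?_ e he
    ?_ ?_ Eig ?_ γ hγ.le ?_
  · -- at `(0, 0)` the bordered form is coercive by the ellipticity and the Poincaré inequality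
    have hc : (0 : ℝ) < min γ 1 / 2 := by positivity
    refine ContinuousLinearMap.isUnit_of_forall_le_norm_inner_map _ (c := ⟨min γ 1 / 2, hc.le⟩) hc
      fun u => ?_
    have h1 := hM (fun i => G i u)
    have h2 := inner_borderedOp J G M e 0 0 u u
    simp only [PiLp.zero_apply, Complex.ofReal_zero, mul_zero, zero_smul, add_zero, zero_mul,
      sub_zero] at h2
    have h3 : (inner ℂ u e * inner ℂ e u).re = ‖inner ℂ e u‖ ^ 2 := by
      rw [← inner_conj_symm, ← Complex.normSq_eq_conj_mul_self, Complex.normSq_eq_norm_sq]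
      norm_cast
    have h4 : (inner ℂ u (borderedOp J G M e (0, 0) u)).re ≤
        ‖inner ℂ (borderedOp J G M e (0, 0) u) u‖ := by
      rw [norm_inner_symm]
      exact Complex.re_le_norm _
    rw [h2, Complex.add_re, h3] at h4
    have h5 : min γ 1 * (∑ i, ‖G i u‖ ^ 2) ≤ γ * ∑ i, ‖G i u‖ ^ 2 := by
      gcongr
      exact min_le_left _ _
    have h6 : min γ 1 * ‖inner ℂ e u‖ ^ 2 ≤ 1 * ‖inner ℂ e u‖ ^ 2 := by
      gcongr
      exact min_le_right _ _
    have h7 := mul_le_mul_of_nonneg_left (hpoincare u) hc.le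
    change ‖u‖ ^ 2 * (min γ 1 / 2) ≤ _
    linarith
  · intro t
    refine ext_inner_left ℂ fun v => ?_
    rw [inner_borderedOp]
    simp only [hGe, PiLp.zero_apply, Complex.ofReal_zero, mul_zero, zero_smul, add_zero, map_zero,
      inner_zero_right, Finset.sum_const_zero, hJe, inner_smul_right, inner_self_eq_norm_sq_to_K,
      he]
    push_cast
    ring
  · rintro ⟨k, μ⟩ u
    rw [inner_borderedOp, Complex.add_im, Complex.sub_im,
      hMre (fun i => G i u + (Complex.I * (k i : ℂ)) • J u), inner_self_eq_norm_sq_to_K,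
      ← inner_conj_symm, ← Complex.normSq_eq_conj_mul_self]
    norm_cast
    simp only [zero_sub, Complex.ofReal_im, add_zero, Complex.mul_im, zero_mul,
      neg_eq_zero, mul_eq_zero]
    exact Or.inr (Complex.ofReal_im (‖J u‖ ^ 2))
  · intro k μ
    rw [hEig]
    refine exists_congr fun u => and_congr_right fun _ => ?_
    rw [ext_iff_inner_left ℂ]
    refine forall_congr' fun v => ?_
    rw [inner_borderedOp, inner_smul_right, mul_comm (inner ℂ v e), add_eq_right, sub_eq_zero]
  · have hk : ∀ᶠ k in 𝓝 (0 : Plane), ∀ i, |k i| ≤ 1 / 2 := by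
      rw [eventually_all]
      intro i
      have hc : Continuous fun k : Plane => |k i| := by fun_prop
      have := hc.tendsto 0
      simp only [PiLp.zero_apply, abs_zero] at this
      exact this.eventually (Iic_mem_nhds (by norm_num))
    filter_upwards [hk] with k hk μ hμ
    obtain ⟨u, hu, hv⟩ := (hEig k μ).mp hμ
    have h1 := hM (fun i => G i u + (Complex.I * (k i : ℂ)) • J u)
    rw [hv u, inner_self_eq_norm_sq_to_K] at h1
    have h2 := mul_le_mul_of_nonneg_left (hshift k hk u) hγ.le
    have h3 : 0 < ‖J u‖ ^ 2 := by
      have : J u ≠ 0 := fun h => hu (hJ u h)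
      positivity
    have h4 : ((μ : ℂ) * ((‖J u‖ : ℂ)) ^ 2).re = μ * ‖J u‖ ^ 2 := by norm_cast
    have h5 := h2.trans (h1.trans_eq h4)
    rw [← mul_assoc] at h5
    exact le_of_mul_le_mul_right h5 h3

end QuadraticFamily

/-! ### Parseval's identity on the cell -/

section Parseval

-- the normalised Haar measure, with respect to which the Fourier series of the torus are stated
local instance : MeasureSpace UnitAddCircle := ⟨AddCircle.haarAddCircle⟩

/-- The exponential `y ↦ exp (i m · y)`. -/
def expChar (m : Fin 2 → ℤ) (y : Plane) : ℂ := Complex.exp (∑ i, Complex.I * (m i : ℂ) * (y i : ℂ))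

/-- The representative in `(-π, π]²` of a point of the unit torus, scaled by `2π`. -/
def torusRep (x : UnitAddTorus (Fin 2)) : Plane :=
  (2 * Real.pi) • WithLp.toLp 2 fun i => ((AddCircle.equivIoc (1 : ℝ) (-(1 / 2)) (x i) : _) : ℝ)

theorem mFourier_eq_expChar (m : Fin 2 → ℤ) (x : UnitAddTorus (Fin 2)) :
    UnitAddTorus.mFourier m x = expChar m (torusRep x) := by
  have h1 : ∀ i, x i = (((AddCircle.equivIoc (1 : ℝ) (-(1 / 2)) (x i) : _) : ℝ) : UnitAddCircle) :=
    fun i => ((AddCircle.equivIoc (1 : ℝ) (-(1 / 2))).symm_apply_apply (x i)).symm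
  have h2 : UnitAddTorus.mFourier m x = ∏ i, fourier (m i) (x i) := rfl
  rw [h2, expChar, Complex.exp_sum]
  refine Finset.prod_congr rfl fun i _ => ?_
  rw [h1 i, fourier_coe_apply]
  congr 1
  simp only [torusRep, PiLp.smul_apply, smul_eq_mul]
  push_cast
  ring

theorem restrict_halfOpen_cell_eq : (volume : Measure Plane).restrict
    {y | ∀ i, y i ∈ Ioc (-Real.pi) Real.pi} = volume.restrict cell := by
  refine Measure.restrict_congr_set ?_
  have hmp := EuclideanSpace.volume_preserving_symm_measurableEquiv_toLp (Fin 2)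
  have h : (univ.pi fun _ : Fin 2 => Ioc (-Real.pi) Real.pi) =ᵐ[volume]
      (univ.pi fun _ : Fin 2 => Ioo (-Real.pi) Real.pi) :=
    (Measure.univ_pi_Ioo_ae_eq_Icc.trans Measure.univ_pi_Ioc_ae_eq_Icc.symm).symm
  have h2 := hmp.quasiMeasurePreserving.preimage_ae_eq h
  have e1 : {y : Plane | ∀ i, y i ∈ Ioc (-Real.pi) Real.pi} =
      (MeasurableEquiv.toLp 2 (Fin 2 → ℝ)).symm ⁻¹' univ.pi fun _ => Ioc (-Real.pi) Real.pi := by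
    ext y
    exact (mem_univ_pi (f := y.ofLp)).symm
  have e2 : cell =
      (MeasurableEquiv.toLp 2 (Fin 2 → ℝ)).symm ⁻¹' univ.pi fun _ => Ioo (-Real.pi) Real.pi := by
    ext y
    exact (mem_univ_pi (f := y.ofLp)).symm
  rw [e1, e2]
  exact h2

theorem measurable_equivIoc_apply : Measurable fun x : UnitAddTorus (Fin 2) =>
    fun i => ((AddCircle.equivIoc (1 : ℝ) (-(1 / 2)) (x i) : _) : ℝ) := by
  refine measurable_pi_lambda _ fun i => ?_
  exact measurable_subtype_coe.comp
    ((AddCircle.measurableEquivIoc (1 : ℝ) (-(1 / 2))).measurable.comp (measurable_pi_apply i))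

theorem measurable_torusRep : Measurable torusRep :=
  (measurable_const_smul (α := Plane) (2 * Real.pi)).comp
    ((MeasurableEquiv.toLp 2 (Fin 2 → ℝ)).measurable.comp measurable_equivIoc_apply)

/-- The normalised measure of the torus becomes normalised Lebesgue measure on the cell; this
transfers Fourier series from the torus to the cell. -/
theorem map_torusRep : Measure.map torusRep volume =
    ENNReal.ofReal (((2 * Real.pi) ^ 2)⁻¹) • (volume : Measure Plane).restrict cell := by
  have hpi := Real.pi_pos
  set box : Set (Fin 2 → ℝ) := {x | ∀ i, x i ∈ Ioc (-(1 / 2) : ℝ) (-(1 / 2) + 1)} with hbox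
  have hboxm : MeasurableSet box := MeasurableSet.univ_pi' fun i => measurableSet_Ioc
  have h1 := (UnitAddTorus.measurePreserving_equivPiIoc (fun _ : Fin 2 => (-(1 / 2) : ℝ))).map_eq
  have h2 : Measure.map (fun x : UnitAddTorus (Fin 2) =>
      fun i => ((AddCircle.equivIoc (1 : ℝ) (-(1 / 2)) (x i) : _) : ℝ)) volume =
      volume.restrict box := by
    rw [← map_comap_subtype_coe hboxm]
    refine Eq.trans ?_ (congrArg (Measure.map Subtype.val) h1)
    rw [Measure.map_map measurable_subtype_coe (MeasurableEquiv.measurable _)]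
    rfl
  have hmp := (EuclideanSpace.volume_preserving_symm_measurableEquiv_toLp (Fin 2)).symm
  have h3 : Measure.map torusRep volume = Measure.map (fun y : Plane => (2 * Real.pi) • y)
      (Measure.map (MeasurableEquiv.toLp 2 (Fin 2 → ℝ)) (volume.restrict box)) := by
    rw [← h2, Measure.map_map (MeasurableEquiv.measurable _) measurable_equivIoc_apply,
      Measure.map_map (measurable_const_smul _)
        ((MeasurableEquiv.measurable _).comp measurable_equivIoc_apply)]
    rfl
  set box' : Set Plane := {y | ∀ i, y i ∈ Ioc (-(1 / 2) : ℝ) (-(1 / 2) + 1)} with hbox'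
  have h4 : Measure.map (MeasurableEquiv.toLp 2 (Fin 2 → ℝ)) (volume.restrict box) =
      (volume : Measure Plane).restrict box' := by
    have := hmp.restrict_preimage_emb (MeasurableEquiv.measurableEmbedding _) box'
    exact this.map_eq
  rw [h3, h4, ← restrict_halfOpen_cell_eq]
  set c2 : Set Plane := {y | ∀ i, y i ∈ Ioc (-Real.pi) Real.pi} with hc2
  have hpre : box' = (fun y : Plane => (2 * Real.pi) • y) ⁻¹' c2 := by
    ext y
    simp only [hbox', hc2, mem_ofPred_eq, mem_preimage, PiLp.smul_apply, smul_eq_mul, mem_Ioc]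
    refine forall_congr' fun i => ?_
    constructor
    · rintro ⟨ha, hb⟩
      constructor <;> nlinarith
    · rintro ⟨ha, hb⟩
      constructor <;> nlinarith
  have hme : MeasurableEmbedding (fun y : Plane => (2 * Real.pi) • y) :=
    (Homeomorph.smulOfNeZero (2 * Real.pi) (by positivity)).measurableEmbedding
  rw [hpre, ← hme.restrict_map, Measure.map_addHaar_smul _ (by positivity), Measure.restrict_smul]
  congr 2
  rw [finrank_euclideanSpace_fin, abs_of_pos (by positivity)]

/-- The (unnormalised) Fourier coefficients `∫_Y f exp (-i m · y)`. -/
def cellCoeff (f : Plane → ℂ) (m : Fin 2 → ℤ) : ℂ := ∫ y in cell, f y * expChar (-m) y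

theorem continuous_expChar (m : Fin 2 → ℤ) : Continuous (expChar m) := by
  unfold expChar
  fun_prop

/-- Parseval's identity on the cell. -/
theorem hasSum_sq_cellCoeff {f : Plane → ℂ} (hf : MemLp f 2 (volume.restrict cell)) :
    HasSum (fun m => ((2 * Real.pi) ^ 2)⁻¹ * ‖cellCoeff f m‖ ^ 2) (∫ y in cell, ‖f y‖ ^ 2) := by
  have hpi := Real.pi_pos
  set c : ℝ := ((2 * Real.pi) ^ 2)⁻¹ with hc
  have hc0 : 0 < c := by positivity
  have hfm : MemLp f 2 (Measure.map torusRep volume) := by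
    rw [map_torusRep]
    exact hf.smul_measure ENNReal.ofReal_ne_top
  have hint : ∀ g : Plane → ℂ, AEStronglyMeasurable g (volume.restrict cell) →
      ∫ x, g (torusRep x) = c * ∫ y in cell, g y := by
    intro g hg
    rw [← integral_map measurable_torusRep.aemeasurable, map_torusRep, integral_smul_measure,
      ENNReal.toReal_ofReal hc0.le, Complex.real_smul]
    rw [map_torusRep]
    exact hg.smul_measure _
  have hint2 : ∫ x, ‖f (torusRep x)‖ ^ 2 = c * ∫ y in cell, ‖f y‖ ^ 2 := by
    rw [← integral_map (f := fun y => ‖f y‖ ^ 2) measurable_torusRep.aemeasurable, map_torusRep,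
      integral_smul_measure, ENNReal.toReal_ofReal hc0.le, smul_eq_mul]
    rw [map_torusRep]
    exact (hf.1.norm.pow 2).smul_measure _
  have hF : MemLp (f ∘ torusRep) 2 (volume : Measure (UnitAddTorus (Fin 2))) :=
    hfm.comp_measurePreserving ⟨measurable_torusRep, rfl⟩
  have hP := UnitAddTorus.hasSum_sq_mFourierCoeff (hF.toLp _)
  have e1 : ∫ x, ‖hF.toLp _ x‖ ^ 2 = c * ∫ y in cell, ‖f y‖ ^ 2 := by
    rw [← hint2]
    refine integral_congr_ae ?_
    filter_upwards [hF.coeFn_toLp] with x hx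
    rw [hx, Function.comp_apply]
  have e2 : ∀ m, UnitAddTorus.mFourierCoeff (hF.toLp _) m = c * cellCoeff f m := by
    intro m
    rw [cellCoeff, ← hint (fun y => f y * expChar (-m) y)
      (hf.1.mul (continuous_expChar _).aestronglyMeasurable)]
    refine integral_congr_ae ?_
    filter_upwards [hF.coeFn_toLp] with x hx
    rw [hx, Function.comp_apply, mFourier_eq_expChar, smul_eq_mul, mul_comm]
  rw [e1] at hP
  simp only [e2, norm_mul, mul_pow, Complex.norm_real, Real.norm_eq_abs, sq_abs] at hP
  have := hP.mul_left c⁻¹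
  rw [inv_mul_cancel_left₀ hc0.ne'] at this
  refine this.congr_fun fun m => ?_
  field_simp

end Parseval

/-! ### The space `H¹_per(Y)` as a Hilbert space -/

theorem measurableSet_cell : MeasurableSet cell := by
  have : cell = ⋂ i : Fin 2, (fun y : Plane => y i) ⁻¹' Ioo (-Real.pi) Real.pi := by
    ext y; simp [cell]
  rw [this]
  exact MeasurableSet.iInter fun i =>
    measurableSet_Ioo.preimage (by fun_prop : Continuous fun y : Plane => y i).measurable

theorem cell_subset_closedBall : cell ⊆ Metric.closedBall 0 (2 * Real.pi) := by
  intro y hy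
  rw [mem_closedBall_zero_iff]
  have h0 := hy 0
  have h1 := hy 1
  have hpi := Real.pi_pos
  refine abs_le_of_sq_le_sq' ?_ (by positivity) |>.2
  rw [EuclideanSpace.norm_sq_eq, Fin.sum_univ_two, Real.norm_eq_abs, Real.norm_eq_abs, sq_abs,
    sq_abs]
  nlinarith [h0.1, h0.2, h1.1, h1.2]

instance isFiniteMeasure_cell : IsFiniteMeasure ((volume : Measure Plane).restrict cell) :=
  ⟨by
    rw [Measure.restrict_apply_univ]
    exact (measure_mono cell_subset_closedBall).trans_lt measure_closedBall_lt_top⟩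

/-- Continuous functions belong to every Lebesgue space of the bounded cell. -/
theorem memLp_cell_of_continuous {E : Type*} [NormedAddCommGroup E] {φ : Plane → E}
    (hφ : Continuous φ) (p : ENNReal) [SecondCountableTopology E] :
    MemLp φ p (volume.restrict cell) := by
  obtain ⟨B, hB⟩ := (isCompact_closedBall (0 : Plane) (2 * Real.pi)).exists_bound_of_continuousOn
    hφ.continuousOn
  refine MemLp.of_bound (hφ.aestronglyMeasurable) B ?_
  rw [ae_restrict_iff' measurableSet_cell]
  exact Eventually.of_forall fun y hy => hB y (cell_subset_closedBall hy)

/-- The complex Hilbert space `L²(Y)`. -/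
abbrev CellL2 : Type := Lp ℂ 2 ((volume : Measure Plane).restrict cell)

/-- The continuous functional `f ↦ ∫_Y f φ` for continuous `φ`. -/
def cellPair (φ : Plane → ℂ) (hφ : Continuous φ) : CellL2 →L[ℂ] ℂ :=
  innerSL ℂ ((memLp_cell_of_continuous (Complex.continuous_conj.comp hφ) 2).toLp _)

theorem cellPair_apply (φ : Plane → ℂ) (hφ : Continuous φ) (f : CellL2) :
    cellPair φ hφ f = ∫ y in cell, f y * φ y := by
  rw [cellPair, innerSL_apply_apply, L2.inner_def]
  refine integral_congr_ae ?_
  filter_upwards [(memLp_cell_of_continuous (Complex.continuous_conj.comp hφ) 2).coeFn_toLp]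
    with y hy
  rw [hy, RCLike.inner_apply]
  simp

theorem continuous_partial {χ : Plane → ℂ} (hχ : ContDiff ℝ ∞ χ) (i : Fin 2) :
    Continuous fun y => fderiv ℝ χ y (unitVec i) :=
  (hχ.continuous_fderiv (by simp)).clm_apply continuous_const

/-- The functional `(ψ, g₁, g₂) ↦ ∫_Y ψ ∂_i χ + ∫_Y g_i χ`. -/
def weakGradDefect (χ : {χ : Plane → ℂ // ContDiff ℝ ∞ χ ∧ CellPeriodic χ}) (i : Fin 2) :
    (PiLp 2 fun _ : Fin 3 => CellL2) →L[ℂ] ℂ :=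
  (cellPair _ (continuous_partial χ.2.1 i)) ∘L (PiLp.proj 2 (fun _ : Fin 3 => CellL2) 0)
    + (cellPair _ χ.2.1.continuous) ∘L (PiLp.proj 2 (fun _ : Fin 3 => CellL2) i.succ)

/-- The space `H¹_per(Y)`, realised as the closed subspace of those triples `(ψ, g₁, g₂)` in
`L²(Y)³` for which `(g₁, g₂)` is the weak periodic gradient of `ψ`. -/
def H1per : Submodule ℂ (PiLp 2 fun _ : Fin 3 => CellL2) :=
  ⨅ χ, ⨅ i, LinearMap.ker (weakGradDefect χ i).toLinearMap

theorem mem_H1per {u : PiLp 2 fun _ : Fin 3 => CellL2} :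
    u ∈ H1per ↔ ∀ χ : Plane → ℂ, ContDiff ℝ ∞ χ → CellPeriodic χ → ∀ i : Fin 2,
      ∫ y in cell, u 0 y * fderiv ℝ χ y (unitVec i) = -∫ y in cell, u i.succ y * χ y := by
  simp only [H1per, Submodule.mem_iInf, LinearMap.mem_ker, weakGradDefect,
    ContinuousLinearMap.coe_coe, add_apply, ContinuousLinearMap.comp_apply, PiLp.proj_apply,
    cellPair_apply, Subtype.forall, add_eq_zero_iff_eq_neg]
  exact ⟨fun h χ h1 h2 i => h χ ⟨h1, h2⟩ i, fun h χ h1 i => h χ h1.1 h1.2 i⟩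

theorem isClosed_H1per : IsClosed (H1per : Set (PiLp 2 fun _ : Fin 3 => CellL2)) := by
  simp only [H1per, Submodule.coe_iInf]
  exact isClosed_iInter fun χ => isClosed_iInter fun i => (weakGradDefect χ i).isClosed_ker

instance completeSpace_H1per : CompleteSpace H1per := isClosed_H1per.completeSpace_coe

/-- The embedding of `H¹_per(Y)` into `L²(Y)`. -/
def embL2 : H1per →L[ℂ] CellL2 := (PiLp.proj 2 (fun _ : Fin 3 => CellL2) 0) ∘L H1per.subtypeL

/-- The weak partial derivatives on `H¹_per(Y)`. -/
def weakPartial (i : Fin 2) : H1per →L[ℂ] CellL2 :=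
  (PiLp.proj 2 (fun _ : Fin 3 => CellL2) i.succ) ∘L H1per.subtypeL

/-- A function in `H¹_per(Y)` defines an element of the Hilbert space. -/
theorem IsH1per.exists_H1per {ψ : Plane → ℂ} {g : Fin 2 → Plane → ℂ} (h : IsH1per ψ g) :
    ∃ u : H1per, (embL2 u =ᵐ[volume.restrict cell] ψ) ∧
      ∀ i, weakPartial i u =ᵐ[volume.restrict cell] g i := by
  let u : PiLp 2 fun _ : Fin 3 => CellL2 :=
    WithLp.toLp 2 (Fin.cons (h.memLp.toLp ψ) fun i => (h.memLp_grad i).toLp (g i))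
  have h0 : u 0 =ᵐ[volume.restrict cell] ψ := h.memLp.coeFn_toLp
  have h1 : ∀ i : Fin 2, u i.succ =ᵐ[volume.restrict cell] g i :=
    fun i => (h.memLp_grad i).coeFn_toLp
  refine ⟨⟨u, mem_H1per.mpr fun χ hχ hp i => ?_⟩, h0, h1⟩
  have e1 : ∫ y in cell, u 0 y * fderiv ℝ χ y (unitVec i) =
      ∫ y in cell, ψ y * fderiv ℝ χ y (unitVec i) := by
    refine integral_congr_ae ?_
    filter_upwards [h0] with y hy
    rw [hy]
  have e2 : ∫ y in cell, u i.succ y * χ y = ∫ y in cell, g i y * χ y := by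
    refine integral_congr_ae ?_
    filter_upwards [h1 i] with y hy
    rw [hy]
  rw [e1, e2, h.weak_grad χ hχ hp i]

/-- The representative of a point of the plane in the half-open cell `[-π, π)²`. -/
def cellRep (y : Plane) : Plane :=
  WithLp.toLp 2 fun i => toIcoMod Real.two_pi_pos (-Real.pi) (y i)

theorem cellRep_periodic : CellPeriodic cellRep := by
  intro m y
  ext i
  by_cases h : i = m
  · subst h
    simp [cellRep, unitVec]
  · simp [cellRep, unitVec, h]

theorem cellRep_of_mem_cell {y : Plane} (hy : y ∈ cell) : cellRep y = y := by
  ext i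
  simp only [cellRep]
  rw [toIcoMod_eq_self]
  exact ⟨(hy i).1.le, by linarith [(hy i).2]⟩

/-- Every element of the Hilbert space comes from a function in `H¹_per(Y)`, namely from the
periodic extension of its values on the cell. -/
theorem exists_isH1per (u : H1per) :
    ∃ (ψ : Plane → ℂ) (g : Fin 2 → Plane → ℂ), IsH1per ψ g ∧
      (embL2 u =ᵐ[volume.restrict cell] ψ) ∧
      ∀ i, weakPartial i u =ᵐ[volume.restrict cell] g i := by
  have hper : ∀ f : CellL2, CellPeriodic fun y => f (cellRep y) := fun f m y => by
    simp only [cellRep_periodic m y]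
  have hae : ∀ f : CellL2, f =ᵐ[volume.restrict cell] fun y => f (cellRep y) := fun f => by
    filter_upwards [ae_restrict_mem measurableSet_cell] with y hy
    rw [cellRep_of_mem_cell hy]
  refine ⟨fun y => embL2 u (cellRep y), fun i y => weakPartial i u (cellRep y), ⟨hper _,
    fun i => hper _, (memLp_congr_ae (hae _)).mp (Lp.memLp _),
    fun i => (memLp_congr_ae (hae _)).mp (Lp.memLp _), fun χ hχ hp i => ?_⟩, hae _, fun i => hae _⟩
  have h := mem_H1per.mp u.2 χ hχ hp i
  refine Eq.trans ?_ (h.trans (congrArg Neg.neg ?_))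
  · refine setIntegral_congr_fun measurableSet_cell fun y hy => ?_
    simp only [cellRep_of_mem_cell hy]
    rfl
  · refine setIntegral_congr_fun measurableSet_cell fun y hy => ?_
    simp only [cellRep_of_mem_cell hy]
    rfl

/-! ### Fourier analysis on the cell -/

theorem expChar_periodic (m : Fin 2 → ℤ) : CellPeriodic (expChar m) := by
  intro j y
  have h : ∑ i, Complex.I * (m i : ℂ) * ((y + (2 * Real.pi) • unitVec j) i : ℂ) =
      ∑ i, Complex.I * (m i : ℂ) * (y i : ℂ) + m j * (2 * Real.pi * Complex.I) := by
    fin_cases j <;> simp [unitVec, Fin.sum_univ_two] <;> ring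
  rw [expChar, h, Complex.exp_add, Complex.exp_int_mul_two_pi_mul_I, mul_one, expChar]

theorem contDiff_expChar (m : Fin 2 → ℤ) : ContDiff ℝ ∞ (expChar m) := by
  unfold expChar
  have h : ∀ i : Fin 2, ContDiff ℝ ∞ fun y : Plane => ((y i : ℝ) : ℂ) := fun i =>
    Complex.ofRealCLM.contDiff.comp (by fun_prop : ContDiff ℝ ∞ fun y : Plane => y i)
  exact ContDiff.cexp (ContDiff.sum fun i _ => contDiff_const.mul (h i))

theorem fderiv_expChar (m : Fin 2 → ℤ) (y : Plane) (i : Fin 2) :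
    fderiv ℝ (expChar m) y (unitVec i) = Complex.I * (m i : ℂ) * expChar m y := by
  have h : ∀ i : Fin 2, HasFDerivAt (fun y : Plane => ((y i : ℝ) : ℂ))
      (Complex.ofRealCLM ∘L EuclideanSpace.proj i) y := fun i =>
    (Complex.ofRealCLM ∘L (EuclideanSpace.proj i : Plane →L[ℝ] ℝ)).hasFDerivAt
  have h2 := (HasFDerivAt.fun_sum (u := Finset.univ) fun j _ =>
    (h j).const_mul (Complex.I * (m j : ℂ))).cexp
  have h3 : HasFDerivAt (expChar m) _ y := h2
  rw [h3.fderiv]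
  fin_cases i <;> simp [unitVec, Fin.sum_univ_two, expChar] <;> ring

/-- The Fourier coefficients on the cell as functionals on `L²(Y)`. -/
def coeffL (m : Fin 2 → ℤ) : CellL2 →L[ℂ] ℂ := cellPair (expChar (-m)) (continuous_expChar _)

theorem norm_sq_eq_integral (f : CellL2) : ‖f‖ ^ 2 = ∫ y in cell, ‖f y‖ ^ 2 := by
  have h : (inner ℂ f f : ℂ) = ((∫ y in cell, ‖f y‖ ^ 2 : ℝ) : ℂ) := by
    rw [L2.inner_def, ← integral_complex_ofReal]
    refine integral_congr_ae (Eventually.of_forall fun y => ?_)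
    simp only [inner_self_eq_norm_sq_to_K]
    norm_cast
  rw [← inner_self_eq_norm_sq (𝕜 := ℂ), h]
  exact Complex.ofReal_re _

theorem hasSum_coeffL (f : CellL2) :
    HasSum (fun m => ((2 * Real.pi) ^ 2)⁻¹ * ‖coeffL m f‖ ^ 2) (‖f‖ ^ 2) := by
  rw [norm_sq_eq_integral]
  simp only [coeffL, cellPair_apply]
  exact hasSum_sq_cellCoeff (Lp.memLp f)

/-- The defining identity of the weak gradient, tested with an exponential. -/
theorem coeffL_weakPartial (m : Fin 2 → ℤ) (i : Fin 2) (u : H1per) :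
    coeffL m (weakPartial i u) = Complex.I * m i * coeffL m (embL2 u) := by
  have h := mem_H1per.mp u.2 _ (contDiff_expChar (-m)) (expChar_periodic _) i
  simp only [fderiv_expChar] at h
  rw [coeffL, cellPair_apply, cellPair_apply]
  rw [← neg_eq_iff_eq_neg] at h
  refine h.symm.trans ?_
  rw [← integral_neg, ← integral_const_mul]
  refine integral_congr_ae (Eventually.of_forall fun y => ?_)
  simp only [Pi.neg_apply, Int.cast_neg]
  change -((embL2 u) y * _) = _
  ring

/-- The weak gradient is determined by the function, through its Fourier coefficients. -/
theorem embL2_injective (u : H1per) (hu : embL2 u = 0) : u = 0 := by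
  have h : ∀ i, weakPartial i u = 0 := fun i => by
    have h1 := hasSum_coeffL (weakPartial i u)
    simp only [coeffL_weakPartial, hu, map_zero, mul_zero, norm_zero, ne_eq, OfNat.ofNat_ne_zero,
      not_false_eq_true, zero_pow] at h1
    have := h1.unique hasSum_zero
    simpa using this
  refine Subtype.ext (PiLp.ext fun j => ?_)
  refine Fin.cases hu (fun i => h i) j

/-- Since `|m_i + k_i| ≥ |k_i|` for integers `m_i` and `|k_i| ≤ ½`, the shifted gradient
`∇ + i k` is bounded below by `|k|`. -/
theorem norm_sq_le_shifted_gradient (k : Plane) (hk : ∀ i, |k i| ≤ 1 / 2) (u : H1per) :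
    ‖k‖ ^ 2 * ‖embL2 u‖ ^ 2 ≤
      ∑ i, ‖weakPartial i u + (Complex.I * (k i : ℂ)) • embL2 u‖ ^ 2 := by
  have h1 := (hasSum_coeffL (embL2 u)).mul_left (‖k‖ ^ 2)
  have h2 := hasSum_sum (s := Finset.univ) fun i _ =>
    hasSum_coeffL (weakPartial i u + (Complex.I * (k i : ℂ)) • embL2 u)
  refine hasSum_le (fun m => ?_) h1 h2
  simp only [map_add, map_smul, coeffL_weakPartial, smul_eq_mul, ← add_mul, ← mul_add, norm_mul,
    Complex.norm_I, one_mul, mul_pow]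
  have h3 : ∀ i, (k i) ^ 2 ≤ ‖((m i : ℂ) + (k i : ℂ))‖ ^ 2 := fun i => by
    have e : ((m i : ℂ) + (k i : ℂ)) = (((m i : ℝ) + k i : ℝ) : ℂ) := by push_cast; rfl
    rw [e, Complex.norm_real, Real.norm_eq_abs, sq_abs]
    -- `(m + k)² - k² = m² + 2 m k ≥ m² - |m| ≥ 0`
    have hb := abs_le.mp (hk i)
    have hm : |(m i : ℝ)| ≤ (m i : ℝ) ^ 2 := by
      rw [← sq_abs]
      exact_mod_cast Int.le_self_sq |m i|
    have := neg_abs_le (m i : ℝ)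
    have h5 : |2 * (m i : ℝ) * k i| ≤ |(m i : ℝ)| := by
      rw [abs_mul, abs_mul, abs_two]
      nlinarith [abs_nonneg (m i : ℝ), hk i]
    nlinarith [neg_abs_le (2 * (m i : ℝ) * k i)]
  rw [EuclideanSpace.norm_sq_eq]
  simp only [Fin.sum_univ_two, Real.norm_eq_abs, sq_abs]
  have hc : 0 ≤ (2 ^ 2 * Real.pi ^ 2)⁻¹ * ‖coeffL m (embL2 u)‖ ^ 2 := by positivity
  nlinarith [mul_le_mul_of_nonneg_right (h3 0) hc, mul_le_mul_of_nonneg_right (h3 1) hc]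

/-! ### Constants and the Poincaré inequality -/

theorem volume_cell : (volume : Measure Plane) cell = ENNReal.ofReal ((2 * Real.pi) ^ 2) := by
  have hpi := Real.pi_pos
  have h := congrArg (fun μ : Measure Plane => μ univ) map_torusRep
  rw [Measure.map_apply measurable_torusRep MeasurableSet.univ, preimage_univ] at h
  simp only [Measure.smul_apply, Measure.restrict_apply_univ, smul_eq_mul] at h
  have h1 : (Measure.pi fun _ : Fin 2 => AddCircle.haarAddCircle (T := (1 : ℝ))) univ = 1 :=
    measure_univ
  have h2 := h1.symm.trans h
  rw [ENNReal.ofReal_inv_of_pos (by positivity), ← ENNReal.div_eq_inv_mul] at h2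
  have := (ENNReal.div_eq_one_iff (by simp [hpi.le, hpi]) ENNReal.ofReal_ne_top).mp h2.symm
  exact this

/-- The integral of a partial derivative of a periodic function over the cell vanishes. -/
theorem integral_cell_partial_eq_zero {χ : Plane → ℂ} (hχ : ContDiff ℝ ∞ χ) (hp : CellPeriodic χ)
    (i : Fin 2) : ∫ y in cell, fderiv ℝ χ y (unitVec i) = 0 := by
  have hpi := Real.pi_pos
  have hmp : MeasurePreserving (MeasurableEquiv.toLp 2 (Fin 2 → ℝ)) :=
    (EuclideanSpace.volume_preserving_symm_measurableEquiv_toLp (Fin 2)).symm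
  set a : Fin 2 → ℝ := fun _ => -Real.pi
  set b : Fin 2 → ℝ := fun _ => Real.pi
  have hab : a ≤ b := fun _ => by simp only [a, b]; linarith
  have h1 : ∫ y in cell, fderiv ℝ χ y (unitVec i) =
      ∫ x in Icc a b, fderiv ℝ χ (WithLp.toLp 2 x) (unitVec i) := by
    have hpre : (MeasurableEquiv.toLp 2 (Fin 2 → ℝ)) ⁻¹' cell =
        univ.pi fun j : Fin 2 => Ioo (a j) (b j) := by
      ext y
      exact (mem_univ_pi (f := y)).symm
    have h2 := hmp.setIntegral_preimage_emb (MeasurableEquiv.measurableEmbedding _)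
      (fun y => fderiv ℝ χ y (unitVec i)) cell
    rw [← h2, hpre]
    exact setIntegral_congr_set Measure.univ_pi_Ioo_ae_eq_Icc
  -- the divergence theorem on the box for the vector field with `χ` in the `i`-th component
  let Λ : (Fin 2 → ℝ) →L[ℝ] Plane := (EuclideanSpace.equiv (Fin 2) ℝ).symm.toContinuousLinearMap
  have hd : ∀ x, HasFDerivAt (fun x : Fin 2 → ℝ => χ (WithLp.toLp 2 x))
      ((fderiv ℝ χ (WithLp.toLp 2 x)) ∘L Λ) x := fun x =>
    ((hχ.differentiable (by simp)) (WithLp.toLp 2 x)).hasFDerivAt.comp x (Λ.hasFDerivAt)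
  rw [h1]
  let f : Fin 2 → (Fin 2 → ℝ) → ℂ := fun j => if j = i then fun x => χ (WithLp.toLp 2 x) else 0
  let f' : Fin 2 → (Fin 2 → ℝ) → (Fin 2 → ℝ) →L[ℝ] ℂ := fun j x =>
    if j = i then (fderiv ℝ χ (WithLp.toLp 2 x)) ∘L Λ else 0
  have hΛ : Λ (Pi.single i 1) = unitVec i := by
    ext j
    simp [Λ, unitVec]
  have hsum : ∀ x, ∑ j, f' j x (Pi.single j 1) = fderiv ℝ χ (WithLp.toLp 2 x) (unitVec i) := by
    intro x
    rw [Finset.sum_eq_single i]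
    · simp [f', hΛ]
    · intro j _ hj
      simp [f', hj]
    · simp
  have hcont : Continuous fun x : Fin 2 → ℝ => χ (WithLp.toLp 2 x) :=
    hχ.continuous.comp Λ.continuous
  have key := integral_divergence_of_hasFDerivAt_off_countable' a b hab f f' ∅ countable_empty
    (fun j => by
      by_cases hj : j = i
      · simp only [f, hj, if_true]; exact hcont.continuousOn
      · simp only [f, hj, if_false]; exact continuousOn_const)
    (fun x _ j => by
      by_cases hj : j = i
      · simp only [f, f', hj, if_true]; exact hd x
      · simp only [f, f', hj, if_false]; exact hasFDerivAt_const _ _)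
    (by
      simp only [hsum]
      exact ((continuous_partial hχ i).comp Λ.continuous).continuousOn.integrableOn_compact
        isCompact_Icc)
  simp only [hsum] at key
  rw [key]
  refine Finset.sum_eq_zero fun j _ => ?_
  by_cases hj : j = i
  · subst hj
    rw [sub_eq_zero]
    refine setIntegral_congr_fun measurableSet_Icc fun x _ => ?_
    simp only [f, if_true]
    have := hp j (WithLp.toLp 2 (j.insertNth (a j) x))
    rw [← this]
    congr 1
    ext l
    refine Fin.succAboveCases j ?_ (fun l => ?_) l
    · simp only [PiLp.add_apply, PiLp.smul_apply, unitVec, Fin.insertNth_apply_same, a, b]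
      simp
      ring
    · simp [unitVec, Fin.insertNth_apply_succAbove]
  · simp [f, hj]

/-- The normalised constant function as an element of `H¹_per(Y)`. -/
def constH1 : H1per :=
  ⟨WithLp.toLp 2 (Fin.cons ((memLp_const (((2 * Real.pi)⁻¹ : ℝ) : ℂ)).toLp _) 0), by
    rw [mem_H1per]
    intro χ hχ hp i
    have e1 : ∫ y in cell, ((memLp_const (((2 * Real.pi)⁻¹ : ℝ) : ℂ)).toLp
          (μ := volume.restrict cell) (p := 2) _) y * fderiv ℝ χ y (unitVec i) =
        ∫ y in cell, (((2 * Real.pi)⁻¹ : ℝ) : ℂ) * fderiv ℝ χ y (unitVec i) := by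
      refine integral_congr_ae ?_
      filter_upwards [(memLp_const (((2 * Real.pi)⁻¹ : ℝ) : ℂ)).coeFn_toLp
        (μ := volume.restrict cell) (p := 2)] with y hy
      rw [hy]
    refine e1.trans ?_
    rw [integral_const_mul, integral_cell_partial_eq_zero hχ hp, mul_zero, eq_comm, neg_eq_zero]
    refine integral_eq_zero_of_ae ?_
    filter_upwards [Lp.coeFn_zero ℂ 2 ((volume : Measure Plane).restrict cell)] with y hy
    change (0 : CellL2) y * _ = 0
    rw [hy, Pi.zero_apply, zero_mul]⟩

theorem embL2_constH1 : embL2 constH1 =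
    (memLp_const (((2 * Real.pi)⁻¹ : ℝ) : ℂ)).toLp (μ := volume.restrict cell) (p := 2) _ := rfl

theorem weakPartial_constH1 (i : Fin 2) : weakPartial i constH1 = 0 := rfl

theorem inner_H1per (u v : H1per) : (inner ℂ u v : ℂ) =
    inner ℂ (embL2 u) (embL2 v) + ∑ i, inner ℂ (weakPartial i u) (weakPartial i v) := by
  rw [Submodule.coe_inner, PiLp.inner_apply, Fin.sum_univ_succ]
  rfl

theorem norm_sq_H1per (u : H1per) :
    ‖u‖ ^ 2 = ‖embL2 u‖ ^ 2 + ∑ i, ‖weakPartial i u‖ ^ 2 := by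
  rw [Submodule.coe_norm, PiLp.norm_sq_eq_of_L2, Fin.sum_univ_succ]
  rfl

theorem norm_constH1 : ‖constH1‖ = 1 := by
  have hpi := Real.pi_pos
  have h : ‖constH1‖ ^ 2 = 1 := by
    rw [norm_sq_H1per]
    simp only [weakPartial_constH1, norm_zero, ne_eq, OfNat.ofNat_ne_zero, not_false_eq_true,
      zero_pow, Finset.sum_const_zero, add_zero]
    rw [norm_sq_eq_integral, embL2_constH1]
    have e1 : ∫ y in cell, ‖((memLp_const (((2 * Real.pi)⁻¹ : ℝ) : ℂ)).toLp
        (μ := volume.restrict cell) (p := 2) _) y‖ ^ 2 = ∫ y in cell, ((2 * Real.pi) ^ 2)⁻¹ := by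
      refine integral_congr_ae ?_
      filter_upwards [(memLp_const (((2 * Real.pi)⁻¹ : ℝ) : ℂ)).coeFn_toLp
        (μ := volume.restrict cell) (p := 2)] with y hy
      rw [hy, Complex.norm_real, Real.norm_eq_abs, sq_abs, inv_pow]
    rw [e1, setIntegral_const, Measure.real, volume_cell, ENNReal.toReal_ofReal (by positivity),
      smul_eq_mul, mul_inv_cancel₀ (by positivity)]
  exact (pow_eq_one_iff_of_nonneg (norm_nonneg _) two_ne_zero).mp h

theorem inner_embL2_constH1 (v : H1per) :
    (inner ℂ (embL2 v) (embL2 constH1) : ℂ) = inner ℂ v constH1 := by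
  rw [inner_H1per]
  simp [weakPartial_constH1]

theorem inner_constH1 (u : H1per) :
    (inner ℂ constH1 u : ℂ) = ((2 * Real.pi)⁻¹ : ℝ) * coeffL 0 (embL2 u) := by
  rw [inner_H1per]
  simp only [weakPartial_constH1, inner_zero_left, Finset.sum_const_zero, add_zero]
  rw [coeffL, cellPair_apply, L2.inner_def, ← integral_const_mul]
  refine integral_congr_ae ?_
  filter_upwards [(memLp_const (((2 * Real.pi)⁻¹ : ℝ) : ℂ)).coeFn_toLp
        (μ := volume.restrict cell) (p := 2)] with y hy
  rw [embL2_constH1, hy, RCLike.inner_apply, Complex.conj_ofReal, mul_comm]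
  simp [expChar]

/-- The Poincaré inequality on `H¹_per(Y)`: the nonzero Fourier modes are controlled by the
gradient, since `|m| ≥ 1`, and the zeroth mode is the pairing with the constant. -/
theorem poincare_H1per (u : H1per) :
    ‖u‖ ^ 2 ≤ 2 * (∑ i, ‖weakPartial i u‖ ^ 2 + ‖(inner ℂ constH1 u : ℂ)‖ ^ 2) := by
  have hpi := Real.pi_pos
  have h0 : ‖embL2 u‖ ^ 2 ≤ ‖(inner ℂ constH1 u : ℂ)‖ ^ 2 + ∑ i, ‖weakPartial i u‖ ^ 2 := by
    have h1 := hasSum_coeffL (embL2 u)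
    have h2 := hasSum_sum (s := Finset.univ) fun i _ => hasSum_coeffL (weakPartial i u)
    have h3 := hasSum_ite_eq (0 : Fin 2 → ℤ) (‖(inner ℂ constH1 u : ℂ)‖ ^ 2)
    refine hasSum_le (fun m => ?_) h1 (h3.add h2)
    have hc : 0 ≤ ((2 * Real.pi) ^ 2)⁻¹ * ‖coeffL m (embL2 u)‖ ^ 2 := by positivity
    by_cases hm : m = 0
    · subst hm
      simp only [if_true, coeffL_weakPartial, Pi.zero_apply, Int.cast_zero, mul_zero, zero_mul,
        norm_zero, ne_eq, OfNat.ofNat_ne_zero, not_false_eq_true, zero_pow,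
        Finset.sum_const_zero, add_zero]
      rw [inner_constH1, norm_mul, Complex.norm_real, Real.norm_eq_abs,
        mul_pow |(2 * Real.pi)⁻¹|, sq_abs, inv_pow]
    · simp only [hm, if_false, zero_add, coeffL_weakPartial, norm_mul, Complex.norm_I, one_mul,
        mul_pow, Fin.sum_univ_two, Complex.norm_intCast, sq_abs]
      have h4 : (1 : ℝ) ≤ (m 0 : ℝ) ^ 2 + (m 1 : ℝ) ^ 2 := by
        have : 1 ≤ m 0 ^ 2 + m 1 ^ 2 := by
          by_contra hlt
          have e0 : m 0 = 0 := by nlinarith [sq_nonneg (m 0), sq_nonneg (m 1)]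
          have e1 : m 1 = 0 := by nlinarith [sq_nonneg (m 0), sq_nonneg (m 1)]
          exact hm (funext fun i => by fin_cases i <;> assumption)
        exact_mod_cast this
      have hc' : 0 ≤ (2 ^ 2 * Real.pi ^ 2)⁻¹ * ‖coeffL m (embL2 u)‖ ^ 2 := by positivity
      nlinarith [mul_le_mul_of_nonneg_right h4 hc']
  rw [norm_sq_H1per]
  nlinarith [sq_nonneg ‖(inner ℂ constH1 u : ℂ)‖]

/-! ### The Bloch eigenvalue problem as a form on `H¹_per(Y)` -/

section

/-- Multiplication by a continuous real function as an operator on `L²(Y)`. -/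
def multOp (a : Plane → ℝ) (ha : Continuous a) : CellL2 →L[ℂ] CellL2 :=
  (ContinuousLinearMap.mul ℂ ℂ).holderL (volume.restrict cell) ⊤ 2 2
    ((memLp_cell_of_continuous (Complex.continuous_ofReal.comp ha) ⊤).toLp _)

theorem coeFn_multOp (a : Plane → ℝ) (ha : Continuous a) (f : CellL2) :
    multOp a ha f =ᵐ[volume.restrict cell] fun y => (a y : ℂ) * f y := by
  have h := (ContinuousLinearMap.mul ℂ ℂ).coeFn_holder (r := 2)
    ((memLp_cell_of_continuous (Complex.continuous_ofReal.comp ha) ⊤).toLp _) f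
  filter_upwards [h, (memLp_cell_of_continuous (Complex.continuous_ofReal.comp ha) ⊤).coeFn_toLp]
    with y hy hy2
  refine hy.trans ?_
  rw [hy2]
  rfl

variable {aY : Plane → Matrix (Fin 2) (Fin 2) ℝ}

/-- The operator of multiplication by an entry of the coefficient field. -/
def IsMedium.op (hm : IsMedium aY) (i j : Fin 2) : CellL2 →L[ℂ] CellL2 :=
  multOp (fun y => aY y i j) (hm.contDiff i j).continuous

theorem IsMedium.integrable_term (hm : IsMedium aY) (f g : CellL2) (i j : Fin 2) :
    Integrable (fun y => (aY y i j : ℂ) * f y * conj (g y)) (volume.restrict cell) := by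
  refine (L2.integrable_inner (𝕜 := ℂ) g (hm.op i j f)).congr ?_
  filter_upwards [coeFn_multOp _ (hm.contDiff i j).continuous f] with y hy
  rw [IsMedium.op, hy, RCLike.inner_apply]

theorem IsMedium.sum_inner_op (hm : IsMedium aY) (ξ ζ : Fin 2 → CellL2) :
    (∑ i, ∑ j, inner ℂ (ξ i) (hm.op i j (ζ j)) : ℂ) =
      ∫ y in cell, ∑ i, ∑ j, (aY y i j : ℂ) * ζ j y * conj (ξ i y) := by
  rw [integral_finsetSum _ fun i _ => integrable_finsetSum _ fun j _ =>
    hm.integrable_term (ζ j) (ξ i) i j]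
  refine Finset.sum_congr rfl fun i _ => ?_
  rw [integral_finsetSum _ fun j _ => hm.integrable_term (ζ j) (ξ i) i j]
  refine Finset.sum_congr rfl fun j _ => ?_
  rw [L2.inner_def]
  refine integral_congr_ae ?_
  filter_upwards [coeFn_multOp _ (hm.contDiff i j).continuous (ζ j)] with y hy
  rw [IsMedium.op, hy, RCLike.inner_apply]

theorem IsMedium.form_im (hm : IsMedium aY) (y : Plane) (z : Fin 2 → ℂ) :
    (∑ i, ∑ j, (aY y i j : ℂ) * z j * conj (z i)).im = 0 := by
  have hs : aY y 1 0 = aY y 0 1 := (hm.symm y).apply 0 1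
  simp only [Fin.sum_univ_two, hs, Complex.add_im, Complex.mul_im, Complex.mul_re,
    Complex.ofReal_re, Complex.ofReal_im, Complex.conj_re, Complex.conj_im]
  ring

/-- Ellipticity for complex vectors, from the real and imaginary parts. -/
theorem form_re_ge {γ : ℝ} (hγ : ∀ (y ξ : Plane), γ * ‖ξ‖ ^ 2 ≤ ∑ i, ∑ j, aY y i j * ξ i * ξ j)
    (y : Plane) (z : Fin 2 → ℂ) :
    γ * ∑ i, ‖z i‖ ^ 2 ≤ (∑ i, ∑ j, (aY y i j : ℂ) * z j * conj (z i)).re := by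
  have h1 := hγ y (WithLp.toLp 2 fun i => (z i).re)
  have h2 := hγ y (WithLp.toLp 2 fun i => (z i).im)
  rw [EuclideanSpace.norm_sq_eq] at h1 h2
  simp only [Fin.sum_univ_two, Real.norm_eq_abs, sq_abs] at h1 h2
  simp only [Fin.sum_univ_two, Complex.add_re, Complex.mul_im, Complex.mul_re,
    Complex.ofReal_re, Complex.ofReal_im, Complex.conj_re, Complex.conj_im,
    ← Complex.normSq_eq_norm_sq, Complex.normSq_apply]
  nlinarith

theorem IsMedium.sum_inner_im (hm : IsMedium aY) (ξ : Fin 2 → CellL2) :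
    (∑ i, ∑ j, inner ℂ (ξ i) (hm.op i j (ξ j)) : ℂ).im = 0 := by
  rw [hm.sum_inner_op]
  have hint : Integrable (fun y => ∑ i, ∑ j, (aY y i j : ℂ) * ξ j y * conj (ξ i y))
      (volume.restrict cell) := integrable_finsetSum _ fun i _ => integrable_finsetSum _ fun j _ =>
    hm.integrable_term (ξ j) (ξ i) i j
  have h := integral_im hint
  refine h.symm.trans ?_
  refine integral_eq_zero_of_ae (Eventually.of_forall fun y => ?_)
  exact hm.form_im y fun i => ξ i y

theorem IsMedium.sum_inner_re_ge (hm : IsMedium aY) {γ : ℝ}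
    (hγ : ∀ (y ξ : Plane), γ * ‖ξ‖ ^ 2 ≤ ∑ i, ∑ j, aY y i j * ξ i * ξ j) (ξ : Fin 2 → CellL2) :
    γ * ∑ i, ‖ξ i‖ ^ 2 ≤ (∑ i, ∑ j, inner ℂ (ξ i) (hm.op i j (ξ j)) : ℂ).re := by
  rw [hm.sum_inner_op]
  have hint : Integrable (fun y => ∑ i, ∑ j, (aY y i j : ℂ) * ξ j y * conj (ξ i y))
      (volume.restrict cell) := integrable_finsetSum _ fun i _ => integrable_finsetSum _ fun j _ =>
    hm.integrable_term (ξ j) (ξ i) i j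
  have h := integral_re hint
  refine le_trans ?_ h.le
  have hi : ∀ i, Integrable (fun y => ‖ξ i y‖ ^ 2) (volume.restrict cell) := fun i =>
    (Lp.memLp (ξ i)).integrable_norm_pow (by norm_num)
  simp only [norm_sq_eq_integral]
  rw [← integral_finsetSum _ fun i _ => hi i, ← integral_const_mul]
  refine integral_mono ((integrable_finsetSum _ fun i _ => hi i).const_mul _) hint.re fun y => ?_
  exact form_re_ge hγ y fun i => ξ i y

/-- The Bloch eigenvalue problem in terms of the operators on the Hilbert space `H¹_per(Y)`. -/
theorem isBlochEigenvalue_iff (hm : IsMedium aY) (k : Plane) (μ : ℝ) :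
    IsBlochEigenvalue aY k μ ↔ ∃ u : H1per, u ≠ 0 ∧ ∀ v : H1per,
      ∑ i, ∑ j, inner ℂ (weakPartial i v + (Complex.I * (k i : ℂ)) • embL2 v)
        (hm.op i j (weakPartial j u + (Complex.I * (k j : ℂ)) • embL2 u)) =
        μ * (inner ℂ (embL2 v) (embL2 u) : ℂ) := by
  have key : ∀ (u v : H1per) (ψ χ : Plane → ℂ) (g h : Fin 2 → Plane → ℂ),
      embL2 u =ᵐ[volume.restrict cell] ψ → (∀ i, weakPartial i u =ᵐ[volume.restrict cell] g i) →
      embL2 v =ᵐ[volume.restrict cell] χ → (∀ i, weakPartial i v =ᵐ[volume.restrict cell] h i) →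
      (((∑ i, ∑ j, inner ℂ (weakPartial i v + (Complex.I * (k i : ℂ)) • embL2 v)
        (hm.op i j (weakPartial j u + (Complex.I * (k j : ℂ)) • embL2 u))) =
        μ * (inner ℂ (embL2 v) (embL2 u) : ℂ)) ↔
      ∫ y in cell, ∑ i, ∑ j, (aY y i j : ℂ) * (g j y + Complex.I * (k j : ℂ) * ψ y) *
          conj (h i y + Complex.I * (k i : ℂ) * χ y)
        = (μ : ℂ) * ∫ y in cell, ψ y * conj (χ y)) := by
    intro u v ψ χ g h hψ hg hχ hh
    have hcomb : ∀ (u : H1per) (ψ : Plane → ℂ) (g : Fin 2 → Plane → ℂ),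
        embL2 u =ᵐ[volume.restrict cell] ψ →
        (∀ i, weakPartial i u =ᵐ[volume.restrict cell] g i) → ∀ i,
        (weakPartial i u + (Complex.I * (k i : ℂ)) • embL2 u : CellL2)
          =ᵐ[volume.restrict cell] fun y => g i y + Complex.I * (k i : ℂ) * ψ y := by
      intro u ψ g hψ hg i
      filter_upwards [hψ, hg i, Lp.coeFn_add (weakPartial i u) ((Complex.I * (k i : ℂ)) • embL2 u),
        Lp.coeFn_smul (Complex.I * (k i : ℂ)) (embL2 u)] with y h1 h2 h3 h4
      rw [h3, Pi.add_apply, h4, Pi.smul_apply, h1, h2, smul_eq_mul]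
    rw [hm.sum_inner_op (fun i => weakPartial i v + (Complex.I * (k i : ℂ)) • embL2 v)
      (fun j => weakPartial j u + (Complex.I * (k j : ℂ)) • embL2 u), L2.inner_def]
    have e1 : ∫ y in cell, ∑ i, ∑ j, (aY y i j : ℂ) *
        (weakPartial j u + (Complex.I * (k j : ℂ)) • embL2 u : CellL2) y *
          conj ((weakPartial i v + (Complex.I * (k i : ℂ)) • embL2 v : CellL2) y) =
        ∫ y in cell, ∑ i, ∑ j, (aY y i j : ℂ) * (g j y + Complex.I * (k j : ℂ) * ψ y) *
          conj (h i y + Complex.I * (k i : ℂ) * χ y) := by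
      refine integral_congr_ae ?_
      filter_upwards [eventually_all.mpr (hcomb u ψ g hψ hg), eventually_all.mpr (hcomb v χ h hχ hh)]
        with y h1 h2
      simp only [h1, h2]
    have e2 : ∫ y in cell, (inner ℂ (embL2 v y) (embL2 u y) : ℂ) =
        ∫ y in cell, ψ y * conj (χ y) := by
      refine integral_congr_ae ?_
      filter_upwards [hψ, hχ] with y h1 h2
      rw [h1, h2, RCLike.inner_apply]
    rw [e1, e2]
  have hne : ∀ (u : H1per) (ψ : Plane → ℂ), embL2 u =ᵐ[volume.restrict cell] ψ →
      ((¬ ψ =ᵐ[volume.restrict cell] 0) ↔ u ≠ 0) := by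
    intro u ψ h
    rw [not_iff_not]
    constructor
    · intro h0
      exact embL2_injective u (Lp.eq_zero_iff_ae_eq_zero.mpr (h.trans h0))
    · rintro rfl
      exact h.symm.trans (by rw [map_zero]; exact Lp.coeFn_zero _ _ _)
  constructor
  · rintro ⟨ψ, g, hψg, h0, heq⟩
    obtain ⟨u, hu, hug⟩ := hψg.exists_H1per
    refine ⟨u, (hne u ψ hu).mp h0, fun v => ?_⟩
    obtain ⟨χ, h, hχh, hv, hvh⟩ := exists_isH1per v
    exact (key u v ψ χ g h hu hug hv hvh).mpr (heq χ h hχh)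
  · rintro ⟨u, hu, heq⟩
    obtain ⟨ψ, g, hψg, hu', hug⟩ := exists_isH1per u
    refine ⟨ψ, g, hψg, (hne u ψ hu').mpr hu, fun χ h hχh => ?_⟩
    obtain ⟨v, hv, hvh⟩ := hχh.exists_H1per
    exact (key u v ψ χ g h hu' hug hv hvh).mp (heq v)

/-- The lowest Bloch eigenvalue is analytic near `k = 0`, vanishes there, and is bounded below by
a positive multiple of `|k|²`. -/
theorem IsMedium.blochMin_analytic (hm : IsMedium aY) :
    ContDiffAt ℝ ω (blochMin aY) 0 ∧ blochMin aY 0 = 0 ∧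
      ∃ γ : ℝ, 0 < γ ∧ ∀ᶠ k in 𝓝 (0 : Plane), γ * ‖k‖ ^ 2 ≤ blochMin aY k := by
  obtain ⟨γ, hγ0, hγ⟩ := hm.posDef
  obtain ⟨h1, h2, h3⟩ := contDiffAt_sInf_of_form embL2 weakPartial hm.op constH1 norm_constH1
    weakPartial_constH1 inner_embL2_constH1 embL2_injective hm.sum_inner_im γ hγ0
    (hm.sum_inner_re_ge hγ) poincare_H1per norm_sq_le_shifted_gradient (IsBlochEigenvalue aY)
    (isBlochEigenvalue_iff hm)
  exact ⟨h1, h2, γ, hγ0, h3⟩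

end

/-! ### Reflections -/

section

theorem reflSign_mul_self (m i : Fin 2) : reflSign m i * reflSign m i = 1 := by
  unfold reflSign
  split_ifs <;> norm_num

/-- The coordinate reflection as a linear isometry. -/
def reflEquiv (m : Fin 2) : Plane ≃ₗᵢ[ℝ] Plane where
  toFun := refl m
  invFun := refl m
  map_add' x y := by ext i; simp [refl, mul_add]
  map_smul' c x := by ext i; simp [refl]; ring
  left_inv x := by ext i; simp [refl, ← mul_assoc, reflSign_mul_self]
  right_inv x := by ext i; simp [refl, ← mul_assoc, reflSign_mul_self]
  norm_map' x := by
    have h : ∀ i, ‖reflSign m i * x i‖ = ‖x i‖ := fun i => by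
      unfold reflSign
      split_ifs <;> simp
    simp only [EuclideanSpace.norm_eq]
    congr 1
    exact Finset.sum_congr rfl fun i _ => by rw [← h i]; rfl

theorem reflEquiv_apply (m : Fin 2) (y : Plane) : reflEquiv m y = refl m y := rfl

theorem refl_refl (m : Fin 2) (y : Plane) : refl m (refl m y) = y := (reflEquiv m).left_inv y

theorem refl_unitVec (m i : Fin 2) : refl m (unitVec i) = reflSign m i • unitVec i := by
  ext j
  by_cases h : j = i
  · subst h; simp [refl, unitVec]
  · simp [refl, unitVec, h]

theorem preimage_refl_cell (m : Fin 2) : reflEquiv m ⁻¹' cell = cell := by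
  ext y
  simp only [cell, mem_preimage, mem_ofPred_eq, reflEquiv_apply, refl]
  refine forall_congr' fun i => ?_
  unfold reflSign
  split_ifs
  · simp only [mem_Ioo]
    constructor <;> rintro ⟨h1, h2⟩ <;> constructor <;> linarith
  · rw [one_mul]

theorem integral_cell_comp_refl (m : Fin 2) (F : Plane → ℂ) :
    ∫ y in cell, F (refl m y) = ∫ y in cell, F y := by
  have h := ((reflEquiv m).measurePreserving).setIntegral_preimage_emb
    (reflEquiv m).toHomeomorph.measurableEmbedding F cell
  rw [preimage_refl_cell] at h
  exact h

theorem CellPeriodic.comp_refl {β : Type*} {u : Plane → β} (hu : CellPeriodic u) (m : Fin 2) :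
    CellPeriodic fun y => u (refl m y) := by
  intro j y
  have h1 : refl m (y + (2 * Real.pi) • unitVec j) =
      refl m y + (reflSign m j) • ((2 * Real.pi) • unitVec j) := by
    rw [smul_comm, ← refl_unitVec]
    simp only [← reflEquiv_apply, map_add, map_smul]
  simp only [h1]
  unfold reflSign
  split_ifs
  · rw [← hu j (refl m y + _)]
    congr 1
    rw [neg_one_smul, neg_add_cancel_right]
  · rw [one_smul, hu]

theorem memLp_cell_comp_refl {u : Plane → ℂ} (hu : MemLp u 2 (volume.restrict cell)) (m : Fin 2) :
    MemLp (fun y => u (refl m y)) 2 (volume.restrict cell) := by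
  have h := ((reflEquiv m).measurePreserving).restrict_preimage_emb
    (reflEquiv m).toHomeomorph.measurableEmbedding cell
  rw [preimage_refl_cell] at h
  exact hu.comp_measurePreserving h

theorem fderiv_comp_refl {χ : Plane → ℂ} (hχ : ContDiff ℝ ∞ χ) (m i : Fin 2) (y : Plane) :
    fderiv ℝ (fun y => χ (refl m y)) y (unitVec i) =
      reflSign m i * fderiv ℝ χ (refl m y) (unitVec i) := by
  have h1 : HasFDerivAt (fun y => χ (refl m y))
      ((fderiv ℝ χ (refl m y)) ∘L (reflEquiv m).toContinuousLinearEquiv.toContinuousLinearMap) y :=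
    ((hχ.differentiable (by simp)) (refl m y)).hasFDerivAt.comp y
      (reflEquiv m).toContinuousLinearEquiv.hasFDerivAt
  rw [h1.fderiv, ContinuousLinearMap.comp_apply]
  change fderiv ℝ χ (refl m y) (refl m (unitVec i)) = _
  rw [refl_unitVec, map_smul, Complex.real_smul]

theorem IsH1per.comp_refl {ψ : Plane → ℂ} {g : Fin 2 → Plane → ℂ} (h : IsH1per ψ g) (m : Fin 2) :
    IsH1per (fun y => ψ (refl m y)) (fun i y => reflSign m i * g i (refl m y)) where
  periodic := h.periodic.comp_refl m
  periodic_grad i j y := by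
    simp only [(h.periodic_grad i).comp_refl m j y]
  memLp := memLp_cell_comp_refl h.memLp m
  memLp_grad i := (memLp_cell_comp_refl (h.memLp_grad i) m).const_mul _
  weak_grad χ hχ hp i := by
    have h1 := h.weak_grad (fun y => χ (refl m y))
      (hχ.comp (reflEquiv m).toContinuousLinearEquiv.contDiff) (hp.comp_refl m) i
    rw [← integral_cell_comp_refl m, ← integral_cell_comp_refl m (fun y => g i y * _)] at h1
    simp only [fderiv_comp_refl hχ, refl_refl] at h1
    have hs : ((reflSign m i : ℝ) : ℂ) * (reflSign m i : ℝ) = 1 := by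
      rw [← Complex.ofReal_mul, reflSign_mul_self, Complex.ofReal_one]
    have e1 : ∫ y in cell, ψ (refl m y) * ((reflSign m i : ℂ) * fderiv ℝ χ y (unitVec i)) =
        (reflSign m i : ℂ) * ∫ y in cell, ψ (refl m y) * fderiv ℝ χ y (unitVec i) := by
      rw [← integral_const_mul]
      congr 1
      ext y
      ring
    have e2 : ∫ y in cell, (reflSign m i : ℂ) * g i (refl m y) * χ y =
        (reflSign m i : ℂ) * ∫ y in cell, g i (refl m y) * χ y := by
      rw [← integral_const_mul]
      congr 1
      ext y
      ring
    rw [e1] at h1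
    rw [e2, ← mul_neg, ← h1, ← mul_assoc, hs, one_mul]

variable {aY : Plane → Matrix (Fin 2) (Fin 2) ℝ}

/-- Reflecting an eigenfunction for `k` gives an eigenfunction for the reflected `k`. -/
theorem IsBlochEigenvalue.refl (hs : EvenlySymmetric aY) {k : Plane} {μ : ℝ}
    (h : IsBlochEigenvalue aY k μ) (m : Fin 2) : IsBlochEigenvalue aY (refl m k) μ := by
  obtain ⟨ψ, g, hψ, h0, heq⟩ := h
  refine ⟨_, _, hψ.comp_refl m, fun h1 => h0 ?_, fun χ h hχ => ?_⟩
  · have hq := ((reflEquiv m).measurePreserving).restrict_preimage_emb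
      (reflEquiv m).toHomeomorph.measurableEmbedding cell
    rw [preimage_refl_cell] at hq
    have h2 := hq.quasiMeasurePreserving.ae_eq_comp h1
    filter_upwards [h2] with y hy
    have : ψ (MovingFrame.refl m (MovingFrame.refl m y)) = 0 := hy
    rwa [refl_refl] at this
  · have h2 := heq _ _ (hχ.comp_refl m)
    rw [← integral_cell_comp_refl m, ← integral_cell_comp_refl m (fun y => ψ _ * _)]
    simp only [refl_refl]
    rw [← h2]
    congr 1
    ext y
    refine Finset.sum_congr rfl fun i _ => Finset.sum_congr rfl fun j _ => ?_
    have hsi : ((reflSign m i : ℝ) : ℂ) * (reflSign m i : ℝ) = 1 := by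
      rw [← Complex.ofReal_mul, reflSign_mul_self, Complex.ofReal_one]
    have hsj : ((reflSign m j : ℝ) : ℂ) * (reflSign m j : ℝ) = 1 := by
      rw [← Complex.ofReal_mul, reflSign_mul_self, Complex.ofReal_one]
    have hk : ∀ i, (MovingFrame.refl m k) i = reflSign m i * k i := fun i => rfl
    rw [hs m y i j, hk, hk]
    simp only [Complex.ofReal_mul, map_add, map_mul, Complex.conj_I, Complex.conj_ofReal]
    linear_combination (((reflSign m i : ℝ) : ℂ) * (conj (h i (MovingFrame.refl m y))) +
      -Complex.I * k i * conj (χ (MovingFrame.refl m y)) *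
        (((reflSign m i : ℝ) : ℂ) * (reflSign m i : ℝ))) * (aY y i j : ℂ) *
        (g j y + Complex.I * k j * ψ y) * hsj +
      (-Complex.I * k i * conj (χ (MovingFrame.refl m y))) * (aY y i j : ℂ) *
        (g j y + Complex.I * k j * ψ y) * hsi

theorem blochMin_refl (hs : EvenlySymmetric aY) (m : Fin 2) (k : Plane) :
    blochMin aY (refl m k) = blochMin aY k := by
  unfold blochMin
  congr 1
  ext μ
  refine ⟨fun h => ?_, fun h => IsBlochEigenvalue.refl hs h m⟩
  have := IsBlochEigenvalue.refl hs h m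
  rwa [refl_refl] at this

/-! ### The Taylor coefficients of the lowest Bloch eigenvalue -/

/-- Under a reflection each Taylor coefficient picks up the product of the signs of its indices. -/
theorem iteratedFDeriv_blochMin_refl (hs : EvenlySymmetric aY) (m : Fin 2) {n : ℕ}
    (idx : Fin n → Fin 2) :
    iteratedFDeriv ℝ n (blochMin aY) 0 (fun i => unitVec (idx i)) =
      (∏ i, reflSign m (idx i)) *
        iteratedFDeriv ℝ n (blochMin aY) 0 (fun i => unitVec (idx i)) := by
  have h1 : blochMin aY ∘ (reflEquiv m).toContinuousLinearEquiv = blochMin aY :=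
    funext fun k => blochMin_refl hs m k
  have h2 := (reflEquiv m).toContinuousLinearEquiv.iteratedFDerivWithin_comp_right (blochMin aY)
    uniqueDiffOn_univ (x := 0) (mem_univ _) n
  rw [h1, preimage_univ, iteratedFDerivWithin_univ] at h2
  have h3 := congrArg (fun T => T (fun i => unitVec (idx i))) h2
  simp only [ContinuousMultilinearMap.compContinuousLinearMap_apply, map_zero] at h3
  refine h3.trans ?_
  rw [← smul_eq_mul, ← ContinuousMultilinearMap.map_smul_univ]
  congr 1
  ext1 i
  exact refl_unitVec m (idx i)

theorem iteratedFDeriv_blochMin_eq_zero (hs : EvenlySymmetric aY) (m : Fin 2) {n : ℕ}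
    (idx : Fin n → Fin 2) (h : ∏ i, reflSign m (idx i) = -1) :
    iteratedFDeriv ℝ n (blochMin aY) 0 (fun i => unitVec (idx i)) = 0 := by
  have := iteratedFDeriv_blochMin_refl hs m idx
  rw [h] at this
  linarith

/-- An off-diagonal coefficient changes sign under a reflection. -/
theorem effA_eq_zero (hs : EvenlySymmetric aY) {l m : Fin 2} (h : l ≠ m) : effA aY l m = 0 := by
  have h1 := iteratedFDeriv_blochMin_eq_zero hs l ![l, m]
    (by simp [Fin.prod_univ_two, reflSign, h.symm])
  have h2 : (fun i => unitVec (![l, m] i)) = ![unitVec l, unitVec m] := by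
    ext1 i; fin_cases i <;> rfl
  rw [h2] at h1
  rw [effA, h1, mul_zero]

theorem effC_eq (l m n q : Fin 2) : effC aY l m n q =
    (1 / 24) * iteratedFDeriv ℝ 4 (blochMin aY) 0 (fun i => unitVec (![l, m, n, q] i)) := by
  have h2 : (fun i => unitVec (![l, m, n, q] i)) =
      ![unitVec l, unitVec m, unitVec n, unitVec q] := by
    ext1 i; fin_cases i <;> rfl
  rw [h2]
  rfl

theorem effC_eq_zero (hs : EvenlySymmetric aY) (r l m n q : Fin 2)
    (h : reflSign r l * reflSign r m * reflSign r n * reflSign r q = -1) :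
    effC aY l m n q = 0 := by
  rw [effC_eq, iteratedFDeriv_blochMin_eq_zero hs r ![l, m, n, q], mul_zero]
  simpa [Fin.prod_univ_four] using h

/-- The fourth order coefficients are symmetric in their indices. -/
theorem effC_perm (hm : IsMedium aY) (σ : Equiv.Perm (Fin 4)) (l m n q l' m' n' q' : Fin 2)
    (h : ∀ i, ![l', m', n', q'] i = ![l, m, n, q] (σ i)) :
    effC aY l' m' n' q' = effC aY l m n q := by
  have h1 := hm.blochMin_analytic.1.iteratedFDeriv_comp_perm (n := 4)
    (fun i => unitVec (![l, m, n, q] i)) σ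
  rw [effC_eq, effC_eq, ← h1]
  congr 2
  ext1 i
  rw [h i]
  rfl

/-- The second derivative at a zero minimum with quadratic growth is positive. -/
theorem deriv_deriv_pos_of_quadratic_growth {g : ℝ → ℝ} (hg : ContDiffAt ℝ ω g 0) (h0 : g 0 = 0)
    {γ : ℝ} (hγ : 0 < γ) (hlow : ∀ᶠ t in 𝓝 (0 : ℝ), γ * t ^ 2 ≤ g t) :
    0 < deriv (deriv g) 0 := by
  by_contra hneg
  rw [not_lt] at hneg
  have hmin : IsLocalMin g 0 := by
    filter_upwards [hlow] with t ht
    rw [h0]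
    exact le_trans (by positivity) ht
  have hd0 : deriv g 0 = 0 := hmin.deriv_eq_zero
  have hev : ∀ᶠ t in 𝓝 (0 : ℝ), DifferentiableAt ℝ g t := by
    have h1 : ContDiffAt ℝ 1 g 0 := hg.of_le (by simp)
    filter_upwards [h1.eventually (by simp)] with t ht using ht.differentiableAt (by simp)
  have hdd : DifferentiableAt ℝ (deriv g) 0 :=
    ((hg.derivWithin (m := 1) (by simp)).differentiableAt (by simp))
  -- if the second derivative of `g` were nonpositive, `h` would have a local maximum at zero
  set h : ℝ → ℝ := fun t => g t - γ / 2 * t ^ 2 with hh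
  have hdh : deriv h =ᶠ[𝓝 0] fun t => deriv g t - γ * t := by
    filter_upwards [hev] with t ht
    have := ht.hasDerivAt.sub ((hasDerivAt_pow 2 t).const_mul (γ / 2))
    refine Eq.trans this.deriv ?_
    norm_num
    ring
  have hddh : deriv (deriv h) 0 = deriv (deriv g) 0 - γ := by
    rw [hdh.deriv_eq]
    have := hdd.hasDerivAt.sub ((hasDerivAt_id (0 : ℝ)).const_mul γ)
    rw [mul_one] at this
    exact this.deriv
  have hmax : IsLocalMax h 0 := by
    refine isLocalMax_of_deriv_deriv_neg (by rw [hddh]; linarith) ?_ ?_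
    · rw [hdh.self_of_nhds]; simp [hd0]
    · exact (hg.continuousAt).sub (by fun_prop)
  obtain ⟨δ, hδ, hb⟩ := Metric.eventually_nhds_iff.mp (hmax.and hlow)
  have hb' := hb (y := δ / 2) (by rw [Real.dist_eq, sub_zero, abs_of_pos (by positivity)]; linarith)
  have h1 : h (δ / 2) ≤ h 0 := hb'.1
  simp only [hh, h0] at h1
  nlinarith [hb'.2, mul_pos hγ (pow_pos hδ 2)]

/-- The lowest eigenvalue vanishes at the origin and grows quadratically along each axis. -/
theorem effA_diag_pos (hm : IsMedium aY) (i : Fin 2) : 0 < effA aY i i := by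
  obtain ⟨hcd, h0, γ, hγ, hlow⟩ := hm.blochMin_analytic
  set f := blochMin aY
  set v : Plane := unitVec i with hv
  have hnv : ‖v‖ = 1 := by simp [hv, unitVec]
  have hline : ContDiff ℝ ω fun t : ℝ => t • v := by fun_prop
  have hg : ContDiffAt ℝ ω (fun t : ℝ => f (t • v)) 0 :=
    ContDiffAt.comp (g := f) (f := fun t : ℝ => t • v) 0 (by simpa using hcd) hline.contDiffAt
  have hc : Tendsto (fun t : ℝ => t • v) (𝓝 0) (𝓝 0) := by
    simpa using hline.continuous.tendsto 0
  have hpos := deriv_deriv_pos_of_quadratic_growth hg (by simpa using h0) hγ (by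
    filter_upwards [hc.eventually hlow] with t ht
    simpa [norm_smul, hnv] using ht)
  have hev : ∀ᶠ k in 𝓝 (0 : Plane), DifferentiableAt ℝ f k := by
    have h1 : ContDiffAt ℝ 1 f 0 := hcd.of_le (by simp)
    filter_upwards [h1.eventually (by simp)] with t ht using ht.differentiableAt (by simp)
  have hl : ∀ t : ℝ, HasDerivAt (fun t : ℝ => t • v) v t := fun t => by
    simpa using (hasDerivAt_id t).smul_const v
  have h1 : deriv (fun t : ℝ => f (t • v)) =ᶠ[𝓝 0] fun t => fderiv ℝ f (t • v) v := by
    filter_upwards [hc.eventually hev] with t ht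
    exact (ht.hasFDerivAt.comp_hasDerivAt t (hl t)).deriv
  have hdd : DifferentiableAt ℝ (fderiv ℝ f) 0 :=
    (hcd.fderiv_right (m := 1) (by simp)).differentiableAt (by simp)
  have h2 : HasDerivAt (fun t : ℝ => fderiv ℝ f (t • v)) (fderiv ℝ (fderiv ℝ f) 0 v) 0 := by
    have h3 : HasFDerivAt (fderiv ℝ f) (fderiv ℝ (fderiv ℝ f) 0) ((0 : ℝ) • v) := by
      rw [zero_smul]; exact hdd.hasFDerivAt
    exact h3.comp_hasDerivAt (f := fun t : ℝ => t • v) 0 (hl 0)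
  have h4 : HasDerivAt (fun t : ℝ => fderiv ℝ f (t • v) v) (fderiv ℝ (fderiv ℝ f) 0 v v) 0 := by
    simpa using h2.clm_apply (hasDerivAt_const (0 : ℝ) v)
  rw [h1.deriv_eq, h4.deriv] at hpos
  rw [effA, iteratedFDeriv_two_apply]
  simpa using hpos

/-- The explicit form of the dispersion coefficient for evenly symmetric media. -/
theorem kappa_effC (hm : IsMedium aY) (hs : EvenlySymmetric aY) {a₁ a₂ : ℝ} (h₁ : 0 < a₁)
    (h₂ : 0 < a₂) (φ : ℝ) :
    kappa a₁ a₂ (effC aY) φ =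
      6 * effC aY 0 0 1 1 * (Real.cos φ ^ 2 / a₁) * (Real.sin φ ^ 2 / a₂)
        + effC aY 0 0 0 0 * (Real.cos φ ^ 4 / a₁ ^ 2)
        + effC aY 1 1 1 1 * (Real.sin φ ^ 4 / a₂ ^ 2) := by
  have hz : ∀ l m n q : Fin 2,
      reflSign 0 l * reflSign 0 m * reflSign 0 n * reflSign 0 q = -1 → effC aY l m n q = 0 :=
    effC_eq_zero hs 0
  have p1 := effC_perm hm (Equiv.swap 1 2) 0 0 1 1 0 1 0 1 (by decide)
  have p2 := effC_perm hm (Equiv.swap 1 3) 0 0 1 1 0 1 1 0 (by decide)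
  have p3 := effC_perm hm (Equiv.swap 0 2) 0 0 1 1 1 0 0 1 (by decide)
  have p4 := effC_perm hm (Equiv.swap 0 3) 0 0 1 1 1 0 1 0 (by decide)
  have p5 := effC_perm hm (Equiv.swap 0 2 * Equiv.swap 1 3) 0 0 1 1 1 1 0 0 (by decide)
  simp only [kappa, Fin.sum_univ_two, Matrix.cons_val_zero, Matrix.cons_val_one, p1, p2, p3, p4, p5]
  have z1 := hz 0 0 0 1 (by simp [reflSign])
  have z2 := hz 0 0 1 0 (by simp [reflSign])
  have z3 := hz 0 1 0 0 (by simp [reflSign])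
  have z4 := hz 1 0 0 0 (by simp [reflSign])
  have z5 := hz 0 1 1 1 (by simp [reflSign])
  have z6 := hz 1 0 1 1 (by simp [reflSign])
  have z7 := hz 1 1 0 1 (by simp [reflSign])
  have z8 := hz 1 1 1 0 (by simp [reflSign])
  simp only [z1, z2, z3, z4, z5, z6, z7, z8]
  have e1 : Real.cos φ ^ 2 / a₁ = (Real.cos φ / Real.sqrt a₁) ^ 2 := by
    rw [div_pow, Real.sq_sqrt h₁.le]
  have e2 : Real.sin φ ^ 2 / a₂ = (Real.sin φ / Real.sqrt a₂) ^ 2 := by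
    rw [div_pow, Real.sq_sqrt h₂.le]
  have e3 : Real.cos φ ^ 4 / a₁ ^ 2 = (Real.cos φ / Real.sqrt a₁) ^ 4 := by
    rw [div_pow, show Real.sqrt a₁ ^ 4 = (Real.sqrt a₁ ^ 2) ^ 2 by ring, Real.sq_sqrt h₁.le]
  have e4 : Real.sin φ ^ 4 / a₂ ^ 2 = (Real.sin φ / Real.sqrt a₂) ^ 4 := by
    rw [div_pow, show Real.sqrt a₂ ^ 4 = (Real.sqrt a₂ ^ 2) ^ 2 by ring, Real.sq_sqrt h₂.le]
  rw [e1, e2, e3, e4]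
  ring

end

/-! ### The symbol of the decomposition -/

theorem pd_const_mul_exp (ξ : Fin 2 → ℝ) (c : ℝ) (i : Fin 2) :
    pd i (fun x : Plane => c * Real.exp (∑ j, ξ j * x j)) =
      fun x => (c * ξ i) * Real.exp (∑ j, ξ j * x j) := by
  ext x
  have h1 : HasFDerivAt (fun x : Plane => ∑ j, ξ j * x j)
      (∑ j, ξ j • (EuclideanSpace.proj j : Plane →L[ℝ] ℝ)) x := by
    refine HasFDerivAt.fun_sum fun j _ => ?_
    exact (EuclideanSpace.proj j : Plane →L[ℝ] ℝ).hasFDerivAt.const_mul (ξ j)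
  have h2 := h1.exp.const_mul c
  rw [pd, h2.fderiv]
  fin_cases i <;> simp [unitVec, Fin.sum_univ_two] <;> ring

/-- The decomposition `-C D⁴ = E D² A D² - F D⁴` on the level of symbols, obtained by applying the
operators to the exponential `x ↦ exp (ξ · x)`. -/
theorem IsDecomposition.symbol {A E : Matrix (Fin 2) (Fin 2) ℝ} {C F : Tensor4}
    (h : IsDecomposition A C E F) (ξ : Fin 2 → ℝ) :
    -(∑ i, ∑ j, ∑ k, ∑ l, C i j k l * (ξ i * ξ j * ξ k * ξ l)) =
      (∑ i, ∑ j, E i j * (ξ i * ξ j)) * (∑ i, ∑ j, A i j * (ξ i * ξ j))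
        - ∑ i, ∑ j, ∑ k, ∑ l, F i j k l * (ξ i * ξ j * ξ k * ξ l) := by
  set u : Plane → ℝ := fun x => 1 * Real.exp (∑ j, ξ j * x j) with hu
  have hsm : ContDiff ℝ ∞ u := by
    rw [hu]
    fun_prop
  have h2 : ∀ (M : Matrix (Fin 2) (Fin 2) ℝ) (c : ℝ),
      opD2 M (fun x : Plane => c * Real.exp (∑ j, ξ j * x j)) =
        fun x => (c * ∑ i, ∑ j, M i j * (ξ i * ξ j)) * Real.exp (∑ j, ξ j * x j) := by
    intro M c
    ext x
    simp only [opD2, pd_const_mul_exp, Finset.mul_sum, Finset.sum_mul]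
    refine Finset.sum_congr rfl fun i _ => Finset.sum_congr rfl fun j _ => ?_
    ring
  have h4 : ∀ (G : Tensor4), opD4 G u =
        fun x => (∑ i, ∑ j, ∑ k, ∑ l, G i j k l * (ξ i * ξ j * ξ k * ξ l)) *
          Real.exp (∑ j, ξ j * x j) := by
    intro G
    ext x
    simp only [opD4, hu, pd_const_mul_exp, Finset.sum_mul]
    refine Finset.sum_congr rfl fun i _ => Finset.sum_congr rfl fun j _ =>
      Finset.sum_congr rfl fun k _ => Finset.sum_congr rfl fun l _ => ?_
    ring
  have h5 := h u hsm 0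
  rw [h4, h4] at h5
  rw [hu, h2, h2] at h5
  simp only [PiLp.zero_apply, mul_zero, Finset.sum_const_zero, Real.exp_zero, mul_one,
    one_mul] at h5
  rw [h5]
  ring

/-! ### Calculus in the moving frame -/

/-- The direction of the derivative `∂_φ` in the variables `(r, φ, t)`. -/
def dirPhi : ℝ × ℝ × ℝ := (0, 1, 0)

/-- The derivative in a fixed direction. -/
def dd (v : ℝ × ℝ × ℝ) (h : ℝ × ℝ × ℝ → ℝ) : ℝ × ℝ × ℝ → ℝ := fun p => fderiv ℝ h p v

theorem dd_add {v : ℝ × ℝ × ℝ} {f g : ℝ × ℝ × ℝ → ℝ} (hf : Differentiable ℝ f)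
    (hg : Differentiable ℝ g) : dd v (fun p => f p + g p) = fun p => dd v f p + dd v g p := by
  ext p
  simp only [dd]
  rw [fderiv_fun_add (hf p) (hg p)]
  rfl

theorem dd_mul {v : ℝ × ℝ × ℝ} {f g : ℝ × ℝ × ℝ → ℝ} (hf : Differentiable ℝ f)
    (hg : Differentiable ℝ g) :
    dd v (fun p => f p * g p) = fun p => dd v f p * g p + f p * dd v g p := by
  ext p
  simp only [dd]
  rw [fderiv_fun_mul (hf p) (hg p)]
  simp
  ring

theorem dd_const_mul {v : ℝ × ℝ × ℝ} (c : ℝ) {g : ℝ × ℝ × ℝ → ℝ} (hg : Differentiable ℝ g) :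
    dd v (fun p => c * g p) = fun p => c * dd v g p := by
  ext p
  simp only [dd]
  rw [fderiv_const_mul (hg p)]
  rfl

theorem contDiff_dd {h : ℝ × ℝ × ℝ → ℝ} (hh : ContDiff ℝ ∞ h) (v : ℝ × ℝ × ℝ) :
    ContDiff ℝ ∞ (dd v h) :=
  (hh.fderiv_right (m := ∞) (by simp)).clm_apply contDiff_const

theorem tsupport_dd_subset (v : ℝ × ℝ × ℝ) (h : ℝ × ℝ × ℝ → ℝ) : tsupport (dd v h) ⊆ tsupport h := by
  refine closure_minimal (fun p hp => ?_) isClosed_closure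
  by_contra hn
  apply hp
  have := fderiv_of_notMem_tsupport (𝕜 := ℝ) hn
  simp [dd, this]

/-- The covector `ξ = ∇ r` in elliptic coordinates. -/
def xi (a₁ a₂ : ℝ) (i : Fin 2) (φ : ℝ) : ℝ :=
  (![Real.cos φ / Real.sqrt a₁, Real.sin φ / Real.sqrt a₂] : Fin 2 → ℝ) i

/-- The covector `ζ = r ∇ φ` in elliptic coordinates, which is `dξ / dφ`. -/
def zeta (a₁ a₂ : ℝ) (i : Fin 2) (φ : ℝ) : ℝ :=
  (![-Real.sin φ / Real.sqrt a₁, Real.cos φ / Real.sqrt a₂] : Fin 2 → ℝ) i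

theorem contDiff_xi (a₁ a₂ : ℝ) (i : Fin 2) : ContDiff ℝ ∞ (xi a₁ a₂ i) := by
  unfold xi
  fin_cases i <;> simp <;> fun_prop

theorem contDiff_zeta (a₁ a₂ : ℝ) (i : Fin 2) : ContDiff ℝ ∞ (zeta a₁ a₂ i) := by
  unfold zeta
  fin_cases i <;> simp <;> fun_prop

theorem hasDerivAt_xi (a₁ a₂ : ℝ) (i : Fin 2) (φ : ℝ) :
    HasDerivAt (xi a₁ a₂ i) (zeta a₁ a₂ i φ) φ := by
  unfold xi zeta
  fin_cases i
  · simpa using (Real.hasDerivAt_cos φ).div_const (Real.sqrt a₁)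
  · simpa using (Real.hasDerivAt_sin φ).div_const (Real.sqrt a₂)

theorem hasDerivAt_zeta (a₁ a₂ : ℝ) (i : Fin 2) (φ : ℝ) :
    HasDerivAt (zeta a₁ a₂ i) (-xi a₁ a₂ i φ) φ := by
  unfold xi zeta
  fin_cases i
  · simpa [neg_div] using (Real.hasDerivAt_sin φ).neg.div_const (Real.sqrt a₁)
  · simpa [neg_div] using (Real.hasDerivAt_cos φ).div_const (Real.sqrt a₂)

theorem dd_comp_phi {f : ℝ → ℝ} {f' : ℝ} {p : ℝ × ℝ × ℝ} (hf : HasDerivAt f f' p.2.1)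
    (v : ℝ × ℝ × ℝ) : dd v (fun p => f p.2.1) p = v.2.1 * f' := by
  have h : HasFDerivAt (fun p : ℝ × ℝ × ℝ => p.2.1)
      ((ContinuousLinearMap.fst ℝ ℝ ℝ) ∘L (ContinuousLinearMap.snd ℝ ℝ (ℝ × ℝ))) p :=
    ((ContinuousLinearMap.fst ℝ ℝ ℝ) ∘L (ContinuousLinearMap.snd ℝ ℝ (ℝ × ℝ))).hasFDerivAt
  have h2 := hf.hasFDerivAt.comp p h
  rw [dd]
  refine (congrArg (fun L : (ℝ × ℝ × ℝ) →L[ℝ] ℝ => L v) h2.fderiv).trans ?_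
  simp

/-- The function `t + s r`, that is `s` times the distance from the origin in elliptic coordinates,
where `s = ε²`. -/
def rad (s : ℝ) (p : ℝ × ℝ × ℝ) : ℝ := p.2.2 + s * p.1

theorem contDiff_rad (s : ℝ) : ContDiff ℝ ∞ (rad s) := by
  unfold rad
  fun_prop

theorem dd_rad (s : ℝ) (v p : ℝ × ℝ × ℝ) : dd v (rad s) p = v.2.2 + s * v.1 := by
  have h : HasFDerivAt (rad s) ((ContinuousLinearMap.snd ℝ ℝ ℝ) ∘L
      (ContinuousLinearMap.snd ℝ ℝ (ℝ × ℝ)) + s • ContinuousLinearMap.fst ℝ ℝ (ℝ × ℝ)) p :=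
    ContinuousLinearMap.hasFDerivAt ((ContinuousLinearMap.snd ℝ ℝ ℝ) ∘L
      (ContinuousLinearMap.snd ℝ ℝ (ℝ × ℝ)) + s • ContinuousLinearMap.fst ℝ ℝ (ℝ × ℝ))
  rw [dd, h.fderiv]
  simp

theorem dd_rad_pow (s : ℝ) (n : ℕ) (v p : ℝ × ℝ × ℝ) :
    dd v (fun p => rad s p ^ (n + 1)) p = (n + 1) * rad s p ^ n * (v.2.2 + s * v.1) := by
  have h := (((contDiff_rad s).differentiable (by simp)) p).hasFDerivAt.pow (n + 1)
  rw [← dd_rad s v p, dd]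
  refine (congrArg (fun L : (ℝ × ℝ × ℝ) →L[ℝ] ℝ => L v) h.fderiv).trans ?_
  simp [dd]

/-- The operator `P` with `∂_{x_i} (q^m h) = q^(m - 1) P h`, where `q = t + s r` is `s` times the
elliptic radius. Taking out powers of `q` removes all negative powers of the radius, so that the
operator is polynomial in `s`. -/
def polarOp (a₁ a₂ s : ℝ) (i : Fin 2) (m : ℕ) (h : ℝ × ℝ × ℝ → ℝ) : ℝ × ℝ × ℝ → ℝ := fun p =>
  rad s p * (xi a₁ a₂ i p.2.1 * dd dirR h p)
    + s * (m * (xi a₁ a₂ i p.2.1 * h p) + zeta a₁ a₂ i p.2.1 * dd dirPhi h p)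

/-- The time derivative of a fixed point, seen in the moving frame. -/
def timeOp (s : ℝ) (h : ℝ × ℝ × ℝ → ℝ) : ℝ × ℝ × ℝ → ℝ := fun p => -dd dirR h p + s * dd dirT h p

theorem contDiff_xi_phi (a₁ a₂ : ℝ) (i : Fin 2) :
    ContDiff ℝ ∞ fun p : ℝ × ℝ × ℝ => xi a₁ a₂ i p.2.1 :=
  (contDiff_xi a₁ a₂ i).comp (by fun_prop)

theorem contDiff_zeta_phi (a₁ a₂ : ℝ) (i : Fin 2) :
    ContDiff ℝ ∞ fun p : ℝ × ℝ × ℝ => zeta a₁ a₂ i p.2.1 :=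
  (contDiff_zeta a₁ a₂ i).comp (by fun_prop)

theorem contDiff_polarOp {h : ℝ × ℝ × ℝ → ℝ} (hh : ContDiff ℝ ∞ h) (a₁ a₂ s : ℝ) (i : Fin 2)
    (m : ℕ) : ContDiff ℝ ∞ (polarOp a₁ a₂ s i m h) :=
  ((contDiff_rad s).mul ((contDiff_xi_phi a₁ a₂ i).mul (contDiff_dd hh _))).add
    (contDiff_const.mul ((contDiff_const.mul ((contDiff_xi_phi a₁ a₂ i).mul hh)).add
      ((contDiff_zeta_phi a₁ a₂ i).mul (contDiff_dd hh _))))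

theorem contDiff_timeOp {h : ℝ × ℝ × ℝ → ℝ} (hh : ContDiff ℝ ∞ h) (s : ℝ) :
    ContDiff ℝ ∞ (timeOp s h) :=
  (contDiff_dd hh _).neg.add (contDiff_const.mul (contDiff_dd hh _))

theorem sum_xi_xi {a₁ a₂ : ℝ} (h₁ : 0 < a₁) (h₂ : 0 < a₂) (φ : ℝ) :
    a₁ * xi a₁ a₂ 0 φ ^ 2 + a₂ * xi a₁ a₂ 1 φ ^ 2 = 1 := by
  simp only [xi, Matrix.cons_val_zero, Matrix.cons_val_one, div_pow, Real.sq_sqrt h₁.le,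
    Real.sq_sqrt h₂.le]
  field_simp
  exact Real.cos_sq_add_sin_sq φ

theorem sum_zeta_zeta {a₁ a₂ : ℝ} (h₁ : 0 < a₁) (h₂ : 0 < a₂) (φ : ℝ) :
    a₁ * zeta a₁ a₂ 0 φ ^ 2 + a₂ * zeta a₁ a₂ 1 φ ^ 2 = 1 := by
  simp only [zeta, Matrix.cons_val_zero, Matrix.cons_val_one, div_pow, Real.sq_sqrt h₁.le,
    Real.sq_sqrt h₂.le, neg_sq]
  field_simp
  exact Real.sin_sq_add_cos_sq φ

theorem sum_xi_zeta {a₁ a₂ : ℝ} (h₁ : 0 < a₁) (h₂ : 0 < a₂) (φ : ℝ) :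
    a₁ * (xi a₁ a₂ 0 φ * zeta a₁ a₂ 0 φ) + a₂ * (xi a₁ a₂ 1 φ * zeta a₁ a₂ 1 φ) = 0 := by
  simp only [xi, zeta, Matrix.cons_val_zero, Matrix.cons_val_one, div_mul_div_comm,
    Real.mul_self_sqrt h₁.le, Real.mul_self_sqrt h₂.le]
  field_simp
  ring

/-- The operator `A D²` in elliptic coordinates, where it is the Laplacian of the plane. -/
theorem sum_polarOp_polarOp {a₁ a₂ : ℝ} (h₁ : 0 < a₁) (h₂ : 0 < a₂) (s : ℝ)
    {h : ℝ × ℝ × ℝ → ℝ} (hh : ContDiff ℝ ∞ h) (p : ℝ × ℝ × ℝ) :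
    a₁ * polarOp a₁ a₂ s 0 3 (polarOp a₁ a₂ s 0 4 h) p
      + a₂ * polarOp a₁ a₂ s 1 3 (polarOp a₁ a₂ s 1 4 h) p =
      rad s p ^ 2 * dd dirR (dd dirR h) p + 9 * s * rad s p * dd dirR h p
        + s ^ 2 * (16 * h p + dd dirPhi (dd dirPhi h) p) := by
  have dh : Differentiable ℝ h := hh.differentiable (by simp)
  have dhv : ∀ v, Differentiable ℝ (dd v h) := fun v => (contDiff_dd hh v).differentiable (by simp)
  have dq : Differentiable ℝ (rad s) := (contDiff_rad s).differentiable (by simp)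
  have dx : ∀ i, Differentiable ℝ fun p : ℝ × ℝ × ℝ => xi a₁ a₂ i p.2.1 := fun i =>
    (contDiff_xi_phi a₁ a₂ i).differentiable (by simp)
  have dz : ∀ i, Differentiable ℝ fun p : ℝ × ℝ × ℝ => zeta a₁ a₂ i p.2.1 := fun i =>
    (contDiff_zeta_phi a₁ a₂ i).differentiable (by simp)
  have key : ∀ (i : Fin 2) (v : ℝ × ℝ × ℝ), dd v (polarOp a₁ a₂ s i 4 h) p =
      (v.2.2 + s * v.1) * (xi a₁ a₂ i p.2.1 * dd dirR h p)
      + rad s p * ((v.2.1 * zeta a₁ a₂ i p.2.1) * dd dirR h p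
          + xi a₁ a₂ i p.2.1 * dd v (dd dirR h) p)
      + s * (4 * ((v.2.1 * zeta a₁ a₂ i p.2.1) * h p + xi a₁ a₂ i p.2.1 * dd v h p)
        + ((v.2.1 * -xi a₁ a₂ i p.2.1) * dd dirPhi h p
          + zeta a₁ a₂ i p.2.1 * dd v (dd dirPhi h) p)) := by
    intro i v
    unfold polarOp
    have d1 : Differentiable ℝ fun p => xi a₁ a₂ i p.2.1 * dd dirR h p := (dx i).mul (dhv _)
    have d2 : Differentiable ℝ fun p => xi a₁ a₂ i p.2.1 * h p := (dx i).mul dh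
    have d3 : Differentiable ℝ fun p => zeta a₁ a₂ i p.2.1 * dd dirPhi h p := (dz i).mul (dhv _)
    have d4 : Differentiable ℝ fun p => ((4 : ℕ) : ℝ) * (xi a₁ a₂ i p.2.1 * h p) := d2.const_mul _
    have d5 : Differentiable ℝ fun p => ((4 : ℕ) : ℝ) * (xi a₁ a₂ i p.2.1 * h p)
      + zeta a₁ a₂ i p.2.1 * dd dirPhi h p := d4.add d3
    have d6 : Differentiable ℝ fun p => rad s p * (xi a₁ a₂ i p.2.1 * dd dirR h p) := dq.mul d1
    rw [dd_add d6 (d5.const_mul s), dd_mul dq d1, dd_mul (dx i) (dhv _),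
      dd_const_mul _ d5, dd_add d4 d3, dd_const_mul _ d2, dd_mul (dx i) dh, dd_mul (dz i) (dhv _)]
    simp only [dd_rad, dd_comp_phi (hasDerivAt_xi a₁ a₂ i p.2.1),
      dd_comp_phi (hasDerivAt_zeta a₁ a₂ i p.2.1)]
    push_cast
    ring
  have hval : ∀ i, polarOp a₁ a₂ s i 4 h p = rad s p * (xi a₁ a₂ i p.2.1 * dd dirR h p)
    + s * ((4 : ℕ) * (xi a₁ a₂ i p.2.1 * h p) + zeta a₁ a₂ i p.2.1 * dd dirPhi h p) := fun i => rfl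
  have hexp : ∀ i, polarOp a₁ a₂ s i 3 (polarOp a₁ a₂ s i 4 h) p =
      rad s p * (xi a₁ a₂ i p.2.1 * dd dirR (polarOp a₁ a₂ s i 4 h) p)
      + s * ((3 : ℕ) * (xi a₁ a₂ i p.2.1 * polarOp a₁ a₂ s i 4 h p)
        + zeta a₁ a₂ i p.2.1 * dd dirPhi (polarOp a₁ a₂ s i 4 h) p) := fun i => rfl
  rw [hexp, hexp, key, key, key, key, hval, hval]
  have e1 := sum_xi_xi h₁ h₂ p.2.1
  have e2 := sum_zeta_zeta h₁ h₂ p.2.1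
  have e3 := sum_xi_zeta h₁ h₂ p.2.1
  simp only [dirR, dirPhi]
  push_cast
  generalize xi a₁ a₂ 0 p.2.1 = x0 at *
  generalize xi a₁ a₂ 1 p.2.1 = x1 at *
  generalize zeta a₁ a₂ 0 p.2.1 = z0 at *
  generalize zeta a₁ a₂ 1 p.2.1 = z1 at *
  generalize rad s p = q at *
  generalize dd (1, 0, 0) h p = hr at *
  generalize dd (0, 1, 0) h p = hp at *
  generalize dd (1, 0, 0) (dd (1, 0, 0) h) p = hrr at *
  generalize dd (1, 0, 0) (dd (0, 1, 0) h) p = hpr at *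
  generalize dd (0, 1, 0) (dd (1, 0, 0) h) p = hrp at *
  generalize dd (0, 1, 0) (dd (0, 1, 0) h) p = hpp at *
  generalize h p = h0 at *
  linear_combination (q ^ 2 * hrr + 8 * s * q * hr + 12 * s ^ 2 * h0) * e1
    + (s * q * hr + 4 * s ^ 2 * h0 + s ^ 2 * hpp) * e2
    + (s * q * hpr + 3 * s ^ 2 * hp + s * q * hrp + 4 * s ^ 2 * hp - s ^ 2 * hp) * e3

/-! ### Polynomial families of test functions -/

section

/-- Families of functions that are polynomial in the parameter `s`, with smooth coefficients
supported in `K`. -/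
inductive PolyFamily (K : Set (ℝ × ℝ × ℝ)) : (ℝ → ℝ × ℝ × ℝ → ℝ) → Prop
  | const {c : ℝ × ℝ × ℝ → ℝ} (hc : ContDiff ℝ ∞ c) (hK : tsupport c ⊆ K) :
      PolyFamily K fun _ p => c p
  | add {f g : ℝ → ℝ × ℝ × ℝ → ℝ} (hf : PolyFamily K f) (hg : PolyFamily K g) :
      PolyFamily K fun s p => f s p + g s p
  | param_mul {f : ℝ → ℝ × ℝ × ℝ → ℝ} (hf : PolyFamily K f) : PolyFamily K fun s p => s * f s p

namespace PolyFamily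

variable {K : Set (ℝ × ℝ × ℝ)} {f g : ℝ → ℝ × ℝ × ℝ → ℝ}

theorem contDiff (hf : PolyFamily K f) (s : ℝ) : ContDiff ℝ ∞ (f s) := by
  induction hf with
  | const hc _ => exact hc
  | add _ _ h1 h2 => exact h1.add h2
  | param_mul _ h => exact contDiff_const.mul h

theorem smooth_mul (hf : PolyFamily K f) {b : ℝ × ℝ × ℝ → ℝ} (hb : ContDiff ℝ ∞ b) :
    PolyFamily K fun s p => b p * f s p := by
  induction hf with
  | const hc hK => exact const (hb.mul hc) (tsupport_mul_subset_right.trans hK)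
  | add _ _ h1 h2 =>
    simp only [mul_add]
    exact h1.add h2
  | param_mul _ h =>
    simp only [mul_left_comm (b _)]
    exact h.param_mul

theorem const_mul (hf : PolyFamily K f) (c : ℝ) : PolyFamily K fun s p => c * f s p :=
  hf.smooth_mul contDiff_const

theorem sub (hf : PolyFamily K f) (hg : PolyFamily K g) :
    PolyFamily K fun s p => f s p - g s p := by
  simpa only [neg_one_mul, ← sub_eq_add_neg] using hf.add (hg.const_mul (-1))

theorem sum_two {f : Fin 2 → ℝ → ℝ × ℝ × ℝ → ℝ} (hf : ∀ i, PolyFamily K (f i)) :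
    PolyFamily K fun s p => ∑ i, f i s p := by
  simp only [Fin.sum_univ_two]
  exact (hf 0).add (hf 1)

theorem dd (hf : PolyFamily K f) (v : ℝ × ℝ × ℝ) : PolyFamily K fun s => dd v (f s) := by
  induction hf with
  | const hc hK => exact const (contDiff_dd hc v) ((tsupport_dd_subset v _).trans hK)
  | add h1 h2 ih1 ih2 =>
    have : ∀ s, _ := fun s => dd_add (v := v) ((h1.contDiff s).differentiable (by simp))
      ((h2.contDiff s).differentiable (by simp))
    simp only [this]
    exact ih1.add ih2
  | param_mul h ih =>
    have : ∀ s, _ := fun s => dd_const_mul (v := v) s ((h.contDiff s).differentiable (by simp))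
    simp only [this]
    exact ih.param_mul

theorem rad_mul (hf : PolyFamily K f) : PolyFamily K fun s p => rad s p * f s p := by
  simp only [rad, add_mul, mul_assoc]
  exact (hf.smooth_mul (b := fun p => p.2.2) (by fun_prop)).add
    (hf.smooth_mul (b := fun p => p.1) (by fun_prop)).param_mul

theorem rad_pow_mul (hf : PolyFamily K f) (n : ℕ) :
    PolyFamily K fun s p => rad s p ^ n * f s p := by
  induction n with
  | zero => simpa using hf
  | succ n ih =>
    simp only [pow_succ', mul_assoc]
    exact ih.rad_mul

theorem polarOp (hf : PolyFamily K f) (a₁ a₂ : ℝ) (i : Fin 2) (m : ℕ) :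
    PolyFamily K fun s => polarOp a₁ a₂ s i m (f s) :=
  ((hf.dd dirR).smooth_mul (contDiff_xi_phi a₁ a₂ i)).rad_mul.add
    (((hf.smooth_mul (contDiff_xi_phi a₁ a₂ i)).const_mul m).add
      ((hf.dd dirPhi).smooth_mul (contDiff_zeta_phi a₁ a₂ i))).param_mul

theorem timeOp (hf : PolyFamily K f) : PolyFamily K fun s => timeOp s (f s) := by
  have := ((hf.dd dirR).const_mul (-1)).add (hf.dd dirT).param_mul
  simp only [neg_one_mul] at this
  exact this

/-- For functions `V n` converging in the sense of distributions, the pairing with a polynomial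
family along parameters tending to zero converges to the pairing of the limit with the constant
coefficient. -/
theorem tendsto_integral {Ω : TopologicalSpace.Opens (ℝ × ℝ × ℝ)} (hKΩ : K ⊆ Ω) (hK : IsCompact K)
    {V : ℕ → ℝ × ℝ × ℝ → ℝ} {W : 𝓓'(Ω, ℝ)} (hW : TendstoInDistributions V W)
    (hint : ∀ c : ℝ × ℝ × ℝ → ℝ, ContDiff ℝ ∞ c → tsupport c ⊆ K →
      ∀ᶠ n in atTop, IntegrableOn (fun p => V n p * c p) Ω)
    {s : ℕ → ℝ} (hs : Tendsto s atTop (𝓝 0)) (hf : PolyFamily K f) :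
    (∀ᶠ n in atTop, IntegrableOn (fun p => V n p * f (s n) p) Ω) ∧
    ∃ ψ : 𝓓(Ω, ℝ), (∀ p, ψ p = f 0 p) ∧
      Tendsto (fun n => ∫ p in (Ω : Set (ℝ × ℝ × ℝ)), V n p * f (s n) p) atTop (𝓝 (W ψ)) := by
  induction hf with
  | @const c hc hcK =>
    exact ⟨hint c hc hcK, ⟨c, hc, hK.of_isClosed_subset (isClosed_tsupport _) hcK,
      hcK.trans hKΩ⟩, fun p => rfl, hW _⟩
  | add h1 h2 ih1 ih2 =>
    obtain ⟨i1, ψ1, e1, t1⟩ := ih1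
    obtain ⟨i2, ψ2, e2, t2⟩ := ih2
    refine ⟨?_, ψ1 + ψ2, fun p => ?_, ?_⟩
    · filter_upwards [i1, i2] with n h h'
      simp only [mul_add]
      exact h.add h'
    · exact congrArg₂ (· + ·) (e1 p) (e2 p)
    · rw [map_add]
      refine (t1.add t2).congr' ?_
      filter_upwards [i1, i2] with n h h'
      simp only [mul_add]
      rw [integral_add h h']
  | param_mul h ih =>
    obtain ⟨i1, ψ1, e1, t1⟩ := ih
    refine ⟨?_, 0, fun p => ?_, ?_⟩
    · filter_upwards [i1] with n h
      simp only [mul_left_comm (V _ _)]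
      exact h.const_mul _
    · exact (zero_mul _).symm
    · rw [map_zero]
      have := hs.mul t1
      rw [zero_mul] at this
      refine this.congr fun n => ?_
      rw [← integral_const_mul]
      simp only [mul_left_comm (V _ _)]

end PolyFamily

/-! ### The weakly dispersive operator in the moving frame -/

theorem timeOp_timeOp (s : ℝ) {h : ℝ × ℝ × ℝ → ℝ} (hh : ContDiff ℝ ∞ h) :
    timeOp s (timeOp s h) = fun p => dd dirR (dd dirR h) p
      + s * (-dd dirR (dd dirT h) p - dd dirT (dd dirR h) p + s * dd dirT (dd dirT h) p) := by
  have dhv : ∀ v, Differentiable ℝ (dd v h) := fun v => (contDiff_dd hh v).differentiable (by simp)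
  have key : ∀ v, dd v (timeOp s h) = fun p => -1 * dd v (dd dirR h) p + s * dd v (dd dirT h) p := by
    intro v
    have e : timeOp s h = fun p => -1 * dd dirR h p + s * dd dirT h p := by
      ext p; simp [timeOp]
    have d1 : Differentiable ℝ fun p => -1 * dd dirR h p := (dhv _).const_mul _
    have d2 : Differentiable ℝ fun p => s * dd dirT h p := (dhv _).const_mul _
    rw [e, dd_add d1 d2, dd_const_mul _ (dhv _), dd_const_mul _ (dhv _)]
  ext p
  rw [timeOp, key, key]
  ring

theorem dd_dirR_mul {b : ℝ × ℝ → ℝ} (hb : ContDiff ℝ ∞ b) {f : ℝ × ℝ × ℝ → ℝ}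
    (hf : ContDiff ℝ ∞ f) : dd dirR (fun p => b p.2 * f p) = fun p => b p.2 * dd dirR f p := by
  have hb' : Differentiable ℝ fun p : ℝ × ℝ × ℝ => b p.2 :=
    (hb.comp contDiff_snd).differentiable (by simp)
  rw [dd_mul hb' (hf.differentiable (by simp))]
  ext p
  have h0 : dd dirR (fun p : ℝ × ℝ × ℝ => b p.2) p = 0 := by
    have h1 : HasFDerivAt (fun p : ℝ × ℝ × ℝ => b p.2)
        ((fderiv ℝ b p.2) ∘L (ContinuousLinearMap.snd ℝ ℝ (ℝ × ℝ))) p :=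
      ((hb.differentiable (by simp)) p.2).hasFDerivAt.comp p
        (ContinuousLinearMap.snd ℝ ℝ (ℝ × ℝ)).hasFDerivAt
    rw [dd, h1.fderiv]
    exact (fderiv ℝ b p.2).map_zero
  rw [h0, zero_mul, zero_add]

theorem polarOp_zero_mul (a₁ a₂ : ℝ) (i : Fin 2) (m : ℕ) {b : ℝ × ℝ → ℝ} (hb : ContDiff ℝ ∞ b)
    {f : ℝ × ℝ × ℝ → ℝ} (hf : ContDiff ℝ ∞ f) :
    polarOp a₁ a₂ 0 i m (fun p => b p.2 * f p) =
      fun p => (p.2.2 * xi a₁ a₂ i p.2.1 * b p.2) * dd dirR f p := by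
  ext p
  rw [polarOp, dd_dirR_mul hb hf, rad]
  ring

theorem contDiff_mul_xi {b : ℝ × ℝ → ℝ} (hb : ContDiff ℝ ∞ b) (a₁ a₂ : ℝ) (i : Fin 2) :
    ContDiff ℝ ∞ fun u : ℝ × ℝ => u.2 * xi a₁ a₂ i u.1 * b u :=
  (contDiff_snd.mul ((contDiff_xi a₁ a₂ i).comp contDiff_fst)).mul hb

theorem polarOp_zero_two (a₁ a₂ : ℝ) (i j : Fin 2) (m n : ℕ) {f : ℝ × ℝ × ℝ → ℝ}
    (hf : ContDiff ℝ ∞ f) : polarOp a₁ a₂ 0 i m (polarOp a₁ a₂ 0 j n f) =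
      fun p => (p.2.2 ^ 2 * (xi a₁ a₂ i p.2.1 * xi a₁ a₂ j p.2.1)) * dd dirR (dd dirR f) p := by
  have h0 : ContDiff ℝ ∞ fun _ : ℝ × ℝ => (1 : ℝ) := contDiff_const
  have e1 := polarOp_zero_mul a₁ a₂ j n h0 hf
  simp only [one_mul] at e1
  rw [e1, polarOp_zero_mul a₁ a₂ i m (contDiff_mul_xi h0 a₁ a₂ j) (contDiff_dd hf _)]
  ext p
  ring

theorem polarOp_zero_four (a₁ a₂ : ℝ) (i j k l : Fin 2) (m₁ m₂ m₃ m₄ : ℕ) {f : ℝ × ℝ × ℝ → ℝ}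
    (hf : ContDiff ℝ ∞ f) :
    polarOp a₁ a₂ 0 i m₁ (polarOp a₁ a₂ 0 j m₂ (polarOp a₁ a₂ 0 k m₃ (polarOp a₁ a₂ 0 l m₄ f))) =
      fun p => (p.2.2 ^ 4 * (xi a₁ a₂ i p.2.1 * xi a₁ a₂ j p.2.1 * xi a₁ a₂ k p.2.1
        * xi a₁ a₂ l p.2.1)) * dd dirR (dd dirR (dd dirR (dd dirR f))) p := by
  have h0 : ContDiff ℝ ∞ fun _ : ℝ × ℝ => (1 : ℝ) := contDiff_const
  have e1 := polarOp_zero_mul a₁ a₂ l m₄ h0 hf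
  simp only [one_mul] at e1
  have h1 := contDiff_mul_xi h0 a₁ a₂ l
  have h2 := contDiff_mul_xi h1 a₁ a₂ k
  have h3 := contDiff_mul_xi h2 a₁ a₂ j
  have c1 := contDiff_dd hf dirR
  have c2 := contDiff_dd c1 dirR
  have c3 := contDiff_dd c2 dirR
  rw [e1, polarOp_zero_mul a₁ a₂ k m₃ h1 c1, polarOp_zero_mul a₁ a₂ j m₂ h2 c2,
    polarOp_zero_mul a₁ a₂ i m₁ h3 c3]
  ext p
  ring

/-- The expression into which the weakly dispersive operator, divided by `s = ε²`, transforms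
in the moving frame when it acts on `q⁴ η`, where `q = t + s r`. The leading wave operator has
cancelled. -/
def frameOp (a₁ a₂ : ℝ) (E : Matrix (Fin 2) (Fin 2) ℝ) (F : Tensor4) (η : ℝ × ℝ × ℝ → ℝ) (s : ℝ) :
    ℝ × ℝ × ℝ → ℝ := fun p =>
  rad s p ^ 4 * (-1 * dd dirR (dd dirT η) p - dd dirT (dd dirR η) p + s * dd dirT (dd dirT η) p)
    - 9 * (rad s p ^ 3 * dd dirR η p)
    - s * (rad s p ^ 2 * (16 * η p + dd dirPhi (dd dirPhi η) p))
    - rad s p ^ 2 * (∑ i, ∑ j, E i j *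
        polarOp a₁ a₂ s i 3 (polarOp a₁ a₂ s j 4 (timeOp s (timeOp s η))) p)
    + ∑ i, ∑ j, ∑ k, ∑ l, F i j k l * polarOp a₁ a₂ s i 1 (polarOp a₁ a₂ s j 2
        (polarOp a₁ a₂ s k 3 (polarOp a₁ a₂ s l 4 η))) p

/-- Since only powers of `q = t + s r` and of `s` enter, the limit `s → 0` is regular. -/
theorem polyFamily_frameOp (a₁ a₂ : ℝ) (E : Matrix (Fin 2) (Fin 2) ℝ) (F : Tensor4)
    {η : ℝ × ℝ × ℝ → ℝ} (hη : ContDiff ℝ ∞ η) :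
    PolyFamily (tsupport η) (frameOp a₁ a₂ E F η) := by
  have h0 : PolyFamily (tsupport η) fun _ => η := .const hη subset_rfl
  exact ((((((((h0.dd dirT).dd dirR).const_mul (-1)).sub ((h0.dd dirR).dd dirT)).add
      ((h0.dd dirT).dd dirT).param_mul).rad_pow_mul 4).sub
      (((h0.dd dirR).rad_pow_mul 3).const_mul 9)).sub
      (((h0.const_mul 16).add ((h0.dd dirPhi).dd dirPhi)).rad_pow_mul 2).param_mul).sub
      ((PolyFamily.sum_two fun i => PolyFamily.sum_two fun j =>
        ((h0.timeOp.timeOp.polarOp a₁ a₂ j 4).polarOp a₁ a₂ i 3).const_mul (E i j)).rad_pow_mul 2)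
    |>.add (PolyFamily.sum_two fun i => PolyFamily.sum_two fun j => PolyFamily.sum_two fun k =>
      PolyFamily.sum_two fun l => ((((h0.polarOp a₁ a₂ l 4).polarOp a₁ a₂ k 3).polarOp
        a₁ a₂ j 2).polarOp a₁ a₂ i 1).const_mul (F i j k l))

/-- The limit operator. At `s = 0` every polar derivative reduces to `t ξ_i ∂_r`, so that `E` and
`F` enter only through their symbols at `ξ`. -/
theorem frameOp_zero (a₁ a₂ : ℝ) (E : Matrix (Fin 2) (Fin 2) ℝ) (F : Tensor4)
    {η : ℝ × ℝ × ℝ → ℝ} (hη : ContDiff ℝ ∞ η) (p : ℝ × ℝ × ℝ) :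
    frameOp a₁ a₂ E F η 0 p =
      p.2.2 ^ 4 * (-dd dirR (dd dirT η) p - dd dirT (dd dirR η) p) - 9 * p.2.2 ^ 3 * dd dirR η p
      + p.2.2 ^ 4 * ((∑ i, ∑ j, ∑ k, ∑ l, F i j k l * (xi a₁ a₂ i p.2.1 * xi a₁ a₂ j p.2.1
          * xi a₁ a₂ k p.2.1 * xi a₁ a₂ l p.2.1))
        - ∑ i, ∑ j, E i j * (xi a₁ a₂ i p.2.1 * xi a₁ a₂ j p.2.1)) *
          dd dirR (dd dirR (dd dirR (dd dirR η))) p := by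
  have e1 : timeOp 0 (timeOp 0 η) = dd dirR (dd dirR η) := by
    rw [timeOp_timeOp 0 hη]
    simp
  have c2 := contDiff_dd (contDiff_dd hη dirR) dirR
  simp only [frameOp, e1, polarOp_zero_two a₁ a₂ _ _ _ _ c2,
    polarOp_zero_four a₁ a₂ _ _ _ _ _ _ _ _ hη]
  simp only [rad, Fin.sum_univ_two]
  ring

end

/-! ### Transforming test functions to elliptic coordinates -/

section

/-- The spatial partial derivative of a function on space-time. -/
def spacePartial (i : Fin 2) (Φ : Plane × ℝ → ℝ) : Plane × ℝ → ℝ :=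
  fun p => fderiv ℝ Φ p (unitVec i, 0)

/-- The time derivative of a function on space-time. -/
def timePartial (Φ : Plane × ℝ → ℝ) : Plane × ℝ → ℝ := fun p => fderiv ℝ Φ p (0, 1)

theorem contDiff_spacePartial {Φ : Plane × ℝ → ℝ} (h : ContDiff ℝ ∞ Φ) (i : Fin 2) :
    ContDiff ℝ ∞ (spacePartial i Φ) :=
  (h.fderiv_right (m := ∞) (by simp)).clm_apply contDiff_const

theorem contDiff_timePartial {Φ : Plane × ℝ → ℝ} (h : ContDiff ℝ ∞ Φ) :
    ContDiff ℝ ∞ (timePartial Φ) :=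
  (h.fderiv_right (m := ∞) (by simp)).clm_apply contDiff_const

theorem pd_slice {Φ : Plane × ℝ → ℝ} (h : ContDiff ℝ ∞ Φ) (i : Fin 2) (t : ℝ) :
    pd i (fun x => Φ (x, t)) = fun x => spacePartial i Φ (x, t) := by
  ext x
  have h1 : HasFDerivAt (fun x : Plane => (x, t)) (ContinuousLinearMap.inl ℝ Plane ℝ) x :=
    hasFDerivAt_prodMk_left x t
  have h2 := (((h.differentiable (by simp)) (x, t)).hasFDerivAt).comp x h1
  rw [pd]
  refine (congrArg (fun L : Plane →L[ℝ] ℝ => L (unitVec i)) h2.fderiv).trans ?_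
  simp [spacePartial]

theorem deriv_slice {Φ : Plane × ℝ → ℝ} (h : ContDiff ℝ ∞ Φ) (x : Plane) :
    deriv (fun s => Φ (x, s)) = fun t => timePartial Φ (x, t) := by
  ext t
  have h1 : HasDerivAt (fun s : ℝ => (x, s)) ((0 : Plane), (1 : ℝ)) t :=
    (hasDerivAt_const _ _).prodMk (hasDerivAt_id _)
  exact ((((h.differentiable (by simp)) (x, t)).hasFDerivAt).comp_hasDerivAt t h1).deriv

theorem dt_one {Φ : Plane × ℝ → ℝ} (h : ContDiff ℝ ∞ Φ) (x : Plane) (t : ℝ) :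
    dt 1 Φ x t = timePartial Φ (x, t) := by
  rw [dt, iteratedDeriv_one, deriv_slice h]

theorem dt_two {Φ : Plane × ℝ → ℝ} (h : ContDiff ℝ ∞ Φ) (x : Plane) (t : ℝ) :
    dt 2 Φ x t = timePartial (timePartial Φ) (x, t) := by
  rw [dt, iteratedDeriv_succ, iteratedDeriv_one, deriv_slice h,
    deriv_slice (contDiff_timePartial h)]

theorem opD2_slice {Φ : Plane × ℝ → ℝ} (h : ContDiff ℝ ∞ Φ) (M : Matrix (Fin 2) (Fin 2) ℝ)
    (x : Plane) (t : ℝ) : opD2 M (fun x => Φ (x, t)) x =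
      ∑ i, ∑ j, M i j * spacePartial i (spacePartial j Φ) (x, t) := by
  simp only [opD2, pd_slice h, pd_slice (contDiff_spacePartial h _)]

theorem opD4_slice {Φ : Plane × ℝ → ℝ} (h : ContDiff ℝ ∞ Φ) (G : Tensor4)
    (x : Plane) (t : ℝ) : opD4 G (fun x => Φ (x, t)) x =
      ∑ i, ∑ j, ∑ k, ∑ l, G i j k l *
        spacePartial i (spacePartial j (spacePartial k (spacePartial l Φ))) (x, t) := by
  have h1 := fun l => contDiff_spacePartial h l
  have h2 := fun l k => contDiff_spacePartial (h1 l) k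
  have h3 := fun l k j => contDiff_spacePartial (h2 l k) j
  simp only [opD4, pd_slice h, pd_slice (h1 _), pd_slice (h2 _ _), pd_slice (h3 _ _ _)]

/-- The test function in the weak formulation of the weakly dispersive equation with `s = ε²`. -/
theorem weak_integrand_eq {Φ : Plane × ℝ → ℝ} (h : ContDiff ℝ ∞ Φ)
    (A E : Matrix (Fin 2) (Fin 2) ℝ) (F : Tensor4) (s : ℝ) (p : Plane × ℝ) :
    dt 2 Φ p.1 p.2 - opD2 A (fun x => Φ (x, p.2)) p.1
      - s * opD2 E (fun x => dt 2 Φ x p.2) p.1 + s * opD4 F (fun x => Φ (x, p.2)) p.1 =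
    timePartial (timePartial Φ) p
      - (∑ i, ∑ j, A i j * spacePartial i (spacePartial j Φ) p)
      - s * (∑ i, ∑ j, E i j *
          spacePartial i (spacePartial j (timePartial (timePartial Φ))) p)
      + s * ∑ i, ∑ j, ∑ k, ∑ l, F i j k l *
          spacePartial i (spacePartial j (spacePartial k (spacePartial l Φ))) p := by
  have h2 := contDiff_timePartial (contDiff_timePartial h)
  simp only [dt_two h]
  rw [opD2_slice h, opD2_slice h2, opD4_slice h]

/-- `Φ` expressed in elliptic coordinates and in the moving frame with rescaled time, on the
branch of the angle around `θ₀`, is the function `g`. -/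
structure IsFrameRep (a₁ a₂ s θ₀ : ℝ) (Φ : Plane × ℝ → ℝ) (g : ℝ × ℝ × ℝ → ℝ) : Prop where
  contDiff : ContDiff ℝ ∞ Φ
  eq : ∀ ρ θ t, 0 < ρ → |θ - θ₀| < Real.pi →
    Φ (elliptic a₁ a₂ ρ θ, t) = g (ρ - t, θ, s * t)

theorem hasDerivAt_elliptic_radius (a₁ a₂ ρ θ : ℝ) :
    HasDerivAt (fun ρ => elliptic a₁ a₂ ρ θ) (elliptic a₁ a₂ 1 θ) ρ := by
  have h : (fun ρ => elliptic a₁ a₂ ρ θ) = fun ρ => ρ • elliptic a₁ a₂ 1 θ := by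
    ext ρ i
    fin_cases i <;> simp [elliptic] <;> ring
  rw [h]
  simpa using (hasDerivAt_id ρ).smul_const (elliptic a₁ a₂ 1 θ)

/-- The derivative of the elliptic coordinates in the angle, at unit radius. -/
def ellipticTangent (a₁ a₂ θ : ℝ) : Plane :=
  !₂[-(Real.sqrt a₁ * Real.sin θ), Real.sqrt a₂ * Real.cos θ]

theorem hasDerivAt_elliptic_angle (a₁ a₂ ρ θ : ℝ) :
    HasDerivAt (fun θ => elliptic a₁ a₂ ρ θ) (ρ • ellipticTangent a₁ a₂ θ) θ := by
  have h : HasDerivAt (fun θ => (elliptic a₁ a₂ ρ θ).ofLp) (ρ • ellipticTangent a₁ a₂ θ).ofLp θ := by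
    rw [hasDerivAt_pi]
    intro i
    fin_cases i
    · have := (Real.hasDerivAt_cos θ).const_mul (ρ * Real.sqrt a₁)
      simpa [elliptic, ellipticTangent, mul_assoc] using this
    · have := (Real.hasDerivAt_sin θ).const_mul (ρ * Real.sqrt a₂)
      simpa [elliptic, ellipticTangent, mul_assoc] using this
  exact ((EuclideanSpace.equiv (Fin 2) ℝ).symm.hasFDerivAt.comp_hasDerivAt θ h)

/-- The unit vectors in the frame of the radial and angular directions. -/
theorem unitVec_eq_elliptic {a₁ a₂ : ℝ} (h₁ : 0 < a₁) (h₂ : 0 < a₂) (i : Fin 2) (θ : ℝ) :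
    unitVec i = xi a₁ a₂ i θ • elliptic a₁ a₂ 1 θ + zeta a₁ a₂ i θ • ellipticTangent a₁ a₂ θ := by
  have s1 : Real.sqrt a₁ ≠ 0 := (Real.sqrt_pos.mpr h₁).ne'
  have s2 : Real.sqrt a₂ ≠ 0 := (Real.sqrt_pos.mpr h₂).ne'
  have hcs := Real.cos_sq_add_sin_sq θ
  ext j
  fin_cases i <;> fin_cases j <;> simp [unitVec, xi, zeta, elliptic, ellipticTangent] <;>
    field_simp <;> linarith

namespace IsFrameRep

variable {a₁ a₂ s θ₀ : ℝ} {Φ : Plane × ℝ → ℝ} {g h : ℝ × ℝ × ℝ → ℝ}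

theorem fderiv_radius (hr : IsFrameRep a₁ a₂ s θ₀ Φ g) (hg : ContDiff ℝ ∞ g) {ρ θ : ℝ} (t : ℝ)
    (hρ : 0 < ρ) (hθ : |θ - θ₀| < Real.pi) :
    fderiv ℝ Φ (elliptic a₁ a₂ ρ θ, t) (elliptic a₁ a₂ 1 θ, 0) =
      dd dirR g (ρ - t, θ, s * t) := by
  have h1 := ((hr.contDiff.differentiable (by simp)) (elliptic a₁ a₂ ρ θ, t)).hasFDerivAt
    |>.comp_hasDerivAt ρ ((hasDerivAt_elliptic_radius a₁ a₂ ρ θ).prodMk (hasDerivAt_const ρ t))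
  have h2 := ((hg.differentiable (by simp)) (ρ - t, θ, s * t)).hasFDerivAt
    |>.comp_hasDerivAt ρ (((hasDerivAt_id ρ).sub_const t).prodMk
      ((hasDerivAt_const ρ θ).prodMk (hasDerivAt_const ρ (s * t))))
  refine h1.unique (h2.congr_of_eventuallyEq ?_)
  filter_upwards [lt_mem_nhds hρ] with ρ' hρ'
  exact hr.eq ρ' θ t hρ' hθ

theorem fderiv_angle (hr : IsFrameRep a₁ a₂ s θ₀ Φ g) (hg : ContDiff ℝ ∞ g) {ρ θ : ℝ} (t : ℝ)
    (hρ : 0 < ρ) (hθ : |θ - θ₀| < Real.pi) :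
    ρ * fderiv ℝ Φ (elliptic a₁ a₂ ρ θ, t) (ellipticTangent a₁ a₂ θ, 0) =
      dd dirPhi g (ρ - t, θ, s * t) := by
  have h1 := ((hr.contDiff.differentiable (by simp)) (elliptic a₁ a₂ ρ θ, t)).hasFDerivAt
    |>.comp_hasDerivAt θ ((hasDerivAt_elliptic_angle a₁ a₂ ρ θ).prodMk (hasDerivAt_const θ t))
  have h2 := ((hg.differentiable (by simp)) (ρ - t, θ, s * t)).hasFDerivAt
    |>.comp_hasDerivAt θ ((hasDerivAt_const θ (ρ - t)).prodMk
      ((hasDerivAt_id θ).prodMk (hasDerivAt_const θ (s * t))))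
  have e : ρ * fderiv ℝ Φ (elliptic a₁ a₂ ρ θ, t) (ellipticTangent a₁ a₂ θ, 0) =
      fderiv ℝ Φ (elliptic a₁ a₂ ρ θ, t) (ρ • ellipticTangent a₁ a₂ θ, 0) := by
    rw [← smul_eq_mul, ← map_smul]
    simp
  rw [e]
  refine h1.unique (h2.congr_of_eventuallyEq ?_)
  have hc : Continuous fun θ' : ℝ => |θ' - θ₀| := by fun_prop
  filter_upwards [hc.continuousAt.eventually (gt_mem_nhds hθ)] with θ' hθ'
  exact hr.eq ρ θ' t hρ hθ'

theorem spacePartial (h₁ : 0 < a₁) (h₂ : 0 < a₂) {m : ℕ} (hh : ContDiff ℝ ∞ h)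
    (hr : IsFrameRep a₁ a₂ s θ₀ Φ fun p => rad s p ^ (m + 1) * h p) (i : Fin 2) :
    IsFrameRep a₁ a₂ s θ₀ (spacePartial i Φ)
      fun p => rad s p ^ m * polarOp a₁ a₂ s i (m + 1) h p where
  contDiff := contDiff_spacePartial hr.contDiff i
  eq ρ θ t hρ hθ := by
    have dq : Differentiable ℝ fun p : ℝ × ℝ × ℝ => rad s p ^ (m + 1) :=
      ((contDiff_rad s).pow _).differentiable (by simp)
    have hg : ContDiff ℝ ∞ fun p => rad s p ^ (m + 1) * h p := ((contDiff_rad s).pow _).mul hh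
    have e1 := hr.fderiv_radius hg t hρ hθ
    have e2 := hr.fderiv_angle hg t hρ hθ
    rw [dd_mul dq (hh.differentiable (by simp))] at e1 e2
    simp only [dd_rad_pow] at e1 e2
    have hq : rad s (ρ - t, θ, s * t) = s * ρ := by
      simp only [rad]; ring
    have e3 : fderiv ℝ Φ (elliptic a₁ a₂ ρ θ, t) (unitVec i, 0) =
        xi a₁ a₂ i θ * fderiv ℝ Φ (elliptic a₁ a₂ ρ θ, t) (elliptic a₁ a₂ 1 θ, 0)
        + zeta a₁ a₂ i θ * fderiv ℝ Φ (elliptic a₁ a₂ ρ θ, t) (ellipticTangent a₁ a₂ θ, 0) := by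
      rw [← smul_eq_mul, ← smul_eq_mul, ← map_smul, ← map_smul, ← map_add]
      congr 1
      simp [← unitVec_eq_elliptic h₁ h₂ i θ]
    simp only [hq, dirPhi, dirR] at e1 e2
    have e4 : fderiv ℝ Φ (elliptic a₁ a₂ ρ θ, t) (ellipticTangent a₁ a₂ θ, 0) =
        s * (s * ρ) ^ m * dd dirPhi h (ρ - t, θ, s * t) := by
      apply mul_left_cancel₀ hρ.ne'
      rw [e2, dirPhi]
      ring
    rw [MovingFrame.spacePartial, e3, e1, e4]
    simp only [polarOp, hq, dirR]
    push_cast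
    ring

theorem timePartial {m : ℕ} (hh : ContDiff ℝ ∞ h)
    (hr : IsFrameRep a₁ a₂ s θ₀ Φ fun p => rad s p ^ (m + 1) * h p) :
    IsFrameRep a₁ a₂ s θ₀ (timePartial Φ) fun p => rad s p ^ (m + 1) * timeOp s h p where
  contDiff := contDiff_timePartial hr.contDiff
  eq ρ θ t hρ hθ := by
    have dq : Differentiable ℝ fun p : ℝ × ℝ × ℝ => rad s p ^ (m + 1) :=
      ((contDiff_rad s).pow _).differentiable (by simp)
    have hg : ContDiff ℝ ∞ fun p => rad s p ^ (m + 1) * h p := ((contDiff_rad s).pow _).mul hh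
    have h1 := ((hr.contDiff.differentiable (by simp)) (elliptic a₁ a₂ ρ θ, t)).hasFDerivAt
      |>.comp_hasDerivAt t ((hasDerivAt_const t (elliptic a₁ a₂ ρ θ)).prodMk (hasDerivAt_id t))
    have h2 := ((hg.differentiable (by simp)) (ρ - t, θ, s * t)).hasFDerivAt
      |>.comp_hasDerivAt t (((hasDerivAt_id t).const_sub ρ).prodMk
        ((hasDerivAt_const t θ).prodMk ((hasDerivAt_id t).const_mul s)))
    have h3 := h1.unique (h2.congr_of_eventuallyEq
      (Eventually.of_forall fun t' => hr.eq ρ θ t' hρ hθ))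
    refine h3.trans ?_
    change dd (-1, 0, s * 1) _ _ = _
    rw [dd_mul dq (hh.differentiable (by simp))]
    simp only [dd_rad_pow]
    have e : dd (-1, 0, s * 1) h (ρ - t, θ, s * t) = timeOp s h (ρ - t, θ, s * t) := by
      have : ((-1, 0, s * 1) : ℝ × ℝ × ℝ) = (-1 : ℝ) • dirR + s • dirT := by simp [dirR, dirT]
      rw [timeOp, dd, this, map_add, map_smul, map_smul]
      simp [dd]
    rw [e]
    ring

/-- In the moving frame the weakly dispersive operator acts as `s` times `frameOp`. -/
theorem weak_integrand (h₁ : 0 < a₁) (h₂ : 0 < a₂) {η : ℝ × ℝ × ℝ → ℝ} (hη : ContDiff ℝ ∞ η)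
    (hr : IsFrameRep a₁ a₂ s θ₀ Φ fun p => rad s p ^ 4 * η p)
    (E : Matrix (Fin 2) (Fin 2) ℝ) (F : Tensor4) {ρ θ : ℝ} (t : ℝ)
    (hρ : 0 < ρ) (hθ : |θ - θ₀| < Real.pi) :
    MovingFrame.timePartial (MovingFrame.timePartial Φ) (elliptic a₁ a₂ ρ θ, t)
      - (∑ i, ∑ j, (Matrix.diagonal ![a₁, a₂] : Matrix (Fin 2) (Fin 2) ℝ) i j *
          MovingFrame.spacePartial i (MovingFrame.spacePartial j Φ) (elliptic a₁ a₂ ρ θ, t))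
      - s * (∑ i, ∑ j, E i j * MovingFrame.spacePartial i (MovingFrame.spacePartial j
          (MovingFrame.timePartial (MovingFrame.timePartial Φ))) (elliptic a₁ a₂ ρ θ, t))
      + s * ∑ i, ∑ j, ∑ k, ∑ l, F i j k l *
          MovingFrame.spacePartial i (MovingFrame.spacePartial j (MovingFrame.spacePartial k
            (MovingFrame.spacePartial l Φ))) (elliptic a₁ a₂ ρ θ, t) =
    s * frameOp a₁ a₂ E F η s (ρ - t, θ, s * t) := by
  have c1 := fun l => contDiff_polarOp hη a₁ a₂ s l 4
  have c2 := fun l k => contDiff_polarOp (c1 l) a₁ a₂ s k 3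
  have c3 := fun l k j => contDiff_polarOp (c2 l k) a₁ a₂ s j 2
  have d1 := contDiff_timeOp hη s
  have d2 := contDiff_timeOp d1 s
  have ht := (hr.timePartial (m := 3) hη).timePartial (m := 3) d1
  have r1 := fun l => hr.spacePartial h₁ h₂ (m := 3) hη l
  have r2 := fun l k => (r1 l).spacePartial h₁ h₂ (m := 2) (c1 l) k
  have r3 := fun l k j => (r2 l k).spacePartial h₁ h₂ (m := 1) (c2 l k) j
  have r4 := fun l k j i => (r3 l k j).spacePartial h₁ h₂ (m := 0) (c3 l k j) i
  have q1 := fun j => ht.spacePartial h₁ h₂ (m := 3) d2 j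
  have q2 := fun j i => (q1 j).spacePartial h₁ h₂ (m := 2) (contDiff_polarOp d2 a₁ a₂ s j 4) i
  have et := ht.eq ρ θ t hρ hθ
  have e2 := fun l k => (r2 l k).eq ρ θ t hρ hθ
  have e4 := fun l k j i => (r4 l k j i).eq ρ θ t hρ hθ
  have f2 := fun j i => (q2 j i).eq ρ θ t hρ hθ
  rw [et]
  simp only [e2, e4, f2]
  set p : ℝ × ℝ × ℝ := (ρ - t, θ, s * t)
  have hA : ∑ i, ∑ j, (Matrix.diagonal ![a₁, a₂] : Matrix (Fin 2) (Fin 2) ℝ) i j *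
      (rad s p ^ 2 * polarOp a₁ a₂ s i (2 + 1) (polarOp a₁ a₂ s j (3 + 1) η) p) =
      rad s p ^ 2 * (rad s p ^ 2 * dd dirR (dd dirR η) p + 9 * s * rad s p * dd dirR η p
        + s ^ 2 * (16 * η p + dd dirPhi (dd dirPhi η) p)) := by
    rw [← sum_polarOp_polarOp h₁ h₂ s hη p]
    simp [Fin.sum_univ_two]
    ring
  rw [hA]
  have ett : timeOp s (timeOp s η) p = _ := congrFun (timeOp_timeOp s hη) p
  rw [ett]
  simp only [frameOp, Finset.mul_sum, pow_zero, zero_add, one_mul, Nat.reduceAdd]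
  simp only [Fin.sum_univ_two]
  ring

end IsFrameRep

end

/-! ### Test functions on space-time from test functions in the moving frame -/

/-- A point of the plane as a complex number in the normalised coordinates `x_i / √a_i`, rotated by
`-θ₀`. Its modulus is the elliptic radius, and its argument is the elliptic angle relative to `θ₀`
in `(-π, π]`. -/
def planeComplex (a₁ a₂ θ₀ : ℝ) (x : Plane) : ℂ :=
  ((x 0 / Real.sqrt a₁ : ℝ) + (x 1 / Real.sqrt a₂ : ℝ) * Complex.I) *
    Complex.exp (-(θ₀ * Complex.I))

theorem contDiff_planeComplex (a₁ a₂ θ₀ : ℝ) : ContDiff ℝ ∞ (planeComplex a₁ a₂ θ₀) := by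
  unfold planeComplex
  have h : ∀ f : Plane → ℝ, ContDiff ℝ ∞ f → ContDiff ℝ ∞ fun x => ((f x : ℝ) : ℂ) := fun f hf =>
    Complex.ofRealCLM.contDiff.comp hf
  exact ((h _ (by fun_prop)).add ((h _ (by fun_prop)).mul contDiff_const)).mul contDiff_const

theorem planeComplex_elliptic {a₁ a₂ : ℝ} (h₁ : 0 < a₁) (h₂ : 0 < a₂) (θ₀ ρ θ : ℝ) :
    planeComplex a₁ a₂ θ₀ (elliptic a₁ a₂ ρ θ) = ρ * Complex.exp ((θ - θ₀ : ℝ) * Complex.I) := by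
  have s1 : Real.sqrt a₁ ≠ 0 := (Real.sqrt_pos.mpr h₁).ne'
  have s2 : Real.sqrt a₂ ≠ 0 := (Real.sqrt_pos.mpr h₂).ne'
  have e1 : ρ * Real.sqrt a₁ * Real.cos θ / Real.sqrt a₁ = ρ * Real.cos θ := by field_simp
  have e2 : ρ * Real.sqrt a₂ * Real.sin θ / Real.sqrt a₂ = ρ * Real.sin θ := by field_simp
  have e3 : Complex.exp ((θ - θ₀ : ℝ) * Complex.I) =
      Complex.exp (θ * Complex.I) * Complex.exp (-(θ₀ * Complex.I)) := by
    rw [← Complex.exp_add]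
    congr 1
    push_cast
    ring
  simp only [planeComplex, elliptic, PiLp.toLp_apply, Matrix.cons_val_zero, Matrix.cons_val_one]
  rw [e1, e2, e3, Complex.exp_mul_I (θ : ℂ)]
  push_cast
  ring

theorem elliptic_planeComplex {a₁ a₂ : ℝ} (h₁ : 0 < a₁) (h₂ : 0 < a₂) (θ₀ : ℝ) (x : Plane) :
    elliptic a₁ a₂ ‖planeComplex a₁ a₂ θ₀ x‖ (θ₀ + (planeComplex a₁ a₂ θ₀ x).arg) = x := by
  have s1 : Real.sqrt a₁ ≠ 0 := (Real.sqrt_pos.mpr h₁).ne'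
  have s2 : Real.sqrt a₂ ≠ 0 := (Real.sqrt_pos.mpr h₂).ne'
  set z := planeComplex a₁ a₂ θ₀ x with hz
  have h : (‖z‖ : ℂ) * Complex.exp ((θ₀ + z.arg : ℝ) * Complex.I) =
      (x 0 / Real.sqrt a₁ : ℝ) + (x 1 / Real.sqrt a₂ : ℝ) * Complex.I := by
    have e : Complex.exp ((θ₀ + z.arg : ℝ) * Complex.I) =
        Complex.exp (z.arg * Complex.I) * Complex.exp (θ₀ * Complex.I) := by
      rw [← Complex.exp_add]
      congr 1
      push_cast
      ring
    rw [e, ← mul_assoc, Complex.norm_mul_exp_arg_mul_I, hz, planeComplex, mul_assoc,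
      ← Complex.exp_add, neg_add_cancel, Complex.exp_zero, mul_one]
  have hre := congrArg Complex.re h
  have him := congrArg Complex.im h
  rw [Complex.re_ofReal_mul, Complex.exp_ofReal_mul_I_re] at hre
  rw [Complex.im_ofReal_mul, Complex.exp_ofReal_mul_I_im] at him
  simp only [Complex.add_re, Complex.add_im, Complex.ofReal_re, Complex.ofReal_im,
    Complex.re_ofReal_mul, Complex.im_ofReal_mul, Complex.I_re, Complex.I_im, mul_zero, add_zero,
    mul_one, zero_add] at hre him
  ext i
  fin_cases i
  · change ‖z‖ * Real.sqrt a₁ * Real.cos _ = x 0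
    rw [mul_right_comm, hre, div_mul_cancel₀ _ s1]
  · change ‖z‖ * Real.sqrt a₂ * Real.sin _ = x 1
    rw [mul_right_comm, him, div_mul_cancel₀ _ s2]

theorem arg_planeComplex_elliptic {a₁ a₂ : ℝ} (h₁ : 0 < a₁) (h₂ : 0 < a₂) {θ₀ ρ θ : ℝ}
    (hρ : 0 < ρ) (hθ : |θ - θ₀| < Real.pi) :
    (planeComplex a₁ a₂ θ₀ (elliptic a₁ a₂ ρ θ)).arg = θ - θ₀ := by
  have hθ' := abs_lt.mp hθ
  rw [planeComplex_elliptic h₁ h₂, Complex.exp_mul_I]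
  exact Complex.arg_mul_cos_add_sin_mul_I hρ ⟨by exact_mod_cast hθ'.1, by exact_mod_cast hθ'.2.le⟩

/-- The map from the moving frame, with `s = ε²`, to space-time. -/
def frameMap (a₁ a₂ s : ℝ) (p : ℝ × ℝ × ℝ) : Plane × ℝ :=
  (elliptic a₁ a₂ (p.1 + p.2.2 / s) p.2.1, p.2.2 / s)

theorem continuous_frameMap (a₁ a₂ s : ℝ) : Continuous (frameMap a₁ a₂ s) := by
  have h : Continuous fun p : ℝ × ℝ × ℝ =>
      (![(p.1 + p.2.2 / s) * Real.sqrt a₁ * Real.cos p.2.1,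
        (p.1 + p.2.2 / s) * Real.sqrt a₂ * Real.sin p.2.1] : Fin 2 → ℝ) := by
    refine continuous_pi fun i => ?_
    fin_cases i <;> simp <;> fun_prop
  exact ((PiLp.continuous_toLp 2 _).comp h).prodMk (by fun_prop)

/-- A test function in the moving frame, supported where the elliptic radius is positive and the
angle lies in one branch, is the representation of a test function on space-time. -/
theorem exists_isFrameRep {a₁ a₂ s T : ℝ} (h₁ : 0 < a₁) (h₂ : 0 < a₂) (hs : 0 < s) (θ₀ : ℝ)
    {g : ℝ × ℝ × ℝ → ℝ} (hg : ContDiff ℝ ∞ g) (hc : HasCompactSupport g)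
    (hsupp : ∀ p ∈ tsupport g, p.2.2 ∈ Ioo 0 T ∧ |p.2.1 - θ₀| < Real.pi ∧ 0 < rad s p) :
    ∃ Φ, IsFrameRep a₁ a₂ s θ₀ Φ g ∧ HasCompactSupport Φ ∧
      tsupport Φ ⊆ univ ×ˢ Ioo 0 (T / s) := by
  set z := planeComplex a₁ a₂ θ₀ with hz
  set Φ : Plane × ℝ → ℝ := fun q => g (‖z q.1‖ - q.2, θ₀ + (z q.1).arg, s * q.2) with hΦ
  -- the support of `Φ` is the image of the support of `g`
  set K := frameMap a₁ a₂ s '' tsupport g with hK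
  have hKc : IsCompact K := hc.image (continuous_frameMap a₁ a₂ s)
  have hsub : tsupport Φ ⊆ K := by
    refine closure_minimal (fun q hq => ?_) hKc.isClosed
    refine ⟨_, subset_tsupport g hq, ?_⟩
    have e : s * q.2 / s = q.2 := by field_simp
    simp only [frameMap, e, sub_add_cancel]
    rw [hz, elliptic_planeComplex h₁ h₂ θ₀ q.1]
  have hval : ∀ ρ θ t, 0 < ρ → |θ - θ₀| < Real.pi →
      Φ (elliptic a₁ a₂ ρ θ, t) = g (ρ - t, θ, s * t) := by
    intro ρ θ t hρ hθ
    have harg : (z (elliptic a₁ a₂ ρ θ)).arg = θ - θ₀ :=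
      arg_planeComplex_elliptic h₁ h₂ hρ hθ
    have hnorm : ‖z (elliptic a₁ a₂ ρ θ)‖ = ρ := by
      rw [hz, planeComplex_elliptic h₁ h₂, norm_mul, Complex.norm_exp_ofReal_mul_I, mul_one,
        Complex.norm_real, Real.norm_eq_abs, abs_of_pos hρ]
    simp only [hΦ, harg, hnorm, add_sub_cancel]
  -- on this support the argument is smooth, as the branch cut is avoided
  have hslit : ∀ q ∈ K, z q.1 ∈ Complex.slitPlane := by
    rintro q ⟨p, hp, rfl⟩
    obtain ⟨-, hθ, hr⟩ := hsupp p hp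
    have hρ : 0 < p.1 + p.2.2 / s := by
      have : p.1 + p.2.2 / s = rad s p / s := by
        rw [rad]; field_simp; ring
      rw [this]
      positivity
    have hθ' := abs_lt.mp hθ
    simp only [frameMap, hz]
    rw [Complex.mem_slitPlane_iff_arg, arg_planeComplex_elliptic h₁ h₂ hρ hθ,
      planeComplex_elliptic h₁ h₂]
    exact ⟨hθ'.2.ne, mul_ne_zero (Complex.ofReal_ne_zero.mpr hρ.ne') (Complex.exp_ne_zero _)⟩
  have hcd : ContDiff ℝ ∞ Φ := by
    rw [contDiff_iff_contDiffAt]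
    intro q
    by_cases hq : q ∈ K
    · have hq' := hslit q hq
      have hz1 : ContDiffAt ℝ ∞ (fun q : Plane × ℝ => z q.1) q :=
        ((contDiff_planeComplex a₁ a₂ θ₀).comp contDiff_fst).contDiffAt
      have hn : ContDiffAt ℝ ∞ (fun q : Plane × ℝ => ‖z q.1‖) q :=
        hz1.norm ℝ (Complex.slitPlane_ne_zero hq')
      have hlog : ContDiffAt ℝ ∞ (fun q : Plane × ℝ => Complex.log (z q.1)) q :=
        ContDiffAt.comp (g := Complex.log) (f := fun q : Plane × ℝ => z q.1) q
          ((Complex.contDiffAt_log hq').restrict_scalars ℝ) hz1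
      have harg : ContDiffAt ℝ ∞ (fun q : Plane × ℝ => (z q.1).arg) q := by
        have := Complex.imCLM.contDiff.contDiffAt.comp q hlog
        refine this.congr_of_eventuallyEq (Eventually.of_forall fun q => ?_)
        simp [Complex.log_im]
      exact hg.contDiffAt.comp q ((hn.sub contDiffAt_snd).prodMk
        ((contDiffAt_const.add harg).prodMk (contDiffAt_const.mul contDiffAt_snd)))
    · have h0 : Φ =ᶠ[𝓝 q] fun _ => 0 :=
        notMem_tsupport_iff_eventuallyEq.mp fun h => hq (hsub h)
      exact contDiffAt_const.congr_of_eventuallyEq h0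
  refine ⟨Φ, ⟨hcd, hval⟩, hKc.of_isClosed_subset (isClosed_tsupport _) hsub, ?_⟩
  intro q hq
  obtain ⟨p, hp, rfl⟩ := hsub hq
  have := (hsupp p hp).1
  exact ⟨mem_univ _, div_pos this.1 hs, div_lt_div_of_pos_right this.2 hs⟩

/-! ### Change of variables -/

/-- A linear change of variables in an integral, up to an unspecified constant. -/
theorem exists_lintegral_comp_continuousLinearEquiv {X Y : Type*}
    [NormedAddCommGroup X] [NormedSpace ℝ X] [MeasurableSpace X] [BorelSpace X]
    [NormedAddCommGroup Y] [NormedSpace ℝ Y] [FiniteDimensional ℝ Y] [MeasurableSpace Y]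
    [BorelSpace Y] (L : X ≃L[ℝ] Y) (μ : Measure X) (ν : Measure Y) [μ.IsAddHaarMeasure]
    [ν.IsAddHaarMeasure] :
    ∃ c : ENNReal, c ≠ 0 ∧ c ≠ ⊤ ∧ ∀ f : Y → ENNReal, Measurable f →
      ∫⁻ x, f (L x) ∂μ = c * ∫⁻ y, f y ∂ν := by
  have := FiniteDimensional.proper_real Y
  have := L.isAddHaarMeasure_map μ
  refine ⟨(μ.map L).addHaarScalarFactor ν, ?_, ENNReal.coe_ne_top, fun f hf => ?_⟩
  · exact ENNReal.coe_ne_zero.mpr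
      (Measure.addHaarScalarFactor_pos_of_isAddHaarMeasure (μ.map L) ν).ne'
  · rw [← lintegral_map hf L.continuous.measurable]
    conv_lhs => rw [Measure.isAddLeftInvariant_eq_smul (μ.map L) ν]
    rw [lintegral_smul_measure]
    rfl

/-- The linear map `(r, φ, τ) ↦ ((r + τ / s, φ), τ / s)` from the moving frame with `s = ε²`. -/
def frameEquiv {s : ℝ} (hs : s ≠ 0) : (ℝ × ℝ × ℝ) ≃L[ℝ] ((ℝ × ℝ) × ℝ) :=
  LinearEquiv.toContinuousLinearEquiv
    { toFun := fun p => ((p.1 + p.2.2 / s, p.2.1), p.2.2 / s)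
      invFun := fun q => (q.1.1 - q.2, q.1.2, s * q.2)
      map_add' := fun p q => by simp [add_div]; ring
      map_smul' := fun c p => by simp [mul_div_assoc, mul_add]
      left_inv := fun p => by ext <;> simp <;> field_simp
      right_inv := fun q => by ext <;> simp <;> field_simp <;> ring }

/-- The linear map of the plane with `(ρ cos θ, ρ sin θ) ↦ elliptic a₁ a₂ ρ (θ₀ + θ)`. -/
def ellipticEquiv {a₁ a₂ : ℝ} (h₁ : 0 < a₁) (h₂ : 0 < a₂) (θ₀ : ℝ) : (ℝ × ℝ) ≃L[ℝ] Plane :=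
  LinearEquiv.toContinuousLinearEquiv
    { toFun := fun y => !₂[Real.sqrt a₁ * (y.1 * Real.cos θ₀ - y.2 * Real.sin θ₀),
        Real.sqrt a₂ * (y.1 * Real.sin θ₀ + y.2 * Real.cos θ₀)]
      invFun := fun x => (x 0 / Real.sqrt a₁ * Real.cos θ₀ + x 1 / Real.sqrt a₂ * Real.sin θ₀,
        x 1 / Real.sqrt a₂ * Real.cos θ₀ - x 0 / Real.sqrt a₁ * Real.sin θ₀)
      map_add' := fun p q => by
        ext i
        fin_cases i <;> simp <;> ring
      map_smul' := fun c p => by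
        ext i
        fin_cases i <;> simp <;> ring
      left_inv := fun p => by
        have s1 : Real.sqrt a₁ ≠ 0 := (Real.sqrt_pos.mpr h₁).ne'
        have s2 : Real.sqrt a₂ ≠ 0 := (Real.sqrt_pos.mpr h₂).ne'
        ext
        · simp only [Matrix.cons_val_zero, Matrix.cons_val_one]
          field_simp
          linear_combination p.1 * Real.cos_sq_add_sin_sq θ₀
        · simp only [Matrix.cons_val_zero, Matrix.cons_val_one]
          field_simp
          linear_combination p.2 * Real.cos_sq_add_sin_sq θ₀
      right_inv := fun x => by
        have s1 : Real.sqrt a₁ ≠ 0 := (Real.sqrt_pos.mpr h₁).ne'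
        have s2 : Real.sqrt a₂ ≠ 0 := (Real.sqrt_pos.mpr h₂).ne'
        ext i
        fin_cases i
        · simp
          field_simp
          linear_combination x 0 * Real.sqrt a₂ * Real.cos_sq_add_sin_sq θ₀
        · simp
          field_simp
          linear_combination x 1 * Real.sqrt a₁ * Real.cos_sq_add_sin_sq θ₀ }

theorem ellipticEquiv_apply {a₁ a₂ : ℝ} (h₁ : 0 < a₁) (h₂ : 0 < a₂) (θ₀ ρ θ : ℝ) :
    ellipticEquiv h₁ h₂ θ₀ (ρ * Real.cos θ, ρ * Real.sin θ) = elliptic a₁ a₂ ρ (θ + θ₀) := by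
  change (!₂[Real.sqrt a₁ * (ρ * Real.cos θ * Real.cos θ₀ - ρ * Real.sin θ * Real.sin θ₀),
        Real.sqrt a₂ * (ρ * Real.cos θ * Real.sin θ₀ + ρ * Real.sin θ * Real.cos θ₀)] : Plane) = _
  ext i
  fin_cases i <;> simp [elliptic, Real.cos_add, Real.sin_add] <;> ring

/-- The part of the moving frame that parametrises space-time, up to a null set, by elliptic
coordinates with the branch of the angle around `θ₀`. -/
def frameBranch (s θ₀ T : ℝ) : Set (ℝ × ℝ × ℝ) :=
  {p | 0 < rad s p ∧ |p.2.1 - θ₀| < Real.pi ∧ p.2.2 ∈ Ioo 0 T}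

theorem measurableSet_frameBranch (s θ₀ T : ℝ) : MeasurableSet (frameBranch s θ₀ T) := by
  have h1 : MeasurableSet {p : ℝ × ℝ × ℝ | 0 < rad s p} :=
    (isOpen_lt continuous_const (contDiff_rad s).continuous).measurableSet
  have h2 : MeasurableSet {p : ℝ × ℝ × ℝ | |p.2.1 - θ₀| < Real.pi} :=
    (isOpen_lt (by fun_prop) continuous_const).measurableSet
  have h3 : MeasurableSet {p : ℝ × ℝ × ℝ | p.2.2 ∈ Ioo 0 T} :=
    (isOpen_Ioo.preimage (continuous_snd.comp continuous_snd)).measurableSet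
  exact h1.inter (h2.inter h3)

/-- Integration in the moving frame with the density `rad s` is integration over space-time. -/
theorem exists_lintegral_frameMap {a₁ a₂ s : ℝ} (h₁ : 0 < a₁) (h₂ : 0 < a₂) (hs : 0 < s)
    (θ₀ T : ℝ) :
    ∃ c : ENNReal, c ≠ 0 ∧ c ≠ ⊤ ∧ ∀ G : Plane × ℝ → ENNReal, Measurable G →
      ∫⁻ p in frameBranch s θ₀ T, ENNReal.ofReal (rad s p) * G (frameMap a₁ a₂ s p) =
        c * ∫⁻ q in slab (T / s), G q := by
  have i1 : (volume : Measure (ℝ × ℝ × ℝ)).IsAddHaarMeasure := by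
    have : ((volume : Measure ℝ).prod (volume : Measure ℝ)).IsAddHaarMeasure := inferInstance
    exact inferInstanceAs
      ((volume : Measure ℝ).prod ((volume : Measure ℝ).prod volume)).IsAddHaarMeasure
  have i2 : (volume : Measure (ℝ × ℝ)).IsAddHaarMeasure :=
    inferInstanceAs ((volume : Measure ℝ).prod (volume : Measure ℝ)).IsAddHaarMeasure
  have i3 : (volume : Measure ((ℝ × ℝ) × ℝ)).IsAddHaarMeasure :=
    inferInstanceAs ((volume : Measure (ℝ × ℝ)).prod (volume : Measure ℝ)).IsAddHaarMeasure
  obtain ⟨c₁, hc₁, hc₁', H₁⟩ := exists_lintegral_comp_continuousLinearEquiv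
    (frameEquiv hs.ne') volume volume
  obtain ⟨c₂, hc₂, hc₂', H₂⟩ := exists_lintegral_comp_continuousLinearEquiv
    (ellipticEquiv h₁ h₂ θ₀) volume volume
  have hs' : ENNReal.ofReal s ≠ 0 := by simpa using hs
  refine ⟨c₁ * (ENNReal.ofReal s * c₂), mul_ne_zero hc₁ (mul_ne_zero hs' hc₂),
    ENNReal.mul_ne_top hc₁' (ENNReal.mul_ne_top ENNReal.ofReal_ne_top hc₂'), fun G hG => ?_⟩
  have hcE : Continuous fun q : ℝ × ℝ => elliptic a₁ a₂ q.1 q.2 := by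
    have := (continuous_frameMap a₁ a₂ 1).fst.comp
      (g := fun p => (frameMap a₁ a₂ 1 p).1) (f := fun q : ℝ × ℝ => (q.1, q.2, (0 : ℝ)))
      (by fun_prop)
    simpa [frameMap, Function.comp_def] using this
  -- the integrand in the variables radius, angle relative to `θ₀`, and unscaled time
  set P : Set (ℝ × ℝ) := polarCoord.target with hP
  have hPm : MeasurableSet P := polarCoord.open_target.measurableSet
  set K : (ℝ × ℝ) × ℝ → ENNReal := fun q => (P ×ˢ Ioo 0 (T / s)).indicator
    (fun q => ENNReal.ofReal (s * q.1.1) * G (elliptic a₁ a₂ q.1.1 (q.1.2 + θ₀), q.2)) q with hK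
  have hin : Measurable fun q : (ℝ × ℝ) × ℝ =>
      ENNReal.ofReal (s * q.1.1) * G (elliptic a₁ a₂ q.1.1 (q.1.2 + θ₀), q.2) := by
    refine Measurable.mul (by fun_prop) (hG.comp ?_)
    refine Measurable.prodMk ?_ measurable_snd
    exact (hcE.comp (f := fun q : (ℝ × ℝ) × ℝ => (q.1.1, q.1.2 + θ₀)) (by fun_prop)).measurable
  have hKm : Measurable K := hin.indicator (hPm.prod measurableSet_Ioo)
  have e1 : ∫⁻ p in frameBranch s θ₀ T, ENNReal.ofReal (rad s p) * G (frameMap a₁ a₂ s p) =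
      ∫⁻ p, K (frameEquiv hs.ne' p - ((0, θ₀), 0)) := by
    rw [← lintegral_indicator (measurableSet_frameBranch s θ₀ T)]
    refine lintegral_congr fun p => ?_
    have hval : frameEquiv hs.ne' p - ((0, θ₀), 0) =
        ((p.1 + p.2.2 / s, p.2.1 - θ₀), p.2.2 / s) := by
      change ((p.1 + p.2.2 / s, p.2.1), p.2.2 / s) - ((0, θ₀), 0) = _
      simp
    have hrad : s * (p.1 + p.2.2 / s) = rad s p := by
      rw [rad]; field_simp; ring
    have hiff : p ∈ frameBranch s θ₀ T ↔
        ((p.1 + p.2.2 / s, p.2.1 - θ₀), p.2.2 / s) ∈ P ×ˢ Ioo 0 (T / s) := by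
      have : 0 < rad s p ↔ 0 < p.1 + p.2.2 / s := by
        rw [← hrad, mul_pos_iff_of_pos_left hs]
      simp only [frameBranch, mem_ofPred_eq, this, abs_lt, hP, polarCoord, mem_prod, mem_Ioi,
        mem_Ioo, div_pos_iff_of_pos_right hs, div_lt_div_iff_of_pos_right hs]
      tauto
    rw [hval]
    simp only [hK]
    by_cases hp : p ∈ frameBranch s θ₀ T
    · simp only [indicator_of_mem hp, indicator_of_mem (hiff.mp hp), hrad, sub_add_cancel, frameMap]
    · rw [indicator_of_notMem hp, indicator_of_notMem (fun h => hp (hiff.mpr h))]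
  have e2 : ∫⁻ p, K (frameEquiv hs.ne' p - ((0, θ₀), 0)) = c₁ * ∫⁻ q, K q := by
    rw [H₁ (fun q => K (q - ((0, θ₀), 0))) (hKm.comp (by fun_prop)),
      lintegral_sub_right_eq_self K]
  have e3 : ∀ t, ∫⁻ y, K (y, t) =
      (Ioo 0 (T / s)).indicator (fun t => ENNReal.ofReal s * (c₂ * ∫⁻ x, G (x, t))) t := by
    intro t
    by_cases ht : t ∈ Ioo 0 (T / s)
    · rw [indicator_of_mem ht]
      have hG' : Measurable fun x => G (x, t) := hG.comp measurable_prodMk_right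
      rw [← H₂ _ hG', ← lintegral_comp_polarCoord_symm
          (fun y => G (ellipticEquiv h₁ h₂ θ₀ y, t)), ← lintegral_const_mul' _ _
        ENNReal.ofReal_ne_top, ← lintegral_indicator hPm]
      refine lintegral_congr fun y => ?_
      by_cases hy : y ∈ P
      · rw [indicator_of_mem hy]
        simp only [hK]
        rw [indicator_of_mem (show (y, t) ∈ P ×ˢ Ioo 0 (T / s) from ⟨hy, ht⟩)]
        have : ellipticEquiv h₁ h₂ θ₀ (polarCoord.symm y) = elliptic a₁ a₂ y.1 (y.2 + θ₀) := by
          rw [← ellipticEquiv_apply h₁ h₂]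
          rfl
        simp only [this, ENNReal.ofReal_mul hs.le, smul_eq_mul]
        ring
      · rw [indicator_of_notMem hy]
        simp only [hK]
        rw [indicator_of_notMem (fun h => hy h.1)]
    · rw [indicator_of_notMem ht]
      have : ∀ y, K (y, t) = 0 := fun y => by
        simp only [hK]
        rw [indicator_of_notMem (fun h => ht h.2)]
      simp [this]
  have e4 : ∫⁻ q, K q = ENNReal.ofReal s * (c₂ * ∫⁻ q in slab (T / s), G q) := by
    rw [Measure.volume_eq_prod, lintegral_prod_symm _ hKm.aemeasurable]
    simp only [e3]
    rw [lintegral_indicator measurableSet_Ioo, lintegral_const_mul' _ _ ENNReal.ofReal_ne_top,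
      lintegral_const_mul' _ _ hc₂', slab, Measure.volume_eq_prod, ← Measure.prod_restrict,
      Measure.restrict_univ, lintegral_prod_symm _ hG.aemeasurable]
  rw [e1, e2, e4]
  ring

/-- The image of the moving frame, with the density `rad s`, is a multiple of Lebesgue measure on
space-time. -/
theorem exists_map_frameMap {a₁ a₂ s : ℝ} (h₁ : 0 < a₁) (h₂ : 0 < a₂) (hs : 0 < s) (θ₀ T : ℝ) :
    ∃ c : ENNReal, c ≠ 0 ∧ c ≠ ⊤ ∧
      ((volume.restrict (frameBranch s θ₀ T)).withDensity
        fun p => ENNReal.ofReal (rad s p)).map (frameMap a₁ a₂ s) =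
      c • volume.restrict (slab (T / s)) := by
  obtain ⟨c, hc, hc', H⟩ := exists_lintegral_frameMap h₁ h₂ hs θ₀ T
  refine ⟨c, hc, hc', Measure.ext_of_lintegral _ fun G hG => ?_⟩
  have hm := (continuous_frameMap a₁ a₂ s).measurable
  have hr : Measurable fun p => ENNReal.ofReal (rad s p) :=
    (contDiff_rad s).continuous.measurable.ennreal_ofReal
  rw [lintegral_map hG hm, lintegral_withDensity_eq_lintegral_mul (g := fun p => G (frameMap a₁ a₂ s p)) _ hr
    (hG.comp hm),
    lintegral_smul_measure, smul_eq_mul, ← H G hG]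
  rfl

/-- Integrable functions on space-time are integrable in the moving frame with the density
`rad s`. -/
theorem integrable_rad_mul_comp_frameMap {a₁ a₂ s T : ℝ} (h₁ : 0 < a₁) (h₂ : 0 < a₂) (hs : 0 < s)
    (θ₀ : ℝ) {G : Plane × ℝ → ℝ} (hG : IntegrableOn G (slab (T / s))) :
    IntegrableOn (fun p => rad s p * G (frameMap a₁ a₂ s p)) (frameBranch s θ₀ T) := by
  obtain ⟨c, hc, hc', H⟩ := exists_map_frameMap h₁ h₂ hs θ₀ T
  have hr : Measurable fun p => ENNReal.ofReal (rad s p) :=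
    (contDiff_rad s).continuous.measurable.ennreal_ofReal
  have h := hG.smul_measure hc'
  rw [← H] at h
  have h2 := h.comp_measurable (continuous_frameMap a₁ a₂ s).measurable
  rw [integrable_withDensity_iff_integrable_smul' hr (by simp)] at h2
  refine h2.congr ?_
  filter_upwards [ae_restrict_mem (measurableSet_frameBranch s θ₀ T)] with p hp
  simp [ENNReal.toReal_ofReal hp.1.le]

/-- A function on space-time with vanishing integral has vanishing integral in the moving frame
with the density `rad s`. -/
theorem setIntegral_rad_mul_comp_frameMap {a₁ a₂ s T : ℝ} (h₁ : 0 < a₁) (h₂ : 0 < a₂) (hs : 0 < s)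
    (θ₀ : ℝ) {G : Plane × ℝ → ℝ} (hG : IntegrableOn G (slab (T / s)))
    (h0 : ∫ q in slab (T / s), G q = 0) :
    ∫ p in frameBranch s θ₀ T, rad s p * G (frameMap a₁ a₂ s p) = 0 := by
  obtain ⟨c, hc, hc', H⟩ := exists_map_frameMap h₁ h₂ hs θ₀ T
  have hr : Measurable fun p => ENNReal.ofReal (rad s p) :=
    (contDiff_rad s).continuous.measurable.ennreal_ofReal
  have h := hG.smul_measure hc'
  have h2 : ∫ q, G q ∂(c • volume.restrict (slab (T / s))) = 0 := by
    rw [integral_smul_measure, h0, smul_zero]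
  rw [← H] at h h2
  rw [integral_map (continuous_frameMap a₁ a₂ s).measurable.aemeasurable h.1,
    integral_withDensity_eq_integral_toReal_smul hr (by simp)] at h2
  rw [← h2]
  refine setIntegral_congr_fun (measurableSet_frameBranch s θ₀ T) fun p hp => ?_
  simp [ENNReal.toReal_ofReal hp.1.le]

/-- Functions in `L^∞(0, τ; L²)` are square integrable on the slab. -/
theorem MemLinftyL2.memLp {τ : ℝ} {g : Plane × ℝ → ℝ} (h : MemLinftyL2 τ g) :
    MemLp g 2 (volume.restrict (slab τ)) := by
  obtain ⟨hm, M, hM⟩ := h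
  refine ⟨hm, ?_⟩
  have hprod : volume.restrict (slab τ) =
      (volume : Measure Plane).prod (volume.restrict (Ioo 0 τ)) := by
    rw [slab, Measure.volume_eq_prod, ← Measure.prod_restrict, Measure.restrict_univ]
  rw [hprod] at hm ⊢
  rw [eLpNorm_lt_top_iff_lintegral_rpow_enorm_lt_top (by norm_num) (by norm_num)]
  rw [lintegral_prod_symm _ (by fun_prop)]
  have hle : ∫⁻ t in Ioo 0 τ, ∫⁻ x, ‖g (x, t)‖ₑ ^ (2 : ENNReal).toReal ≤
      ∫⁻ t in Ioo 0 τ, (M : ENNReal) ^ (2 : ENNReal).toReal := by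
    refine lintegral_mono_ae ?_
    filter_upwards [hM] with t ht
    rw [eLpNorm_eq_lintegral_rpow_enorm_toReal (by norm_num) (by norm_num)] at ht
    have := ENNReal.rpow_le_rpow ht (z := (2 : ENNReal).toReal) (by norm_num)
    rwa [← ENNReal.rpow_mul, one_div, inv_mul_cancel₀ (by norm_num), ENNReal.rpow_one] at this
  refine hle.trans_lt ?_
  rw [setLIntegral_const]
  exact ENNReal.mul_lt_top (by simp) (by simp)

/-! ### The weakly dispersive equation in the moving frame -/

theorem tsupport_spacePartial_subset (i : Fin 2) (Φ : Plane × ℝ → ℝ) :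
    tsupport (spacePartial i Φ) ⊆ tsupport Φ := by
  refine closure_minimal (fun p hp => ?_) isClosed_closure
  by_contra hn
  exact hp (by simp [spacePartial, fderiv_of_notMem_tsupport (𝕜 := ℝ) hn])

theorem tsupport_timePartial_subset (Φ : Plane × ℝ → ℝ) :
    tsupport (timePartial Φ) ⊆ tsupport Φ := by
  refine closure_minimal (fun p hp => ?_) isClosed_closure
  by_contra hn
  exact hp (by simp [timePartial, fderiv_of_notMem_tsupport (𝕜 := ℝ) hn])

theorem PolyFamily.eq_zero_of_notMem {K : Set (ℝ × ℝ × ℝ)} {f : ℝ → ℝ × ℝ × ℝ → ℝ}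
    (hf : PolyFamily K f) (s : ℝ) {p : ℝ × ℝ × ℝ} (hp : p ∉ K) : f s p = 0 := by
  induction hf with
  | const _ hK => exact image_eq_zero_of_notMem_tsupport fun h => hp (hK h)
  | add _ _ h1 h2 => simp [h1, h2]
  | param_mul _ h => simp [h]

theorem MemLinftyL2.integrableOn_mul {τ : ℝ} {w G : Plane × ℝ → ℝ} (hw : MemLinftyL2 τ w)
    (hG : Continuous G) (hc : HasCompactSupport G) : IntegrableOn (fun p => w p * G p) (slab τ) :=
  hw.memLp.integrable_mul (q := 2) (hG.memLp_of_hasCompactSupport hc)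

/-- On a branch of the angle, points of the moving frame are the elliptic coordinates of their
images. -/
theorem IsFrameRep.apply_frameMap {a₁ a₂ s θ₀ T : ℝ} {Φ : Plane × ℝ → ℝ} {g : ℝ × ℝ × ℝ → ℝ}
    (hr : IsFrameRep a₁ a₂ s θ₀ Φ g) (hs : 0 < s) {p : ℝ × ℝ × ℝ} (hp : p ∈ frameBranch s θ₀ T) :
    Φ (frameMap a₁ a₂ s p) = g p := by
  have hrad : p.1 + p.2.2 / s = rad s p / s := by
    rw [rad]; field_simp; ring
  have hρ : 0 < p.1 + p.2.2 / s := by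
    rw [hrad]
    exact div_pos hp.1 hs
  rw [frameMap, hr.eq _ _ _ hρ hp.2.1, add_sub_cancel_right, mul_div_cancel₀ _ hs.ne']

theorem movingFrame_eq_comp_frameMap {a₁ a₂ ε θ₀ T : ℝ} (hε : 0 < ε) (w : Plane × ℝ → ℝ)
    {p : ℝ × ℝ × ℝ} (hp : p ∈ frameBranch (ε ^ 2) θ₀ T) :
    movingFrame a₁ a₂ ε w p = w (frameMap a₁ a₂ (ε ^ 2) p) := by
  have hrad : p.1 + p.2.2 / ε ^ 2 = rad (ε ^ 2) p / ε ^ 2 := by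
    rw [rad]; field_simp; ring
  have hρ : 0 < p.1 + p.2.2 / ε ^ 2 := by
    rw [hrad]
    exact div_pos hp.1 (by positivity)
  rw [movingFrame, if_pos (by linarith), frameMap]

theorem frameBranch_subset (s θ₀ T : ℝ) : frameBranch s θ₀ T ⊆ (frameDomain T : Set (ℝ × ℝ × ℝ)) :=
  fun _ hp => hp.2.2

theorem integrableOn_movingFrame_mul {a₁ a₂ ε θ₀ T : ℝ} (h₁ : 0 < a₁) (h₂ : 0 < a₂) (hε : 0 < ε)
    {w : Plane × ℝ → ℝ} (hw : MemLinftyL2 (T / ε ^ 2) w) {c : ℝ × ℝ × ℝ → ℝ}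
    (hcs : ContDiff ℝ ∞ c) (hcc : HasCompactSupport c)
    (hsupp : tsupport c ⊆ frameBranch (ε ^ 2) θ₀ T) :
    IntegrableOn (fun p => movingFrame a₁ a₂ ε w p * c p) (frameDomain T) := by
  have hs : 0 < ε ^ 2 := by positivity
  -- dividing by `rad` compensates the density of the change of variables
  set g : ℝ × ℝ × ℝ → ℝ := fun p => (rad (ε ^ 2) p)⁻¹ * c p with hg
  have hgc : tsupport g ⊆ tsupport c := tsupport_mul_subset_right
  have hgs : ContDiff ℝ ∞ g := by
    rw [contDiff_iff_contDiffAt]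
    intro p
    by_cases hp : p ∈ tsupport c
    · exact ((contDiff_rad _).contDiffAt.inv (hsupp hp).1.ne').mul hcs.contDiffAt
    · have h0 : g =ᶠ[𝓝 p] fun _ => 0 :=
        notMem_tsupport_iff_eventuallyEq.mp fun h => hp (hgc h)
      exact contDiffAt_const.congr_of_eventuallyEq h0
  obtain ⟨Φ, hr, hΦc, -⟩ := exists_isFrameRep h₁ h₂ hs θ₀ (T := T) hgs
    (hcc.of_isClosed_subset (isClosed_tsupport _) hgc) fun p hp =>
      let h := hsupp (hgc hp); ⟨h.2.2, h.2.1, h.1⟩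
  have hi := integrable_rad_mul_comp_frameMap h₁ h₂ hs θ₀
    (hw.integrableOn_mul hr.contDiff.continuous hΦc)
  refine IntegrableOn.of_forall_sdiff_eq_zero (s := frameBranch (ε ^ 2) θ₀ T) ?_
    (frameDomain T).isOpen.measurableSet ?_
  · refine hi.congr_fun (fun p hp => ?_) (measurableSet_frameBranch _ _ _)
    have hp0 : rad (ε ^ 2) p ≠ 0 := hp.1.ne'
    simp only [hr.apply_frameMap hs hp, movingFrame_eq_comp_frameMap hε w hp, hg]
    field_simp
  · intro p hp
    rw [image_eq_zero_of_notMem_tsupport fun h => hp.2 (hsupp h), mul_zero]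

/-- The weak formulation tested with the representation of `q⁴ η`, where `q = t + ε² r`: in the
moving frame the terms of order one cancel, and the factor `ε²` can be divided out. -/
theorem IsWeakSolution.integral_movingFrame {a₁ a₂ ε θ₀ T : ℝ} (h₁ : 0 < a₁) (h₂ : 0 < a₂)
    (hε : 0 < ε) {E : Matrix (Fin 2) (Fin 2) ℝ} {F : Tensor4} {f : Plane → ℝ} {w : Plane × ℝ → ℝ}
    (hw : IsWeakSolution (Matrix.diagonal ![a₁, a₂]) E F ε (T / ε ^ 2) f w)
    {η : ℝ × ℝ × ℝ → ℝ} (hη : ContDiff ℝ ∞ η) (hηc : HasCompactSupport η)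
    (hsupp : tsupport η ⊆ frameBranch (ε ^ 2) θ₀ T) :
    ∫ p in (frameDomain T : Set (ℝ × ℝ × ℝ)), movingFrame a₁ a₂ ε w p *
      (rad (ε ^ 2) p * frameOp a₁ a₂ E F η (ε ^ 2) p) = 0 := by
  have hs : 0 < ε ^ 2 := by positivity
  have hgs : ContDiff ℝ ∞ fun p => rad (ε ^ 2) p ^ 4 * η p := ((contDiff_rad _).pow 4).mul hη
  have hgη : tsupport (fun p => rad (ε ^ 2) p ^ 4 * η p) ⊆ tsupport η := tsupport_mul_subset_right
  obtain ⟨Φ, hr, hΦc, hΦ⟩ := exists_isFrameRep h₁ h₂ hs θ₀ (T := T) hgs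
    (hηc.of_isClosed_subset (isClosed_tsupport _) hgη) fun p hp =>
      let h := hsupp (hgη hp); ⟨h.2.2, h.2.1, h.1⟩
  have hweak := hw.weak_eq Φ hr.contDiff hΦc
    (hΦ.trans (prod_mono_right fun t ht => ht.2))
  have hdt : ∀ x, dt 1 Φ x 0 = 0 := fun x => by
    rw [dt_one hr.contDiff]
    refine image_eq_zero_of_notMem_tsupport fun h => ?_
    exact lt_irrefl _ (hΦ (tsupport_timePartial_subset _ h)).2.1
  have hop : ∀ x, opD2 E (fun _ : Plane => (0 : ℝ)) x = 0 := fun x => by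
    have hpd : ∀ i, pd i (fun _ : Plane => (0 : ℝ)) = fun _ => 0 := fun i => by
      ext x
      simp [pd]
    simp [opD2, hpd]
  simp only [hdt, hop, mul_zero, sub_zero, integral_zero, add_zero,
    weak_integrand_eq hr.contDiff] at hweak
  set op : Plane × ℝ → ℝ := fun p => timePartial (timePartial Φ) p
      - (∑ i, ∑ j, (Matrix.diagonal ![a₁, a₂] : Matrix (Fin 2) (Fin 2) ℝ) i j *
          spacePartial i (spacePartial j Φ) p)
      - ε ^ 2 * (∑ i, ∑ j, E i j *
          spacePartial i (spacePartial j (timePartial (timePartial Φ))) p)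
      + ε ^ 2 * ∑ i, ∑ j, ∑ k, ∑ l, F i j k l *
          spacePartial i (spacePartial j (spacePartial k (spacePartial l Φ))) p with hopdef
  have ctt := contDiff_timePartial (contDiff_timePartial hr.contDiff)
  have hopc : Continuous op := by
    have d1 := fun l => contDiff_spacePartial hr.contDiff l
    have d2 := fun l k => contDiff_spacePartial (d1 l) k
    have d4 := fun l k j i =>
      (contDiff_spacePartial (contDiff_spacePartial (d2 l k) j) i).continuous
    have dt2 := fun j i => (contDiff_spacePartial (contDiff_spacePartial ctt j) i).continuous
    have d2' := fun l k => (d2 l k).continuous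
    have ctt' := ctt.continuous
    rw [hopdef]
    fun_prop
  have hopcs : HasCompactSupport op := by
    refine HasCompactSupport.intro hΦc fun p hp => ?_
    have z1 : timePartial (timePartial Φ) p = 0 := image_eq_zero_of_notMem_tsupport fun h =>
      hp (tsupport_timePartial_subset _ (tsupport_timePartial_subset _ h))
    have z2 : ∀ i j, spacePartial i (spacePartial j Φ) p = 0 := fun i j =>
      image_eq_zero_of_notMem_tsupport fun h =>
        hp (tsupport_spacePartial_subset _ _ (tsupport_spacePartial_subset _ _ h))
    have z3 : ∀ i j, spacePartial i (spacePartial j (timePartial (timePartial Φ))) p = 0 :=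
      fun i j => image_eq_zero_of_notMem_tsupport fun h =>
        hp (tsupport_timePartial_subset _ (tsupport_timePartial_subset _
          (tsupport_spacePartial_subset _ _ (tsupport_spacePartial_subset _ _ h))))
    have z4 : ∀ i j k l,
        spacePartial i (spacePartial j (spacePartial k (spacePartial l Φ))) p = 0 :=
      fun i j k l => image_eq_zero_of_notMem_tsupport fun h =>
        hp (tsupport_spacePartial_subset _ _ (tsupport_spacePartial_subset _ _
          (tsupport_spacePartial_subset _ _ (tsupport_spacePartial_subset _ _ h))))
    simp [hopdef, z1, z2, z3, z4]
  have hzero := setIntegral_rad_mul_comp_frameMap h₁ h₂ hs θ₀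
    (hw.memSolutionSpace.1.integrableOn_mul hopc hopcs) hweak
  rw [setIntegral_eq_of_subset_of_forall_sdiff_eq_zero (frameDomain T).isOpen.measurableSet
    (frameBranch_subset (ε ^ 2) θ₀ T)]
  · apply mul_left_cancel₀ hs.ne'
    rw [mul_zero, ← hzero, ← integral_const_mul]
    refine setIntegral_congr_fun (measurableSet_frameBranch _ _ _) fun p hp => ?_
    have hrad : p.1 + p.2.2 / ε ^ 2 = rad (ε ^ 2) p / ε ^ 2 := by
      rw [rad]; field_simp; ring
    have hρ : 0 < p.1 + p.2.2 / ε ^ 2 := by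
      rw [hrad]
      exact div_pos hp.1 hs
    have hv := hr.weak_integrand h₁ h₂ hη E F (p.2.2 / ε ^ 2) hρ hp.2.1
    rw [add_sub_cancel_right, mul_div_cancel₀ _ hs.ne'] at hv
    simp only [movingFrame_eq_comp_frameMap hε w hp]
    change _ = rad (ε ^ 2) p * (w (frameMap a₁ a₂ (ε ^ 2) p) * op (frameMap a₁ a₂ (ε ^ 2) p))
    rw [show op (frameMap a₁ a₂ (ε ^ 2) p) = ε ^ 2 * frameOp a₁ a₂ E F η (ε ^ 2) p from hv]
    ring
  · intro p hp
    rw [(polyFamily_frameOp a₁ a₂ E F hη).eq_zero_of_notMem _ fun h => hp.2 (hsupp h)]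
    simp

/-- For a compact set on which `t` is positive, `t + s r` is positive for small `s`. -/
theorem eventually_rad_pos {K : Set (ℝ × ℝ × ℝ)} (hK : IsCompact K) (hpos : ∀ p ∈ K, 0 < p.2.2)
    {s : ℕ → ℝ} (hs : Tendsto s atTop (𝓝 0)) : ∀ᶠ n in atTop, ∀ p ∈ K, 0 < rad (s n) p := by
  have h : ∀ᶠ σ in 𝓝 (0 : ℝ), ∀ p ∈ K, 0 < rad σ p := by
    refine hK.eventually_forall_of_forall_eventually fun p hp => ?_
    have hc : Continuous fun z : ℝ × (ℝ × ℝ × ℝ) => rad z.1 z.2 := by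
      unfold rad
      fun_prop
    refine hc.continuousAt.eventually (lt_mem_nhds ?_)
    simpa [rad] using hpos p hp
  exact hs.eventually h

/-- The limit distribution annihilates the images of test functions, supported in one branch of
the angle, under the limit of the weakly dispersive operator. -/
theorem exists_testFunction_apply_eq_zero {a₁ a₂ T : ℝ} (h₁ : 0 < a₁) (h₂ : 0 < a₂)
    {E : Matrix (Fin 2) (Fin 2) ℝ} {F : Tensor4} {ε : ℕ → ℝ} (hε : ∀ n, 0 < ε n)
    (hε0 : Tendsto ε atTop (𝓝 0)) {f : ℕ → Plane → ℝ} {w : ℕ → Plane × ℝ → ℝ}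
    (hw : ∀ n, IsWeakSolution (Matrix.diagonal ![a₁, a₂]) E F (ε n) (T / ε n ^ 2) (f n) (w n))
    {W : 𝓓'(frameDomain T, ℝ)}
    (hW : TendstoInDistributions (fun n => movingFrame a₁ a₂ (ε n) (w n)) W)
    {θ₀ : ℝ} (η : 𝓓(frameDomain T, ℝ)) (hθ : ∀ p ∈ tsupport η, |p.2.1 - θ₀| < Real.pi) :
    ∃ ψ : 𝓓(frameDomain T, ℝ), (∀ p, ψ p = p.2.2 * frameOp a₁ a₂ E F η 0 p) ∧ W ψ = 0 := by
  have hs : Tendsto (fun n => ε n ^ 2) atTop (𝓝 0) := by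
    simpa using hε0.pow 2
  have hK : IsCompact (tsupport η) := η.hasCompactSupport
  have hev := eventually_rad_pos hK (fun p hp => (η.tsupport_subset hp).1) hs
  have hbranch : ∀ᶠ n in atTop, tsupport η ⊆ frameBranch (ε n ^ 2) θ₀ T := by
    filter_upwards [hev] with n hn p hp
    exact ⟨hn p hp, hθ p hp, η.tsupport_subset hp⟩
  obtain ⟨-, ψ, hψ, hlim⟩ := PolyFamily.tendsto_integral η.tsupport_subset hK hW
    (fun c hc hcK => by
      filter_upwards [hbranch] with n hn
      exact integrableOn_movingFrame_mul h₁ h₂ (hε n) (hw n).memSolutionSpace.1 hc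
        (hK.of_isClosed_subset (isClosed_tsupport _) hcK) (hcK.trans hn)) hs
    (polyFamily_frameOp a₁ a₂ E F η.contDiff).rad_mul
  refine ⟨ψ, fun p => ?_, ?_⟩
  · rw [hψ, rad]
    simp
  · refine tendsto_nhds_unique hlim (tendsto_const_nhds.congr' ?_)
    filter_upwards [hbranch] with n hn
    exact ((hw n).integral_movingFrame h₁ h₂ (hε n) η.contDiff η.hasCompactSupport hn).symm

/-! ### The linearized cylindrical Korteweg-de Vries equation -/

theorem coe_lineDerivOp {Ω : TopologicalSpace.Opens (ℝ × ℝ × ℝ)} (v : ℝ × ℝ × ℝ) (η : 𝓓(Ω, ℝ)) :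
    ((∂_{v} η : 𝓓(Ω, ℝ)) : ℝ × ℝ × ℝ → ℝ) = dd v η := by
  ext p
  change TestFunction.lineDerivCLM ℝ v η p = _
  rw [TestFunction.lineDerivCLM_apply_of_le (by simp), dd,
    (η.contDiff.differentiable (by simp) p).lineDeriv_eq_fderiv]

theorem mulTest_apply {Ω : TopologicalSpace.Opens (ℝ × ℝ × ℝ)} {g : ℝ × ℝ × ℝ → ℝ}
    (hg : ContDiffOn ℝ ∞ g Ω) (η : 𝓓(Ω, ℝ)) (p : ℝ × ℝ × ℝ) : mulTest g hg η p = g p * η p :=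
  rfl

theorem lineDerivOp_distribution_apply {Ω : TopologicalSpace.Opens (ℝ × ℝ × ℝ)}
    (v : ℝ × ℝ × ℝ) (W : 𝓓'(Ω, ℝ)) (η : 𝓓(Ω, ℝ)) : (∂_{v} W) η = -W (∂_{v} η) := by
  rw [Distribution.lineDerivOp_apply_apply]
  simp

/-- The dispersion coefficient is the symbol of `F D⁴ - E D²`, because the symbol of `A D²` equals
one at `ξ = ∇ r`. -/
theorem IsDecomposition.kappa_eq {a₁ a₂ : ℝ} (h₁ : 0 < a₁) (h₂ : 0 < a₂) {C F : Tensor4}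
    {E : Matrix (Fin 2) (Fin 2) ℝ} (h : IsDecomposition (Matrix.diagonal ![a₁, a₂]) C E F) (φ : ℝ) :
    (∑ i, ∑ j, ∑ k, ∑ l, F i j k l * (xi a₁ a₂ i φ * xi a₁ a₂ j φ * xi a₁ a₂ k φ * xi a₁ a₂ l φ))
      - ∑ i, ∑ j, E i j * (xi a₁ a₂ i φ * xi a₁ a₂ j φ) = kappa a₁ a₂ C φ := by
  have hs := h.symbol fun i => xi a₁ a₂ i φ
  have hA : ∑ i, ∑ j, (Matrix.diagonal ![a₁, a₂] : Matrix (Fin 2) (Fin 2) ℝ) i j *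
      (xi a₁ a₂ i φ * xi a₁ a₂ j φ) = 1 := by
    rw [← sum_xi_xi h₁ h₂ φ]
    simp [Fin.sum_univ_two]
    ring
  have hk : kappa a₁ a₂ C φ = ∑ i, ∑ j, ∑ k, ∑ l,
      C i j k l * (xi a₁ a₂ i φ * xi a₁ a₂ j φ * xi a₁ a₂ k φ * xi a₁ a₂ l φ) := by
    simp only [kappa, xi, mul_assoc]
  rw [hA, mul_one] at hs
  rw [hk]
  linarith

/-- The left-hand side of the linearized cylindrical Korteweg-de Vries equation, tested with `η`. -/
def kdvPairing (a₁ a₂ : ℝ) (C : Tensor4) (T : ℝ) (U : 𝓓'(frameDomain T, ℝ))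
    (η : 𝓓(frameDomain T, ℝ)) : ℝ :=
  (∂_{dirT} U) η
    + U (mulTest (fun p => 1 / (2 * p.2.2)) (contDiffOn_one_div_two_mul T) η)
    - (1 / 2) * (∂_{dirR} (∂_{dirR} (∂_{dirR} U)))
        (mulTest (fun p => kappa a₁ a₂ C p.2.1) (contDiffOn_kappa a₁ a₂ C T) η)

/-- All derivatives moved to the test functions. -/
theorem lineDerivOp_pairing {Ω : TopologicalSpace.Opens (ℝ × ℝ × ℝ)} (W : 𝓓'(Ω, ℝ))
    (ζ χ₁ χ₂ ψ : 𝓓(Ω, ℝ)) (hψ : ∀ p, ψ p = dd dirR (dd dirT ζ) p - dd dirR χ₁ p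
      - (1 / 2) * dd dirR (dd dirR (dd dirR (dd dirR χ₂))) p) :
    (∂_{dirT} (∂_{dirR} W)) ζ + (∂_{dirR} W) χ₁
      - (1 / 2) * (∂_{dirR} (∂_{dirR} (∂_{dirR} (∂_{dirR} W)))) χ₂ = W ψ := by
  have e : ψ = ∂_{dirR} (∂_{dirT} ζ) - ∂_{dirR} χ₁
      - (1 / 2 : ℝ) • ∂_{dirR} (∂_{dirR} (∂_{dirR} (∂_{dirR} χ₂))) := by
    ext p
    simp only [hψ, ← coe_lineDerivOp]
    rfl
  rw [e]
  simp only [lineDerivOp_distribution_apply, map_sub, map_smul, neg_neg, smul_eq_mul]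
  ring

theorem kdvPairing_add (a₁ a₂ : ℝ) (C : Tensor4) (T : ℝ) (U : 𝓓'(frameDomain T, ℝ))
    (η₁ η₂ : 𝓓(frameDomain T, ℝ)) :
    kdvPairing a₁ a₂ C T U (η₁ + η₂) =
      kdvPairing a₁ a₂ C T U η₁ + kdvPairing a₁ a₂ C T U η₂ := by
  have hm : ∀ (g : ℝ × ℝ × ℝ → ℝ) (hg : ContDiffOn ℝ ∞ g (frameDomain T)),
      mulTest g hg (η₁ + η₂) = mulTest g hg η₁ + mulTest g hg η₂ := fun g hg => by
    ext p
    exact mul_add _ _ _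
  simp only [kdvPairing, hm, map_add]
  ring

theorem contDiff_kappa (a₁ a₂ : ℝ) (C : Tensor4) : ContDiff ℝ ∞ (kappa a₁ a₂ C) := by
  change ContDiff ℝ ∞ fun φ => kappa a₁ a₂ C φ
  simp only [kappa, Fin.sum_univ_two, Matrix.cons_val_zero, Matrix.cons_val_one]
  fun_prop

theorem dd_dirT_dirR_comm {h : ℝ × ℝ × ℝ → ℝ} (hh : ContDiff ℝ ∞ h) :
    dd dirT (dd dirR h) = dd dirR (dd dirT h) := by
  have d2 : Differentiable ℝ (fderiv ℝ h) :=
    (hh.fderiv_right (m := ∞) (by simp)).differentiable (by simp)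
  have key : ∀ v w p, dd v (dd w h) p = fderiv ℝ (fderiv ℝ h) p v w := by
    intro v w p
    have := (d2 p).hasFDerivAt.clm_apply (hasFDerivAt_const w p)
    refine (congrArg (fun L : (ℝ × ℝ × ℝ) →L[ℝ] ℝ => L v) this.fderiv).trans ?_
    simp
  ext p
  rw [key, key]
  exact (hh.contDiffAt.isSymmSndFDerivAt (by simpa using WithTop.coe_le_coe.mpr (le_top (a := (2 : ℕ∞))))) dirT dirR

theorem dd_dirR_four_mul {b : ℝ × ℝ → ℝ} (hb : ContDiff ℝ ∞ b) {f : ℝ × ℝ × ℝ → ℝ}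
    (hf : ContDiff ℝ ∞ f) : dd dirR (dd dirR (dd dirR (dd dirR fun p => b p.2 * f p))) =
      fun p => b p.2 * dd dirR (dd dirR (dd dirR (dd dirR f))) p := by
  have c1 := contDiff_dd hf dirR
  have c2 := contDiff_dd c1 dirR
  rw [dd_dirR_mul hb hf, dd_dirR_mul hb c1, dd_dirR_mul hb c2, dd_dirR_mul hb (contDiff_dd c2 _)]

/-- The equation for test functions supported in one branch of the angle. The test function
`ζ / (2 t⁵)` is used: the factor `t⁵` is produced by the powers of the radius that clear the
denominators of the operator and by the density of the change of variables. -/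
theorem kdvPairing_eq_zero_of_branch {a₁ a₂ T : ℝ} (h₁ : 0 < a₁) (h₂ : 0 < a₂)
    {C : Tensor4} {E : Matrix (Fin 2) (Fin 2) ℝ} {F : Tensor4}
    (hdec : IsDecomposition (Matrix.diagonal ![a₁, a₂]) C E F)
    {ε : ℕ → ℝ} (hε : ∀ n, 0 < ε n)
    (hε0 : Tendsto ε atTop (𝓝 0)) {f : ℕ → Plane → ℝ} {w : ℕ → Plane × ℝ → ℝ}
    (hw : ∀ n, IsWeakSolution (Matrix.diagonal ![a₁, a₂]) E F (ε n) (T / ε n ^ 2) (f n) (w n))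
    {W : 𝓓'(frameDomain T, ℝ)}
    (hW : TendstoInDistributions (fun n => movingFrame a₁ a₂ (ε n) (w n)) W)
    {θ₀ : ℝ} (ζ : 𝓓(frameDomain T, ℝ)) (hθ : ∀ p ∈ tsupport ζ, |p.2.1 - θ₀| < Real.pi) :
    kdvPairing a₁ a₂ C T (∂_{dirR} W) ζ = 0 := by
  have hg : ContDiffOn ℝ ∞ (fun p : ℝ × ℝ × ℝ => 1 / (2 * p.2.2 ^ 5)) (frameDomain T) := by
    refine ContDiffOn.div contDiffOn_const (by fun_prop) fun p hp => ?_
    have h0 : 0 < p.2.2 := hp.1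
    positivity
  set η : 𝓓(frameDomain T, ℝ) := mulTest _ hg ζ with hη
  have hsupp : tsupport η ⊆ tsupport ζ := tsupport_mul_subset_right
  obtain ⟨ψ, hψ, hWψ⟩ := exists_testFunction_apply_eq_zero h₁ h₂ hε hε0 hw hW η
    fun p hp => hθ p (hsupp hp)
  have hζη : (ζ : ℝ × ℝ × ℝ → ℝ) = fun p => 2 * p.2.2 ^ 5 * η p := by
    ext p
    change ζ p = 2 * p.2.2 ^ 5 * (1 / (2 * p.2.2 ^ 5) * ζ p)
    by_cases hp : p.2.2 = 0
    · have : ζ p = 0 := image_eq_zero_of_notMem_tsupport fun h =>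
        (ζ.tsupport_subset h).1.ne' hp
      rw [this]
      ring
    · field_simp
  have cη : ContDiff ℝ ∞ (η : ℝ × ℝ × ℝ → ℝ) := η.contDiff
  have cζ : ContDiff ℝ ∞ (ζ : ℝ × ℝ × ℝ → ℝ) := ζ.contDiff
  -- the derivatives of the test functions in the pairing in terms of `η`
  have hζr : dd dirR ζ = fun p => 2 * p.2.2 ^ 5 * dd dirR η p := by
    rw [hζη]
    exact dd_dirR_mul (b := fun u : ℝ × ℝ => 2 * u.2 ^ 5) (by fun_prop) cη
  have hpow : ∀ p : ℝ × ℝ × ℝ, dd dirT (fun p => 2 * p.2.2 ^ 5) p = 10 * p.2.2 ^ 4 := by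
    intro p
    have h := dd_rad_pow 0 4 dirT p
    simp only [rad, zero_mul, add_zero] at h
    have hd : Differentiable ℝ fun p : ℝ × ℝ × ℝ => p.2.2 ^ (4 + 1) := by fun_prop
    rw [show (fun p : ℝ × ℝ × ℝ => 2 * p.2.2 ^ 5) = fun p => 2 * p.2.2 ^ (4 + 1) from rfl,
      dd_const_mul 2 hd]
    change 2 * dd dirT (fun p : ℝ × ℝ × ℝ => p.2.2 ^ (4 + 1)) p = _
    rw [h, dirT]
    push_cast
    ring
  have hζrt : dd dirR (dd dirT ζ) = fun p =>
      10 * p.2.2 ^ 4 * dd dirR η p + 2 * p.2.2 ^ 5 * dd dirT (dd dirR η) p := by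
    rw [← dd_dirT_dirR_comm cζ, hζr,
      dd_mul (by fun_prop) ((contDiff_dd cη _).differentiable (by simp))]
    simp only [hpow]
  set χ₁ : 𝓓(frameDomain T, ℝ) :=
    mulTest (fun p => 1 / (2 * p.2.2)) (contDiffOn_one_div_two_mul T) ζ with hχ₁
  have hdiv : (χ₁ : ℝ × ℝ × ℝ → ℝ) = fun p => p.2.2 ^ 4 * η p := by
    ext p
    rw [hχ₁, mulTest_apply, hζη]
    by_cases hp : p.2.2 = 0
    · simp [hp]
    · field_simp
  have hdiv' : dd dirR χ₁ = fun p => p.2.2 ^ 4 * dd dirR η p := by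
    rw [hdiv]
    exact dd_dirR_mul (b := fun u : ℝ × ℝ => u.2 ^ 4) (by fun_prop) cη
  set χ₂ : 𝓓(frameDomain T, ℝ) :=
    mulTest (fun p => kappa a₁ a₂ C p.2.1) (contDiffOn_kappa a₁ a₂ C T) ζ with hχ₂
  have hkap : (χ₂ : ℝ × ℝ × ℝ → ℝ) =
      fun p => (kappa a₁ a₂ C p.2.1 * (2 * p.2.2 ^ 5)) * η p := by
    ext p
    rw [hχ₂, mulTest_apply, hζη]
    ring
  have cb : ContDiff ℝ ∞ fun u : ℝ × ℝ => kappa a₁ a₂ C u.1 * (2 * u.2 ^ 5) :=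
    ((contDiff_kappa a₁ a₂ C).comp contDiff_fst).mul (by fun_prop)
  have hpair := lineDerivOp_pairing W ζ χ₁ χ₂ (-ψ) fun p => by
    change -(ψ p) = _
    rw [hζrt, hdiv', hkap, dd_dirR_four_mul cb cη, hψ, frameOp_zero a₁ a₂ E F cη,
      hdec.kappa_eq h₁ h₂, dd_dirT_dirR_comm cη]
    ring
  rw [kdvPairing, hpair, map_neg, hWψ, neg_zero]

/-- The equation for all test functions, by cutting the test function into pieces that are
supported in angular strips of width two, so that each of them sees only one branch of the
angle. -/
theorem solvesLinearizedKdV_of_tendsto {a₁ a₂ T : ℝ} (h₁ : 0 < a₁) (h₂ : 0 < a₂)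
    {C : Tensor4} {E : Matrix (Fin 2) (Fin 2) ℝ} {F : Tensor4}
    (hdec : IsDecomposition (Matrix.diagonal ![a₁, a₂]) C E F)
    {ε : ℕ → ℝ} (hε : ∀ n, 0 < ε n)
    (hε0 : Tendsto ε atTop (𝓝 0)) {f : ℕ → Plane → ℝ} {w : ℕ → Plane × ℝ → ℝ}
    (hw : ∀ n, IsWeakSolution (Matrix.diagonal ![a₁, a₂]) E F (ε n) (T / ε n ^ 2) (f n) (w n))
    {W : 𝓓'(frameDomain T, ℝ)}
    (hW : TendstoInDistributions (fun n => movingFrame a₁ a₂ (ε n) (w n)) W) :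
    SolvesLinearizedKdV a₁ a₂ C T (∂_{dirR} W) := by
  have hbase : ∀ (θ₀ : ℝ) (ζ : 𝓓(frameDomain T, ℝ)),
      (∀ p ∈ tsupport ζ, p.2.1 ∈ Icc (θ₀ - 1) (θ₀ + 1)) →
      kdvPairing a₁ a₂ C T (∂_{dirR} W) ζ = 0 := fun θ₀ ζ hζ =>
    kdvPairing_eq_zero_of_branch h₁ h₂ hdec hε hε0 hw hW ζ (θ₀ := θ₀) fun p hp => by
      have h := hζ p hp
      have : |p.2.1 - θ₀| ≤ 1 := abs_le.mpr ⟨by linarith [h.1], by linarith [h.2]⟩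
      linarith [Real.pi_gt_three]
  have hind : ∀ (N : ℕ) (a : ℝ) (ζ : 𝓓(frameDomain T, ℝ)),
      (∀ p ∈ tsupport ζ, p.2.1 ∈ Icc a (a + N + 1)) →
      kdvPairing a₁ a₂ C T (∂_{dirR} W) ζ = 0 := by
    intro N a
    induction N with
    | zero =>
      intro ζ hζ
      refine hbase a ζ fun p hp => ?_
      have h := hζ p hp
      simp only [CharP.cast_eq_zero, add_zero] at h
      exact ⟨by linarith [h.1], h.2⟩
    | succ N ih =>
      intro ζ hζ
      have cσ : ContDiff ℝ ∞ fun p : ℝ × ℝ × ℝ => Real.smoothTransition (p.2.1 - (a + N)) :=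
        Real.smoothTransition.contDiff.comp (by fun_prop)
      have cσ' : ContDiff ℝ ∞ fun p : ℝ × ℝ × ℝ => 1 - Real.smoothTransition (p.2.1 - (a + N)) :=
        contDiff_const.sub cσ
      have hsplit : ζ = mulTest _ cσ.contDiffOn ζ + mulTest _ cσ'.contDiffOn ζ := by
        ext p
        change ζ p = Real.smoothTransition (p.2.1 - (a + N)) * ζ p
          + (1 - Real.smoothTransition (p.2.1 - (a + N))) * ζ p
        ring
      rw [hsplit, kdvPairing_add, hbase (a + N + 1), ih, add_zero]
      · intro p hp
        have h1 : tsupport (mulTest _ cσ'.contDiffOn ζ) ⊆ {p | p.2.1 ≤ a + N + 1} := by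
          refine closure_minimal (fun p hp => ?_) (isClosed_le (by fun_prop) continuous_const)
          by_contra hn
          refine hp ?_
          change (1 - Real.smoothTransition (p.2.1 - (a + N))) * ζ p = 0
          rw [Real.smoothTransition.one_of_one_le, sub_self, zero_mul]
          have : ¬ p.2.1 ≤ a + N + 1 := hn
          linarith
        exact ⟨(hζ p (tsupport_mul_subset_right hp)).1, h1 hp⟩
      · intro p hp
        have h1 : tsupport (mulTest _ cσ.contDiffOn ζ) ⊆ {p | a + N ≤ p.2.1} := by
          refine closure_minimal (fun p hp => ?_) (isClosed_le continuous_const (by fun_prop))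
          by_contra hn
          refine hp ?_
          change Real.smoothTransition (p.2.1 - (a + N)) * ζ p = 0
          rw [Real.smoothTransition.zero_of_nonpos, zero_mul]
          have : ¬ a + N ≤ p.2.1 := hn
          linarith
        have h2 := (hζ p (tsupport_mul_subset_right hp)).2
        have h3 : a + N ≤ p.2.1 := h1 hp
        push_cast at h2
        exact ⟨by linarith, by linarith⟩
  intro ζ
  have hc : IsCompact (tsupport ζ) := ζ.hasCompactSupport
  obtain ⟨R, hR⟩ := (hc.image (f := fun p : ℝ × ℝ × ℝ => |p.2.1|) (by fun_prop)).bddAbove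
  obtain ⟨N, hN⟩ := exists_nat_ge (2 * R)
  refine hind N (-R) ζ fun p hp => ?_
  have h := abs_le.mp (hR ⟨p, hp, rfl⟩)
  exact ⟨h.1, by linarith [h.2]⟩

end

end MovingFrame

theorem mainTheorem3
    (aY : MovingFrame.Plane → Matrix (Fin 2) (Fin 2) ℝ)
    (hmedium : MovingFrame.IsMedium aY) (hsymm : MovingFrame.EvenlySymmetric aY)
    (A : Matrix (Fin 2) (Fin 2) ℝ) (hA : A = MovingFrame.effA aY)
    (C : MovingFrame.Tensor4) (hC : C = MovingFrame.effC aY)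
    (a₁ a₂ : ℝ) (ha₁ : a₁ = A 0 0) (ha₂ : a₂ = A 1 1)
    (E : Matrix (Fin 2) (Fin 2) ℝ) (F : MovingFrame.Tensor4)
    (hE : E.PosSemidef) (hF : MovingFrame.IsPosSemidef4 F)
    (hdecomp : MovingFrame.IsDecomposition A C E F)
    (T : ℝ) (hT : 0 < T)
    (ε : ℕ → ℝ) (hε : ∀ n, 0 < ε n) (hε0 : Filter.Tendsto ε Filter.atTop (nhds 0))
    (f : ℕ → MovingFrame.Plane → ℝ) (hf : ∀ n, MovingFrame.MemH2 (f n))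
    (w : ℕ → MovingFrame.Plane × ℝ → ℝ)
    (hw : ∀ n, MovingFrame.IsWeakSolution A E F (ε n) (T / ε n ^ 2) (f n) (w n))
    (W : 𝓓'(MovingFrame.frameDomain T, ℝ))
    (hW : MovingFrame.TendstoInDistributions
      (fun n => MovingFrame.movingFrame a₁ a₂ (ε n) (w n)) W) :
    A = Matrix.diagonal ![a₁, a₂] ∧ 0 < a₁ ∧ 0 < a₂ ∧
    (∀ φ : ℝ, MovingFrame.kappa a₁ a₂ C φ =
      6 * C 0 0 1 1 * (Real.cos φ ^ 2 / a₁) * (Real.sin φ ^ 2 / a₂)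
        + C 0 0 0 0 * (Real.cos φ ^ 4 / a₁ ^ 2) + C 1 1 1 1 * (Real.sin φ ^ 4 / a₂ ^ 2)) ∧
    MovingFrame.SolvesLinearizedKdV a₁ a₂ C T (∂_{MovingFrame.dirR} W) := by
  have hdiag : A = Matrix.diagonal ![a₁, a₂] := by
    ext i j
    by_cases h : i = j
    · subst h
      fin_cases i <;> simp [ha₁, ha₂]
    · rw [Matrix.diagonal_apply_ne _ h, hA, MovingFrame.effA_eq_zero hsymm h]
  have h₁ : 0 < a₁ := by
    rw [ha₁, hA]
    exact MovingFrame.effA_diag_pos hmedium 0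
  have h₂ : 0 < a₂ := by
    rw [ha₂, hA]
    exact MovingFrame.effA_diag_pos hmedium 1
  refine ⟨hdiag, h₁, h₂, fun φ => ?_, ?_⟩
  · rw [hC]
    exact MovingFrame.kappa_effC hmedium hsymm h₁ h₂ φ
  · rw [hdiag] at hdecomp hw
    exact MovingFrame.solvesLinearizedKdV_of_tendsto h₁ h₂ hdecomp hε hε0 hw hW
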